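/- **Models.** Fix $p\in(0,1)$ and put $h=p/(1+p)$. Consider $n$ sites $0,1,\dots,n-1$ on a circle, with $\lceil \rho n\rceil$ particles, at most one per site, where $0<\rho<1$ is constant. Time is discrete. *Zero-range model with parameters $p$ and $\pi\in(0,1]$.* In each time slot all particles decide independently: a particle whose right neighbour site is occupied does not move; a particle with holes as both neighbours moves one site to the right with probability $\pi$; a particle with a hole as right neighbour and a particle as left neighbour moves one site to the right with probability $p$. For $\pi=1$ this is the basic model TASEP-H. The steady-state flux $\phi_\pi(\rho;n)$ is the expected number of particle moves per site per time slot under a stationary distribution, and $\phi_\pi(\rho)=\lim_{n\to\infty}\phi_\pi(\rho;n)$. *TASEP-H with A-perturbations, $\lambda>0$.* In each time slot the particles first move as in the zero-range model with $\pi=1$. If the configuration then reached has no two adjacent particles, a perturbation is applied with probability $\lambda/n$: a uniformly chosen particle is removed and is then placed at a uniformly chosen hole, the site just vacated counting as a hole. The flux $\phi(\rho,n)$ is the expected total clockwise distance travelled by all particles (relocations included) per site per time slot under a stationary distribution, and the typical flux is $\phi(\rho)=\lim_{n\to\infty}\phi(\rho,n)$. **Theorem.** Let $0<p<1$ and $0<\rho<1$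 with $\rho\neq h$. 1. For every $\pi\in(0,1)$ the limiting flux $\phi_\pi(\rho)$ exists (stationary distributions exist for all large $n$, and the limit does not depend on which are chosen), and $$\lim_{\pi\uparrow 1}\phi_\pi(\rho)=\begin{cases}\rho, & \rho<h,\\ p(1-\rho), & \rho>h.\end{cases}$$ 2. For every $\lambda>0$ the typical flux $\phi(\rho)$ of TASEP-H with A-perturbations exists (in the same sense), and $\lim_{\pi\uparrow1}\phi_\pi(\rho)=\phi(\rho)$. 3. If $\rho<1/2$, then $\phi_1(\rho)$ also exists (in the same sense). If $h<\rho<1/2$, then $\pi\mapsto\phi_\pi(\rho)$, $\pi\in(0,1]$, is discontinuous at $\pi=1$. -/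

import Mathlib

open Filter Topology

/-- A configuration on the circle of `n` sites `0, …, n - 1`: the finite set of occupied sites.
The right (clockwise) neighbour of site `i` is `finRotate n i = i + 1 (mod n)`, its left neighbour
is `(finRotate n).symm i`. -/
abbrev Config (n : ℕ) : Type := Finset (Fin n)

/-- A site of `Z` carries a free particle when both of its neighbours are holes
(to be used for occupied `i`). -/
def IsFree {n : ℕ} (Z : Config n) (i : Fin n) : Prop :=
  finRotate n i ∉ Z ∧ (finRotate n).symm i ∉ Z

/-- An ideal (completely sparse) configuration: every particle is free. -/
def IsIdeal {n : ℕ} (Z : Config n) : Prop :=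
  ∀ i ∈ Z, IsFree Z i

instance instDecidableIsIdeal {n : ℕ} (Z : Config n) : Decidable (IsIdeal Z) := by
  unfold IsIdeal IsFree
  infer_instance

noncomputable section

/-- Probability that the particle at the occupied site `i` hops to its right neighbour during one
time slot: `0` if it is blocked, `p` if it is held back by a particle on its left, `π` if it is
free. -/
def hopProb (p π : ℝ) {n : ℕ} (Z : Config n) (i : Fin n) : ℝ :=
  if finRotate n i ∈ Z then 0
  else if (finRotate n).symm i ∈ Z then p
  else π

/-- Probability that, from `Z`, the set of particles that hop is exactly `M ⊆ Z`: particles decide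
independently. -/
def moversProb (p π : ℝ) {n : ℕ} (Z M : Config n) : ℝ :=
  ∏ i ∈ Z, if i ∈ M then hopProb p π Z i else 1 - hopProb p π Z i

/-- The configuration after the particles of `M ⊆ Z` have hopped one site to the right. -/
def moveSet {n : ℕ} (Z M : Config n) : Config n :=
  (Z \ M) ∪ M.map (finRotate n).toEmbedding

/-- One-step transition probabilities of the zero-range model with parameters `p` and `π`.
For `π = 1` this is basic TASEP-H. -/
def stepProb (p π : ℝ) {n : ℕ} (Z Z' : Config n) : ℝ :=
  ∑ M ∈ Z.powerset, moversProb p π Z M * (if moveSet Z M = Z' then 1 else 0)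

/-- `μ` is a stationary distribution, carried by the configurations with exactly `k` particles, of
the Markov chain with transition probabilities `P`. -/
structure IsStationaryDist {n : ℕ} (k : ℕ) (P : Config n → Config n → ℝ) (μ : Config n → ℝ) :
    Prop where
  nonneg : ∀ Z, 0 ≤ μ Z
  support : ∀ Z, Z.card ≠ k → μ Z = 0
  total : ∑ Z, μ Z = 1
  balance : ∀ Z', ∑ Z, μ Z * P Z Z' = μ Z'

/-- The set of steady-state fluxes, over all stationary distributions, of a chain on the `k`-particle
configurations on `n` sites, where `ψ Z` is the expected total distance travelled by the particles
in the time slot that starts in `Z`; the flux is the steady-state mean of `ψ`, per site. -/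
def steadyFluxes {n : ℕ} (k : ℕ) (P : Config n → Config n → ℝ) (ψ : Config n → ℝ) : Set ℝ :=
  {x | ∃ μ : Config n → ℝ, IsStationaryDist k P μ ∧ x = (∑ Z, μ Z * ψ Z) / n}

/-- `L` is the limiting flux: for all large `n` there is a steady state, and whatever steady states
are chosen, the fluxes converge to `L` as `n → ∞`. -/
def IsFluxLimit (S : ℕ → Set ℝ) (L : ℝ) : Prop :=
  (∀ᶠ n in atTop, (S n).Nonempty) ∧
    ∀ f : ℕ → ℝ, (∀ᶠ n in atTop, f n ∈ S n) → Tendsto f atTop (𝓝 L)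

/-- `L` is the limiting flux, as `n → ∞`, of the zero-range model with `⌈ρ n⌉` particles on `n`
sites. -/
def IsZeroRangeFlux (p π ρ L : ℝ) : Prop :=
  IsFluxLimit
    (fun n : ℕ => steadyFluxes (n := n) ⌈ρ * n⌉₊ (stepProb p π) (fun Z => ∑ i ∈ Z, hopProb p π Z i))
    L

/-- Clockwise distance from site `x` to site `y`. -/
def cwDist {n : ℕ} (x y : Fin n) : ℕ := (y.val + (n - x.val)) % n

/-- Probability that a perturbation of `Z` picks the particle at `x ∈ Z` and relocates it to a given site
of `(Z.erase x)ᶜ`: the particle is uniform among the particles, and the new site is uniform among the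
holes, where the site just vacated counts as a hole. -/
def pickProb {n : ℕ} (Z : Config n) (x : Fin n) : ℝ :=
  ((Z.card : ℝ) * ((Z.erase x)ᶜ.card : ℝ))⁻¹

/-- Probability that a perturbation turns `Z` into `Z'`. -/
def perturbProb {n : ℕ} (Z Z' : Config n) : ℝ :=
  ∑ x ∈ Z, ∑ y ∈ (Z.erase x)ᶜ, pickProb Z x * (if insert y (Z.erase x) = Z' then 1 else 0)

/-- Expected clockwise distance travelled by the relocated particle in a perturbation of `Z`. -/
def perturbDist {n : ℕ} (Z : Config n) : ℝ :=
  ∑ x ∈ Z, ∑ y ∈ (Z.erase x)ᶜ, pickProb Z x * (cwDist x y : ℝ)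

/-- Probability `lam / n` of a perturbation in a time slot that ends in an ideal configuration.
The truncation at `1` only matters for the finitely many `n < lam`. -/
def perturbRate (lam : ℝ) (n : ℕ) : ℝ := min 1 (lam / n)

/-- Effect of the possible perturbation on the configuration `Z` reached by the normal movement:
if `Z` is ideal, it is perturbed with probability `lam / n`; otherwise nothing happens. -/
def afterProb (lam : ℝ) {n : ℕ} (Z Z' : Config n) : ℝ :=
  if IsIdeal Z then
    (1 - perturbRate lam n) * (if Z = Z' then 1 else 0) + perturbRate lam n * perturbProb Z Z'
  else if Z = Z' then 1 else 0

/-- One-step transition probabilities of TASEP-H with A-perturbations: normal movement of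
TASEP-H, then possibly a perturbation. -/
def aStepProb (p lam : ℝ) {n : ℕ} (Z Z'' : Config n) : ℝ :=
  ∑ Z', stepProb p 1 Z Z' * afterProb lam Z' Z''

/-- Expected total distance travelled by all particles in one time slot of TASEP-H with
A-perturbations, relocations included. -/
def aDist (p lam : ℝ) {n : ℕ} (Z : Config n) : ℝ :=
  ∑ i ∈ Z, hopProb p 1 Z i +
    ∑ Z', stepProb p 1 Z Z' * (if IsIdeal Z' then perturbRate lam n * perturbDist Z' else 0)

/-- `L` is the limiting (typical) flux, as `n → ∞`, of TASEP-H with A-perturbations, with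
`⌈ρ n⌉` particles on `n` sites. -/
def IsTypicalFlux (p lam ρ L : ℝ) : Prop :=
  IsFluxLimit
    (fun n : ℕ => steadyFluxes (n := n) ⌈ρ * n⌉₊ (aStepProb p lam) (aDist p lam))
    L

end

set_option linter.unusedSectionVars false

/-! ## Basic facts on the one-step dynamics -/

section Basics

variable {n : ℕ} [NeZero n]

/-! Write k for the number of particles, N = n - k for the number of holes, κ = ρ / (1 - ρ), r = (1
- p) / p and q = (1 - π) / π. The condition ρ < h reads κ < p.

Zero-range model, π < 1. There is an explicit stationary weight `zrWeight`: multiplied by the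
probability of a mover set M, it depends only on the adjacencies inside the residual set Z \ M. This
quantity is unchanged when time is reversed and the circle reflected, which gives stationarity
(`zrWeight_balance`); a minimum principle gives uniqueness. Cutting the circle at a hole turns the
partition function into the coefficient of X^k in ((1 + uX)(1 + qX / (1 - rX)))^N, where u marks
movers (`coeff_queueWeight_pow`). So the flux is the mean of E under an explicit law of the numbers
E of movers and c of residual clusters. Ratios of neighbouring masses are rational, hence summation
by parts bounds second moments and forces (E / N, c / N) towards the unique nondegenerate root of
two mean-field equations (`tendsto_pairSum`). As q → 0 the limit of E / N tends to min(p, κ);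
multiplied by 1 - ρ this is the two-branch formula.

A-perturbations, κ < p. View the configuration as a periodic height function. The Lyapunov function
`lyap`, a soft maximum minus the mean of the hole heights, decreases per step on average by at least
the mean number of particles that do not move. A relocation raises it by O(n) but has probability at
most λ / n, so in equilibrium only O(1) particles stand still and the flux is ρ.

A-perturbations, κ > p. A stationary law lives on configurations with at most one jam. Read
counterclockwise from the jam head, such a configuration is a word on which a step acts simply. The
truncated exponential sum `jamPot` is a supermartingale up to an exponentially small error, while
after an ideal configuration it decreases on average by a polynomially small amount; so ideal
configurations are exponentially rare (`IsStationaryDist.mass_ideal_le`). While a jam lasts, the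
number of inversions of the word has drift (mean number of movers) - p (n - k), hence the flux is p
(1 - ρ).

For π = 1 without perturbations and ρ < 1/2, ideal configurations are absorbing and reachable from
everywhere, so the flux is ρ. This differs from p (1 - ρ) when ρ > h, whence the discontinuity. -/

theorem finRotate_eq_add_one (i : Fin n) : finRotate n i = i + 1 := finRotate_apply i

theorem finRotate_symm_eq_sub_one (i : Fin n) : (finRotate n).symm i = i - 1 :=
  finRotate_symm_apply i

theorem hopProb_eq (p π : ℝ) (Z : Config n) (i : Fin n) :
    hopProb p π Z i = if i + 1 ∈ Z then 0 else if i - 1 ∈ Z then p else π := by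
  simp only [hopProb, finRotate_eq_add_one, finRotate_symm_eq_sub_one]

theorem mem_moveSet {Z M : Config n} {x : Fin n} :
    x ∈ moveSet Z M ↔ (x ∈ Z ∧ x ∉ M) ∨ x - 1 ∈ M := by
  simp only [moveSet, Finset.mem_union, Finset.mem_sdiff, Finset.mem_map, Equiv.coe_toEmbedding,
    finRotate_eq_add_one]
  refine or_congr Iff.rfl ⟨?_, fun h => ⟨x - 1, h, sub_add_cancel _ _⟩⟩
  rintro ⟨a, ha, rfl⟩
  simpa using ha

theorem isIdeal_iff {Z : Config n} : IsIdeal Z ↔ ∀ i ∈ Z, i + 1 ∉ Z := by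
  simp only [IsIdeal, IsFree, finRotate_eq_add_one, finRotate_symm_eq_sub_one]
  refine ⟨fun h i hi => (h i hi).1, fun h i hi => ⟨h i hi, fun h' => ?_⟩⟩
  exact h _ h' (by simpa using hi)

/-- A set of movers in which every particle has a hole on its right. -/
def Movable (Z M : Config n) : Prop := M ⊆ Z ∧ ∀ i ∈ M, i + 1 ∉ Z

/-- A set of movers of positive probability for `π = 1`: free particles all move. -/
def FreeMoves (Z M : Config n) : Prop :=
  Movable Z M ∧ ∀ i ∈ Z, i + 1 ∉ Z → i - 1 ∉ Z → i ∈ M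

theorem Movable.card_moveSet {Z M : Config n} (h : Movable Z M) :
    (moveSet Z M).card = Z.card := by
  have hd : Disjoint (Z \ M) (M.map (finRotate n).toEmbedding) := by
    rw [Finset.disjoint_left]
    intro x hx hx'
    simp only [Finset.mem_map, Equiv.coe_toEmbedding, finRotate_eq_add_one] at hx'
    obtain ⟨a, ha, rfl⟩ := hx'
    exact h.2 a ha (Finset.mem_sdiff.1 hx).1
  rw [moveSet, Finset.card_union_of_disjoint hd, Finset.card_map, Finset.card_sdiff_of_subset h.1]
  have := Finset.card_le_card h.1
  omega

/-- Expectation over the random set of movers. -/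
noncomputable def moverExp (p π : ℝ) (Z : Config n) (F : Config n → ℝ) : ℝ :=
  ∑ M ∈ Z.powerset, moversProb p π Z M * F M

theorem sum_stepProb_mul (p π : ℝ) (Z : Config n) (f : Config n → ℝ) :
    ∑ Z', stepProb p π Z Z' * f Z' = moverExp p π Z (fun M => f (moveSet Z M)) := by
  simp only [stepProb, moverExp, Finset.sum_mul]
  rw [Finset.sum_comm]
  refine Finset.sum_congr rfl fun M _ => ?_
  rw [Finset.sum_eq_single (moveSet Z M)]
  · simp
  · intro b _ hb
    simp [Ne.symm hb]
  · simp

theorem sum_powerset_prod_ite {ι : Type*} [DecidableEq ι] (s : Finset ι) (f g : ι → ℝ) :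
    ∑ M ∈ s.powerset, ∏ i ∈ s, (if i ∈ M then f i else g i) = ∏ i ∈ s, (f i + g i) := by
  rw [Finset.prod_add]
  refine Finset.sum_congr rfl fun M hM => ?_
  rw [Finset.prod_ite, Finset.filter_mem_eq_inter, Finset.filter_notMem_eq_sdiff,
    Finset.inter_eq_right.2 (Finset.mem_powerset.1 hM)]

theorem moverExp_const (p π : ℝ) (Z : Config n) (c : ℝ) : moverExp p π Z (fun _ => c) = c := by
  rw [moverExp, ← Finset.sum_mul]
  simp only [moversProb]
  rw [sum_powerset_prod_ite]
  simp

theorem moverExp_add (p π : ℝ) (Z : Config n) (F G : Config n → ℝ) :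
    moverExp p π Z (fun M => F M + G M) = moverExp p π Z F + moverExp p π Z G := by
  simp [moverExp, mul_add, Finset.sum_add_distrib]

theorem moverExp_sub (p π : ℝ) (Z : Config n) (F G : Config n → ℝ) :
    moverExp p π Z (fun M => F M - G M) = moverExp p π Z F - moverExp p π Z G := by
  simp [moverExp, mul_sub, Finset.sum_sub_distrib]

theorem moverExp_const_mul (p π : ℝ) (Z : Config n) (c : ℝ) (F : Config n → ℝ) :
    moverExp p π Z (fun M => c * F M) = c * moverExp p π Z F := by
  simp only [moverExp, Finset.mul_sum]
  exact Finset.sum_congr rfl fun M _ => by ring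

theorem moverExp_sum {ι : Type*} (p π : ℝ) (Z : Config n) (s : Finset ι)
    (F : ι → Config n → ℝ) :
    moverExp p π Z (fun M => ∑ i ∈ s, F i M) = ∑ i ∈ s, moverExp p π Z (F i) := by
  simp only [moverExp, Finset.mul_sum]
  exact Finset.sum_comm

theorem moverExp_ite_mem (p π : ℝ) {Z : Config n} {i : Fin n} (hi : i ∈ Z) (a b : ℝ) :
    moverExp p π Z (fun M => if i ∈ M then a else b)
      = hopProb p π Z i * a + (1 - hopProb p π Z i) * b := by
  have key : ∀ c d : ℝ, ∑ M ∈ Z.powerset, moversProb p π Z M * (if i ∈ M then c else d)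
      = hopProb p π Z i * c + (1 - hopProb p π Z i) * d := by
    intro c d
    have h1 : ∀ M ∈ Z.powerset, moversProb p π Z M * (if i ∈ M then c else d)
        = ∏ j ∈ Z, (if j ∈ M then hopProb p π Z j * (if j = i then c else 1)
          else (1 - hopProb p π Z j) * (if j = i then d else 1)) := by
      intro M _
      have : (if i ∈ M then c else d) = ∏ j ∈ Z, (if j ∈ M then (if j = i then c else 1)
          else (if j = i then d else 1)) := by
        rw [Finset.prod_eq_single i]
        · simp
        · intro j _ hj
          simp [hj]
        · exact fun h => (h hi).elim
      rw [this, moversProb, ← Finset.prod_mul_distrib]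
      refine Finset.prod_congr rfl fun j _ => ?_
      split_ifs <;> ring
    rw [Finset.sum_congr rfl h1, sum_powerset_prod_ite, Finset.prod_eq_single i]
    · simp
    · intro j _ hj
      simp [hj]
    · exact fun h => (h hi).elim
  exact key a b

theorem moverExp_card (p π : ℝ) (Z : Config n) :
    moverExp p π Z (fun M => (M.card : ℝ)) = ∑ i ∈ Z, hopProb p π Z i := by
  have : moverExp p π Z (fun M => (M.card : ℝ))
      = moverExp p π Z (fun M => ∑ i ∈ Z, if i ∈ M then 1 else 0) := by
    refine Finset.sum_congr rfl fun M hM => ?_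
    congr 1
    show (M.card : ℝ) = ∑ i ∈ Z, if i ∈ M then 1 else 0
    rw [Finset.sum_ite_mem, Finset.inter_eq_right.2 (Finset.mem_powerset.1 hM)]
    simp
  rw [this, moverExp_sum]
  refine Finset.sum_congr rfl fun i hi => ?_
  rw [moverExp_ite_mem p π hi]
  ring

variable {p π : ℝ}

theorem hopProb_nonneg (hp0 : 0 ≤ p) (hπ0 : 0 ≤ π) (Z : Config n) (i : Fin n) :
    0 ≤ hopProb p π Z i := by
  rw [hopProb_eq]; split_ifs <;> simp [*]

theorem hopProb_le_one (hp1 : p ≤ 1) (hπ1 : π ≤ 1) (Z : Config n) (i : Fin n) :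
    hopProb p π Z i ≤ 1 := by
  rw [hopProb_eq]; split_ifs <;> simp [*]

theorem moversProb_nonneg (hp0 : 0 ≤ p) (hp1 : p ≤ 1) (hπ0 : 0 ≤ π) (hπ1 : π ≤ 1)
    (Z M : Config n) : 0 ≤ moversProb p π Z M := by
  refine Finset.prod_nonneg fun i _ => ?_
  split_ifs
  · exact hopProb_nonneg hp0 hπ0 Z i
  · linarith [hopProb_le_one hp1 hπ1 Z i]

theorem movable_of_moversProb_ne_zero {Z M : Config n} (hM : M ⊆ Z)
    (h : moversProb p π Z M ≠ 0) : Movable Z M := by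
  refine ⟨hM, fun i hi hi' => h ?_⟩
  refine Finset.prod_eq_zero (hM hi) ?_
  rw [if_pos hi, hopProb_eq, if_pos hi']

theorem freeMoves_of_moversProb_ne_zero {Z M : Config n} (hM : M ⊆ Z)
    (h : moversProb p 1 Z M ≠ 0) : FreeMoves Z M := by
  refine ⟨movable_of_moversProb_ne_zero hM h, fun i hi h1 h2 => ?_⟩
  by_contra hi'
  refine h (Finset.prod_eq_zero hi ?_)
  rw [if_neg hi', hopProb_eq, if_neg h1, if_neg h2, sub_self]

/-- For π = 1 only mover sets containing every free particle have positive probability, so averaged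
estimates reduce to deterministic ones on `FreeMoves` sets. -/
theorem moverExp_one_mono (hp0 : 0 ≤ p) (hp1 : p ≤ 1) {Z : Config n}
    {F G : Config n → ℝ} (h : ∀ M, FreeMoves Z M → F M ≤ G M) :
    moverExp p 1 Z F ≤ moverExp p 1 Z G := by
  refine Finset.sum_le_sum fun M hM => ?_
  by_cases h0 : moversProb p 1 Z M = 0
  · simp [h0]
  · exact mul_le_mul_of_nonneg_left
      (h M (freeMoves_of_moversProb_ne_zero (Finset.mem_powerset.1 hM) h0))
      (moversProb_nonneg hp0 hp1 zero_le_one le_rfl Z M)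

theorem moverExp_one_congr (hp0 : 0 ≤ p) (hp1 : p ≤ 1) {Z : Config n}
    {F G : Config n → ℝ} (h : ∀ M, FreeMoves Z M → F M = G M) :
    moverExp p 1 Z F = moverExp p 1 Z G :=
  le_antisymm (moverExp_one_mono hp0 hp1 fun M hM => (h M hM).le)
    (moverExp_one_mono hp0 hp1 fun M hM => (h M hM).ge)

theorem stepProb_nonneg (hp0 : 0 ≤ p) (hp1 : p ≤ 1) (hπ0 : 0 ≤ π) (hπ1 : π ≤ 1)
    (Z Z' : Config n) : 0 ≤ stepProb p π Z Z' := by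
  refine Finset.sum_nonneg fun M _ => mul_nonneg (moversProb_nonneg hp0 hp1 hπ0 hπ1 Z M) ?_
  split_ifs <;> simp

theorem sum_stepProb (p π : ℝ) (Z : Config n) : ∑ Z', stepProb p π Z Z' = 1 := by
  have := sum_stepProb_mul p π Z (fun _ => 1)
  simpa [moverExp_const] using this

theorem exists_movers_of_stepProb_ne_zero {Z Z' : Config n} (h : stepProb p π Z Z' ≠ 0) :
    ∃ M, M ⊆ Z ∧ moversProb p π Z M ≠ 0 ∧ moveSet Z M = Z' := by
  obtain ⟨M, hM, hne⟩ := Finset.exists_ne_zero_of_sum_ne_zero h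
  refine ⟨M, Finset.mem_powerset.1 hM, left_ne_zero_of_mul hne, ?_⟩
  by_contra h'
  simp [h'] at hne

theorem stepProb_moveSet_ge (hp0 : 0 ≤ p) (hp1 : p ≤ 1) (hπ0 : 0 ≤ π) (hπ1 : π ≤ 1)
    {Z M : Config n} (hM : M ⊆ Z) : moversProb p π Z M ≤ stepProb p π Z (moveSet Z M) := by
  have := Finset.single_le_sum (f := fun M' => moversProb p π Z M' *
    (if moveSet Z M' = moveSet Z M then (1 : ℝ) else 0)) (s := Z.powerset)
    (fun M' _ => mul_nonneg (moversProb_nonneg hp0 hp1 hπ0 hπ1 Z M') (by split_ifs <;> simp))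
    (Finset.mem_powerset.2 hM)
  simpa [stepProb] using this

theorem card_eq_of_stepProb_ne_zero {Z Z' : Config n} (h : stepProb p π Z Z' ≠ 0) :
    Z'.card = Z.card := by
  obtain ⟨M, hM, hne, rfl⟩ := exists_movers_of_stepProb_ne_zero h
  exact (movable_of_moversProb_ne_zero hM hne).card_moveSet

end Basics

/-! ## Finite Markov chains on configurations -/

section Chain

variable {n k : ℕ} {P : Config n → Config n → ℝ} {μ : Config n → ℝ}

theorem IsStationaryDist.sum_mul_step (h : IsStationaryDist k P μ) (f : Config n → ℝ) :
    ∑ Z, μ Z * ∑ Z', P Z Z' * f Z' = ∑ Z, μ Z * f Z := by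
  simp only [Finset.mul_sum]
  rw [Finset.sum_comm]
  refine Finset.sum_congr rfl fun Z' _ => ?_
  rw [← h.balance Z', Finset.sum_mul]
  exact Finset.sum_congr rfl fun Z _ => by ring

/-- The transition matrix A fixes the constant vector, so A - 1 is singular and has a left null
vector v. Then |v| ≤ |v| A entrywise with equal totals, hence equality, and |v| normalised is
stationary. -/
theorem exists_isStationaryDist (hk : k ≤ n) (hP : ∀ Z Z', 0 ≤ P Z Z')
    (hP1 : ∀ Z, Z.card = k → ∑ Z', P Z Z' = 1)
    (hcard : ∀ Z Z', P Z Z' ≠ 0 → Z'.card = Z.card) : ∃ μ, IsStationaryDist k P μ := by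
  classical
  let S := {Z : Config n // Z.card = k}
  have hSne : Nonempty S := by
    obtain ⟨t, _, ht⟩ := Finset.exists_subset_card_eq (s := (Finset.univ : Finset (Fin n))) (n := k)
      (by simpa using hk)
    exact ⟨⟨t, ht⟩⟩
  have hsub : ∀ g : Config n → ℝ, (∀ Z, Z.card ≠ k → g Z = 0) → ∑ Z, g Z = ∑ Z : S, g Z.1 := by
    intro g hg
    rw [← Finset.sum_subtype (Finset.univ.filter fun Z : Config n => Z.card = k) (by simp) g,
      Finset.sum_filter]
    refine Finset.sum_congr rfl fun Z _ => ?_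
    split_ifs with h
    · rfl
    · exact hg Z h
  have hrow : ∀ Z : S, ∑ Z' : S, P Z.1 Z'.1 = 1 := by
    intro Z
    rw [← hsub (fun Z' => P Z.1 Z'), hP1 _ Z.2]
    intro Z' hZ'
    by_contra h
    exact hZ' ((hcard _ _ h).trans Z.2)
  let A : Matrix S S ℝ := fun Z Z' => P Z.1 Z'.1
  have hdet : (A - 1).det = 0 := by
    rw [← Matrix.exists_mulVec_eq_zero_iff]
    refine ⟨fun _ => 1, fun h => ?_, ?_⟩
    · have := congrFun h hSne.some
      simp at this
    · funext Z
      have h1 : (A.mulVec fun _ => (1 : ℝ)) Z = 1 := by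
        simpa [Matrix.mulVec, dotProduct, A] using hrow Z
      rw [Matrix.sub_mulVec, Matrix.one_mulVec, Pi.sub_apply, h1, sub_self, Pi.zero_apply]
  obtain ⟨v, hv0, hv⟩ := Matrix.exists_vecMul_eq_zero_iff.2 hdet
  have hv' : ∀ Z', ∑ Z, v Z * A Z Z' = v Z' := by
    intro Z'
    have := congrFun hv Z'
    rw [Matrix.vecMul_sub, Matrix.vecMul_one, Pi.sub_apply, Pi.zero_apply, sub_eq_zero] at this
    simpa [Matrix.vecMul, dotProduct] using this
  have hle : ∀ Z', |v Z'| ≤ ∑ Z, |v Z| * A Z Z' := by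
    intro Z'
    rw [← hv' Z']
    refine (Finset.abs_sum_le_sum_abs _ _).trans (le_of_eq ?_)
    refine Finset.sum_congr rfl fun Z _ => ?_
    rw [abs_mul, abs_of_nonneg (hP _ _)]
  have htot : ∑ Z', ∑ Z, |v Z| * A Z Z' = ∑ Z', |v Z'| := by
    rw [Finset.sum_comm]
    refine Finset.sum_congr rfl fun Z _ => ?_
    rw [← Finset.mul_sum, hrow Z, mul_one]
  have heq : ∀ Z', ∑ Z, |v Z| * A Z Z' = |v Z'| := by
    have := (Finset.sum_eq_sum_iff_of_le (fun i _ => hle i)).1 htot.symm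
    exact fun Z' => (this Z' (Finset.mem_univ _)).symm
  have hT : 0 < ∑ Z, |v Z| := by
    obtain ⟨Z, hZ⟩ := Function.ne_iff.1 hv0
    exact Finset.sum_pos' (fun _ _ => abs_nonneg _) ⟨Z, Finset.mem_univ _, abs_pos.2 hZ⟩
  set T := ∑ Z, |v Z|
  let μ : Config n → ℝ := fun Z => if h : Z.card = k then |v ⟨Z, h⟩| / T else 0
  have hμS : ∀ Z : S, μ Z.1 = |v Z| / T := fun Z => by simp [μ, Z.2]
  have hμ0 : ∀ Z, Z.card ≠ k → μ Z = 0 := fun Z h => by simp [μ, h]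
  refine ⟨μ, fun Z => ?_, hμ0, ?_, fun Z' => ?_⟩
  · by_cases h : Z.card = k
    · simp only [μ, h, dif_pos]; positivity
    · rw [hμ0 Z h]
  · rw [hsub μ hμ0]
    simp only [hμS]
    rw [← Finset.sum_div, div_self hT.ne']
  · rw [hsub (fun Z => μ Z * P Z Z') (fun Z h => by simp [hμ0 Z h])]
    by_cases h : Z'.card = k
    · have := heq ⟨Z', h⟩
      simp only [hμS]
      rw [hμS ⟨Z', h⟩, ← this, Finset.sum_div]
      exact Finset.sum_congr rfl fun Z _ => by simp only [A]; ring
    · rw [hμ0 Z' h]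
      refine Finset.sum_eq_zero fun Z _ => ?_
      by_contra hne
      exact h ((hcard _ _ (right_ne_zero_of_mul hne)).trans Z.2)

theorem IsStationaryDist.ne_zero_step (h : IsStationaryDist k P μ) (hP : ∀ Z Z', 0 ≤ P Z Z')
    {Z Z' : Config n} (hZ : μ Z ≠ 0) (hPZ : P Z Z' ≠ 0) : μ Z' ≠ 0 := by
  rw [← h.balance Z']
  refine ne_of_gt (Finset.sum_pos' (fun _ _ => mul_nonneg (h.nonneg _) (hP _ _))
    ⟨Z, Finset.mem_univ _, ?_⟩)
  exact mul_pos (lt_of_le_of_ne (h.nonneg _) hZ.symm) (lt_of_le_of_ne (hP _ _) hPZ.symm)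

/-- A stationary distribution charges no transition into a closed set from outside. -/
theorem IsStationaryDist.not_mem_of_step (h : IsStationaryDist k P μ) (hP : ∀ Z Z', 0 ≤ P Z Z')
    (hP1 : ∀ Z, Z.card = k → ∑ Z', P Z Z' = 1) {D : Config n → Prop}
    (hD : ∀ Z Z', D Z → P Z Z' ≠ 0 → D Z') {Z Z' : Config n} (hZ : μ Z ≠ 0)
    (hDZ : ¬ D Z) (hPZ : P Z Z' ≠ 0) : ¬ D Z' := by
  classical
  intro hDZ'
  have h1 := h.sum_mul_step (fun Z => if D Z then 1 else 0)
  -- Closedness gives this inequality term by term. By stationarity both sides have the same sum, so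
  -- every term is an equality and no mass flows into D.
  have h2 : ∀ Z, μ Z * (if D Z then 1 else 0)
      ≤ μ Z * ∑ Z', P Z Z' * (if D Z' then (1 : ℝ) else 0) := by
    intro Y
    by_cases hk : Y.card = k
    swap
    · rw [h.support Y hk, zero_mul, zero_mul]
    refine mul_le_mul_of_nonneg_left ?_ (h.nonneg _)
    by_cases hY : D Y
    · rw [if_pos hY]
      refine (hP1 Y hk).symm.le.trans ?_
      refine Finset.sum_le_sum fun Y' _ => ?_
      by_cases h0 : P Y Y' = 0
      · simp [h0]
      · simp [hD Y Y' hY h0]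
    · rw [if_neg hY]
      exact Finset.sum_nonneg fun Y' _ => mul_nonneg (hP _ _) (by split_ifs <;> simp)
  have h3 := (Finset.sum_eq_sum_iff_of_le (fun i _ => h2 i)).1 h1.symm Z (Finset.mem_univ _)
  rw [if_neg hDZ, mul_zero] at h3
  have h4 : 0 < ∑ Z', P Z Z' * (if D Z' then (1 : ℝ) else 0) := by
    refine Finset.sum_pos' (fun Y' _ => mul_nonneg (hP _ _) (by split_ifs <;> simp))
      ⟨Z', Finset.mem_univ _, ?_⟩
    simpa [hDZ'] using lt_of_le_of_ne (hP _ _) hPZ.symm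
  have h5 := mul_pos (lt_of_le_of_ne (h.nonneg _) hZ.symm) h4
  linarith

/-- If a closed set can be reached from everywhere, it carries every stationary distribution. -/
theorem IsStationaryDist.mem_of_ne_zero (h : IsStationaryDist k P μ) (hP : ∀ Z Z', 0 ≤ P Z Z')
    (hP1 : ∀ Z, Z.card = k → ∑ Z', P Z Z' = 1) {D : Config n → Prop}
    (hD : ∀ Z Z', D Z → P Z Z' ≠ 0 → D Z')
    (hreach : ∀ Z, Z.card = k → ∃ Z', Relation.ReflTransGen (fun Y Y' => P Y Y' ≠ 0) Z Z' ∧ D Z')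
    {Z : Config n} (hZ : μ Z ≠ 0) : D Z := by
  by_contra hDZ
  obtain ⟨Z', hpath, hDZ'⟩ := hreach Z (by by_contra hc; exact hZ (h.support Z hc))
  have : μ Z' ≠ 0 ∧ ¬ D Z' := by
    clear hDZ'
    induction hpath with
    | refl => exact ⟨hZ, hDZ⟩
    | tail _ hstep ih =>
      exact ⟨h.ne_zero_step hP ih.1 hstep, h.not_mem_of_step hP hP1 hD ih.1 ih.2 hstep⟩
  exact this.2 hDZ'

end Chain

/-! ## The product-form stationary measure of the zero-range model -/

section ProductForm

variable {n : ℕ} [NeZero n]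

/-- The mirror image of a configuration. -/
def mirror (Z : Config n) : Config n := Z.map (Equiv.neg (Fin n)).toEmbedding

theorem mem_mirror {Z : Config n} {x : Fin n} : x ∈ mirror Z ↔ -x ∈ Z := by
  simp only [mirror, Finset.mem_map, Equiv.coe_toEmbedding, Equiv.neg_apply]
  constructor
  · rintro ⟨a, ha, rfl⟩; simpa using ha
  · exact fun h => ⟨-x, h, neg_neg x⟩

theorem mirror_mirror (Z : Config n) : mirror (mirror Z) = Z := by
  ext x; simp [mem_mirror]

theorem prod_mirror (Z : Config n) (f : Fin n → ℝ) : ∏ i ∈ mirror Z, f i = ∏ i ∈ Z, f (-i) := by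
  simp [mirror, Finset.prod_map]

/-- Product over the occupied sites, `a` for blocked particles and `b` for unblocked ones. -/
noncomputable def pairWeight (a b : ℝ) (R : Config n) : ℝ := ∏ i ∈ R, if i + 1 ∈ R then a else b

theorem card_filter_add_one (R : Config n) :
    (R.filter fun i => i + 1 ∈ R).card = (R.filter fun i => i - 1 ∈ R).card := by
  refine Finset.card_bij (fun i _ => i + 1) ?_ ?_ ?_
  · simp only [Finset.mem_filter]
    rintro i ⟨h1, h2⟩
    exact ⟨h2, by simpa using h1⟩
  · intro i _ j _ h
    exact add_right_cancel h
  · simp only [Finset.mem_filter]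
    rintro i ⟨h1, h2⟩
    exact ⟨i - 1, ⟨h2, by simpa using h1⟩, by simp⟩

theorem prod_ite_const (R : Config n) (P : Fin n → Prop) [DecidablePred P] (a b : ℝ) :
    ∏ i ∈ R, (if P i then a else b) = a ^ (R.filter P).card * b ^ (R.card - (R.filter P).card) := by
  rw [Finset.prod_ite, Finset.prod_const, Finset.prod_const]
  congr 2
  have := Finset.card_filter_add_card_filter_not (s := R) P
  omega

/-- The weight depends only on the numbers of particles and of adjacent pairs, and a pair may be
counted from either end. -/
theorem pairWeight_mirror (a b : ℝ) (R : Config n) :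
    pairWeight a b (mirror R) = pairWeight a b R := by
  have h : ∀ i : Fin n, -i + 1 ∈ mirror R ↔ i - 1 ∈ R := by
    intro i; rw [mem_mirror]; simp [sub_eq_neg_add, add_comm]
  rw [pairWeight, prod_mirror]
  simp only [h]
  rw [pairWeight, prod_ite_const, prod_ite_const, card_filter_add_one]

/-- Stationary weight of a configuration of the zero-range model. -/
noncomputable def zrWeight (p π : ℝ) (Z : Config n) : ℝ :=
  ∏ i ∈ Z, if i + 1 ∈ Z then (1 - p) / p else
    if i - 1 ∈ Z then (1 - π) / π / (1 - p) else 1 / π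

variable {p π : ℝ}

/-- Separating a correction for free particles makes the mirror symmetry visible: being free is a
left-right symmetric condition. -/
theorem zrWeight_eq (hp1 : p < 1) (hπ0 : 0 < π) (hπ1 : π < 1) (Z : Config n) :
    zrWeight p π Z = pairWeight ((1 - p) / p) ((1 - π) / π / (1 - p)) Z *
      ∏ i ∈ Z, if i + 1 ∉ Z ∧ i - 1 ∉ Z then (1 - p) / (1 - π) else 1 := by
  rw [zrWeight, pairWeight, ← Finset.prod_mul_distrib]
  refine Finset.prod_congr rfl fun i _ => ?_
  have h1 : 1 - p ≠ 0 := by linarith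
  have h2 : 1 - π ≠ 0 := by linarith
  by_cases h : i + 1 ∈ Z <;> by_cases h' : i - 1 ∈ Z <;> simp [h, h']
  field_simp

theorem zrWeight_mirror (hp1 : p < 1) (hπ0 : 0 < π) (hπ1 : π < 1) (Z : Config n) :
    zrWeight p π (mirror Z) = zrWeight p π Z := by
  rw [zrWeight_eq hp1 hπ0 hπ1, zrWeight_eq hp1 hπ0 hπ1, pairWeight_mirror, prod_mirror]
  congr 1
  refine Finset.prod_congr rfl fun i _ => ?_
  have h1 : -i + 1 ∈ mirror Z ↔ i - 1 ∈ Z := by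
    rw [mem_mirror]; simp [sub_eq_neg_add, add_comm]
  have h2 : -i - 1 ∈ mirror Z ↔ i + 1 ∈ Z := by
    rw [mem_mirror]; simp [add_comm]
  simp only [h1, h2, and_comm]

theorem zrWeight_pos (hp0 : 0 < p) (hp1 : p < 1) (hπ0 : 0 < π) (hπ1 : π < 1) (Z : Config n) :
    0 < zrWeight p π Z := by
  refine Finset.prod_pos fun i _ => ?_
  have h1 : 0 < 1 - p := by linarith
  have h2 : 0 < 1 - π := by linarith
  split_ifs <;> positivity

/-- A non-mover contributes r if blocked and q otherwise, a free mover contributes 1, and a mover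
leaving a longer cluster contributes q / r. Handing this last factor to the particle behind it
leaves a product over the residual set alone. -/
theorem zrWeight_mul_moversProb (hp0 : 0 < p) (hp1 : p < 1) (hπ0 : 0 < π) {Z M : Config n}
    (hM : Movable Z M) :
    zrWeight p π Z * moversProb p π Z M = pairWeight ((1 - p) / p) ((1 - π) / π) (Z \ M) := by
  set r := (1 - p) / p with hr
  set q := (1 - π) / π with hq
  have h1 : (1 - p) ≠ 0 := by linarith
  have hr0 : r ≠ 0 := div_ne_zero h1 hp0.ne'
  have hstep : zrWeight p π Z * moversProb p π Z M
      = (∏ i ∈ Z \ M, if i + 1 ∈ Z then r else q) * ∏ i ∈ M, if i - 1 ∈ Z then q / r else 1 := by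
    rw [zrWeight, moversProb, ← Finset.prod_mul_distrib, ← Finset.prod_sdiff hM.1]
    congr 1
    · refine Finset.prod_congr rfl fun i hi => ?_
      rw [if_neg (Finset.mem_sdiff.1 hi).2, hopProb_eq]
      split_ifs
      · simp [hr]
      · rw [hq]; field_simp
      · rw [hq]; field_simp
    · refine Finset.prod_congr rfl fun i hi => ?_
      rw [if_pos hi, hopProb_eq, if_neg (hM.2 i hi), if_neg (hM.2 i hi)]
      split_ifs
      · rw [hr, hq]; field_simp
      · field_simp
  -- The particle behind a departing head was blocked, with weight r, and now heads a residual
  -- cluster: r · (q / r) = q.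
  have hshift : (∏ i ∈ M, if i - 1 ∈ Z then q / r else 1)
      = ∏ i ∈ Z \ M, if i + 1 ∈ M then q / r else 1 := by
    rw [← Finset.prod_filter, ← Finset.prod_filter]
    refine Finset.prod_bij (fun i _ => i - 1) ?_ ?_ ?_ ?_
    · simp only [Finset.mem_filter, Finset.mem_sdiff, sub_add_cancel]
      rintro i ⟨hi, hi'⟩
      refine ⟨⟨hi', fun h => hM.2 _ h ?_⟩, hi⟩
      simpa using hM.1 hi
    · intro i _ j _ h
      exact sub_left_injective h
    · simp only [Finset.mem_filter, Finset.mem_sdiff]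
      rintro i ⟨⟨hi, -⟩, hi'⟩
      exact ⟨i + 1, ⟨hi', by simpa using hi⟩, by simp⟩
    · intros; rfl
  rw [hstep, hshift, ← Finset.prod_mul_distrib, pairWeight]
  refine Finset.prod_congr rfl fun i _ => ?_
  by_cases h : i + 1 ∈ Z <;> by_cases h' : i + 1 ∈ M
  · simp [h, h', mul_div_cancel₀ _ hr0]
  · simp [h, h']
  · exact (h (hM.1 h')).elim
  · simp [h, h']

/-- A move run backwards and seen in a mirror is again a move: the arrivals become the movers, the
residual set is merely reflected, and doing this twice gives back the original move. -/
theorem mirror_moveSet_mirror {Z M : Config n} (hM : Movable Z M) :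
    Movable (mirror (moveSet Z M)) (mirror (M.map (finRotate n).toEmbedding)) ∧
      mirror (moveSet Z M) \ mirror (M.map (finRotate n).toEmbedding) = mirror (Z \ M) ∧
      mirror (moveSet (mirror (moveSet Z M)) (mirror (M.map (finRotate n).toEmbedding))) = Z ∧
      mirror ((mirror (M.map (finRotate n).toEmbedding)).map (finRotate n).toEmbedding) = M := by
  have hs : ∀ (A : Config n) (x : Fin n), x ∈ A.map (finRotate n).toEmbedding ↔ x - 1 ∈ A := by
    intro A x
    simp only [Finset.mem_map, Equiv.coe_toEmbedding, finRotate_eq_add_one]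
    constructor
    · rintro ⟨a, ha, rfl⟩; simpa using ha
    · exact fun h => ⟨x - 1, h, sub_add_cancel _ _⟩
  have h1 : ∀ x, x - 1 ∈ M → x ∉ Z := fun x hx => by simpa using hM.2 _ hx
  have h2 : ∀ x : Fin n, -(x - 1) - 1 = -x := fun x => by abel
  have h3 : ∀ x : Fin n, -(-x - 1) - 1 = x := fun x => by abel
  have h4 : ∀ x : Fin n, -(x + 1) = -x - 1 := fun x => by abel
  refine ⟨⟨?_, ?_⟩, ?_, ?_, ?_⟩
  · intro x
    simp only [mem_mirror, hs, mem_moveSet]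
    exact Or.inr
  · intro x
    simp only [mem_mirror, hs, mem_moveSet, h4]
    rintro hx (⟨-, h⟩ | h)
    · exact h hx
    · exact hM.2 _ h (by simpa using hM.1 hx)
  · ext x
    simp only [Finset.mem_sdiff, mem_mirror, hs, mem_moveSet]
    constructor
    · rintro ⟨h | h, h'⟩
      · exact h
      · exact (h' h).elim
    · rintro ⟨h, h'⟩
      exact ⟨Or.inl ⟨h, h'⟩, fun h'' => h1 _ h'' h⟩
  · ext x
    simp only [mem_moveSet, mem_mirror, hs, neg_neg, h3]
    constructor
    · rintro (⟨⟨h, -⟩ | h, h'⟩ | h)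
      · exact h
      · exact (h' h).elim
      · exact hM.1 h
    · intro h
      by_cases hx : x ∈ M
      · exact Or.inr hx
      · exact Or.inl ⟨Or.inl ⟨h, hx⟩, fun h' => h1 _ h' h⟩
  · ext x
    simp only [mem_mirror, hs, h3]

/-- By reversal, the pairs (Z, M) leading to Z' correspond, with equal weights, to the mover sets of
the mirror image of Z'. These weights add up to the weight of the mirror image, which is that of Z'.
-/
theorem zrWeight_balance (hp0 : 0 < p) (hp1 : p < 1) (hπ0 : 0 < π) (hπ1 : π < 1) (Z' : Config n) :
    ∑ Z, zrWeight p π Z * stepProb p π Z Z' = zrWeight p π Z' := by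
  classical
  have hw : ∀ Z : Config n, ∀ M ∈ Z.powerset, zrWeight p π Z * moversProb p π Z M
      = if Movable Z M then pairWeight ((1 - p) / p) ((1 - π) / π) (Z \ M) else 0 := by
    intro Z M hMZ
    split_ifs with hM
    · exact zrWeight_mul_moversProb hp0 hp1 hπ0 hM
    · rw [mul_eq_zero]
      right
      by_contra h
      exact hM (movable_of_moversProb_ne_zero (Finset.mem_powerset.1 hMZ) h)
  have hR : zrWeight p π Z' = ∑ M' ∈ (mirror Z').powerset with Movable (mirror Z') M',
      pairWeight ((1 - p) / p) ((1 - π) / π) (mirror Z' \ M') := by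
    rw [← zrWeight_mirror hp1 hπ0 hπ1, Finset.sum_filter]
    have := moverExp_const p π (mirror Z') (zrWeight p π (mirror Z'))
    rw [moverExp] at this
    rw [← this]
    refine Finset.sum_congr rfl fun M hM => ?_
    rw [mul_comm, hw _ M hM]
  have hL : ∑ Z, zrWeight p π Z * stepProb p π Z Z'
      = ∑ x ∈ (Finset.univ : Finset (Config n × Config n)) with
          Movable x.1 x.2 ∧ moveSet x.1 x.2 = Z',
        pairWeight ((1 - p) / p) ((1 - π) / π) (x.1 \ x.2) := by
    rw [Finset.sum_filter, ← Finset.univ_product_univ, Finset.sum_product]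
    refine Finset.sum_congr rfl fun Z _ => ?_
    rw [stepProb, Finset.mul_sum,
      ← Finset.sum_subset (Finset.subset_univ Z.powerset)]
    · refine Finset.sum_congr rfl fun M hM => ?_
      rw [← mul_assoc, hw Z M hM]
      by_cases h1 : Movable Z M <;> by_cases h2 : moveSet Z M = Z' <;> simp [h1, h2]
    · intro M _ hM
      rw [if_neg]
      rintro ⟨h, -⟩
      exact hM (Finset.mem_powerset.2 h.1)
  rw [hL, hR]
  refine Finset.sum_bij' (fun x _ => mirror (x.2.map (finRotate n).toEmbedding))
    (fun M' _ => (mirror (moveSet (mirror Z') M'), mirror (M'.map (finRotate n).toEmbedding)))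
    ?_ ?_ ?_ ?_ ?_
  · rintro ⟨Z, M⟩ hx
    obtain ⟨hM, rfl⟩ := (Finset.mem_filter.1 hx).2
    have := (mirror_moveSet_mirror hM).1
    simp only [Finset.mem_filter, Finset.mem_powerset]
    exact ⟨this.1, this⟩
  · intro M' hx
    have hM := (Finset.mem_filter.1 hx).2
    obtain ⟨h1, -, h3, -⟩ := mirror_moveSet_mirror hM
    refine Finset.mem_filter.2 ⟨Finset.mem_univ _, h1, ?_⟩
    rw [← mirror_mirror (moveSet _ _), h3, mirror_mirror]
  · rintro ⟨Z, M⟩ hx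
    obtain ⟨hM, rfl⟩ := (Finset.mem_filter.1 hx).2
    obtain ⟨-, -, h3, h4⟩ := mirror_moveSet_mirror hM
    exact Prod.ext h3 h4
  · intro M' hx
    have hM := (Finset.mem_filter.1 hx).2
    exact (mirror_moveSet_mirror hM).2.2.2
  · rintro ⟨Z, M⟩ hx
    obtain ⟨hM, rfl⟩ := (Finset.mem_filter.1 hx).2
    simp only
    rw [(mirror_moveSet_mirror hM).2.1, pairWeight_mirror]

/-! ### Uniqueness -/

theorem moversProb_singleton_pos (hp0 : 0 < p) (hp1 : p < 1) (hπ0 : 0 < π) (hπ1 : π < 1)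
    {Z : Config n} {i : Fin n} (hi : i + 1 ∉ Z) : 0 < moversProb p π Z {i} := by
  refine Finset.prod_pos fun j _ => ?_
  rw [hopProb_eq]
  split_ifs with h1 h2 <;> first | linarith | skip
  rw [Finset.mem_singleton] at h1
  exact (hi (h1 ▸ h2)).elim

/-- Unless the particles fill an initial segment, some particle away from site 0 has a hole behind
it and can be pulled back; the sum of the positions then drops, which is the induction measure for
uniqueness. -/
theorem exists_pred_of_not_isLowerSet {Z : Config n} (hZ : ¬ IsLowerSet (Z : Set (Fin n))) :
    ∃ Y : Config n, ∃ i : Fin n, i ∈ Y ∧ i + 1 ∉ Y ∧ moveSet Y {i} = Z ∧ Y.card = Z.card ∧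
      ∑ j ∈ Y, j.val < ∑ j ∈ Z, j.val := by
  have : ∃ i ∈ Z, i ≠ 0 ∧ i - 1 ∉ Z := by
    by_contra! hcon
    refine hZ fun a b hba ha => ?_
    have key : ∀ d : ℕ, ∀ a b : Fin n, a.val = b.val + d → a ∈ Z → b ∈ Z := by
      intro d
      induction d with
      | zero =>
        intro a b h ha
        have : a = b := Fin.ext (by simpa using h)
        exact this ▸ ha
      | succ d ih =>
        intro a b h ha
        have ha0 : a ≠ 0 := by
          intro h0
          rw [h0] at h
          simp at h
        refine ih (a - 1) b ?_ (hcon a ha ha0)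
        rw [Fin.val_sub_one_of_ne_zero ha0]
        omega
    exact key (a.val - b.val) a b (by have : b.val ≤ a.val := hba; omega) ha
  obtain ⟨i, hi, hi0, hi1⟩ := this
  have hne : i - 1 ∉ Z.erase i := fun h => hi1 (Finset.mem_of_mem_erase h)
  have hii : i ≠ i - 1 := fun h => hi1 (h ▸ hi)
  refine ⟨insert (i - 1) (Z.erase i), i - 1, Finset.mem_insert_self _ _, ?_, ?_, ?_, ?_⟩
  · rw [sub_add_cancel]
    simp [hii]
  · ext x
    simp only [mem_moveSet, Finset.mem_insert, Finset.mem_erase, Finset.mem_singleton,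
      sub_left_inj]
    constructor
    · rintro (⟨h | h, h'⟩ | rfl)
      · exact (h' h).elim
      · exact h.2
      · exact hi
    · intro h
      by_cases hx : x = i
      · exact Or.inr hx
      · exact Or.inl ⟨Or.inr ⟨hx, h⟩, fun h' => hi1 (h' ▸ h)⟩
  · rw [Finset.card_insert_of_notMem hne, Finset.card_erase_of_mem hi]
    have := Finset.card_pos.2 ⟨i, hi⟩
    omega
  · rw [Finset.sum_insert hne, ← Finset.add_sum_erase Z _ hi, Fin.val_sub_one_of_ne_zero hi0]
    have : i.val ≠ 0 := fun h => hi0 (Fin.ext h)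
    omega

/-- A nonnegative invariant function that vanishes at some `k`-particle configuration vanishes at
a packed one. -/
theorem exists_isLowerSet_eq_zero (hp0 : 0 < p) (hp1 : p < 1) (hπ0 : 0 < π) (hπ1 : π < 1)
    {ν : Config n → ℝ} {k : ℕ}
    (hν : ∀ Z, Z.card = k → 0 ≤ ν Z)
    (hbal : ∀ Z', Z'.card = k → ∑ Z, ν Z * stepProb p π Z Z' = ν Z') :
    ∀ (m : ℕ) (Z : Config n), ∑ j ∈ Z, j.val = m → Z.card = k → ν Z = 0 →
      ∃ Y : Config n, Y.card = k ∧ IsLowerSet (Y : Set (Fin n)) ∧ ν Y = 0 := by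
  intro m
  induction m using Nat.strong_induction_on with
  | _ m ih =>
    intro Z hm hZk hZ
    by_cases hL : IsLowerSet (Z : Set (Fin n))
    · exact ⟨Z, hZk, hL, hZ⟩
    obtain ⟨Y, i, hiY, hi1, rfl, hcard, hlt⟩ := exists_pred_of_not_isLowerSet hL
    have hP : 0 < stepProb p π Y (moveSet Y {i}) :=
      (moversProb_singleton_pos hp0 hp1 hπ0 hπ1 hi1).trans_le
        (stepProb_moveSet_ge hp0.le hp1.le hπ0.le hπ1.le (Finset.singleton_subset_iff.2 hiY))
    have h0 : ∑ X, ν X * stepProb p π X (moveSet Y {i}) = 0 := by rw [hbal _ hZk, hZ]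
    have hnn : ∀ X ∈ (Finset.univ : Finset (Config n)),
        0 ≤ ν X * stepProb p π X (moveSet Y {i}) := by
      intro X _
      by_cases hX : stepProb p π X (moveSet Y {i}) = 0
      · rw [hX, mul_zero]
      · refine mul_nonneg (hν X ?_) (stepProb_nonneg hp0.le hp1.le hπ0.le hπ1.le _ _)
        rw [← card_eq_of_stepProb_ne_zero hX, hZk]
    have := (Finset.sum_eq_zero_iff_of_nonneg hnn).1 h0 Y (Finset.mem_univ _)
    have hY : ν Y = 0 := (mul_eq_zero.1 this).resolve_right hP.ne'
    exact ih _ (hm ▸ hlt) Y rfl (hcard.trans hZk) hY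

theorem isLowerSet_eq {Y Y' : Config n} (hY : IsLowerSet (Y : Set (Fin n)))
    (hY' : IsLowerSet (Y' : Set (Fin n))) (h : Y.card = Y'.card) : Y = Y' := by
  rcases hY.total hY' with h' | h'
  · exact Finset.eq_of_subset_of_card_le (by exact_mod_cast h') h.ge
  · exact (Finset.eq_of_subset_of_card_le (by exact_mod_cast h') h.le).symm

/-- With c and d the extreme values of μ / `zrWeight`, both μ - c w and d w - μ are nonnegative,
invariant and vanish somewhere, hence both vanish at the packed configuration, which forces c = d.
-/
theorem IsStationaryDist.eq_const_mul (hp0 : 0 < p) (hp1 : p < 1) (hπ0 : 0 < π) (hπ1 : π < 1)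
    {k : ℕ} (hk : k ≤ n) {μ : Config n → ℝ} (h : IsStationaryDist k (stepProb p π) μ) :
    ∃ c, ∀ Z, Z.card = k → μ Z = c * zrWeight p π Z := by
  have hw := fun Z : Config n => zrWeight_pos hp0 hp1 hπ0 hπ1 Z
  have hne : (Finset.univ.filter fun Z : Config n => Z.card = k).Nonempty := by
    obtain ⟨t, _, ht⟩ := Finset.exists_subset_card_eq (s := (Finset.univ : Finset (Fin n))) (n := k)
      (by simpa using hk)
    exact ⟨t, by simpa using ht⟩
  obtain ⟨Z₀, hZ₀, hmin⟩ := Finset.exists_min_image _ (fun Z => μ Z / zrWeight p π Z) hne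
  obtain ⟨Z₁, hZ₁, hmax⟩ := Finset.exists_max_image _ (fun Z => μ Z / zrWeight p π Z) hne
  simp only [Finset.mem_filter, Finset.mem_univ, true_and] at hZ₀ hZ₁ hmin hmax
  set c := μ Z₀ / zrWeight p π Z₀ with hc
  set d := μ Z₁ / zrWeight p π Z₁ with hd
  have h1 : ∀ Z, Z.card = k → 0 ≤ μ Z - c * zrWeight p π Z := by
    intro Z hZ
    have := (le_div_iff₀ (hw Z)).1 (hmin Z hZ)
    linarith
  have h2 : ∀ Z, Z.card = k → 0 ≤ d * zrWeight p π Z - μ Z := by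
    intro Z hZ
    have := (div_le_iff₀ (hw Z)).1 (hmax Z hZ)
    linarith
  have hb := zrWeight_balance (n := n) hp0 hp1 hπ0 hπ1
  obtain ⟨Y, hYk, hYL, hY⟩ := exists_isLowerSet_eq_zero hp0 hp1 hπ0 hπ1
    (ν := fun Z => μ Z - c * zrWeight p π Z) h1 (by
      intro Z' _
      simp only [sub_mul, mul_assoc]
      rw [Finset.sum_sub_distrib, ← Finset.mul_sum, hb, h.balance]) _ Z₀ rfl hZ₀ (by
      simp only [hc]; rw [div_mul_cancel₀ _ (hw Z₀).ne', sub_self])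
  obtain ⟨Y', hYk', hYL', hY'⟩ := exists_isLowerSet_eq_zero hp0 hp1 hπ0 hπ1
    (ν := fun Z => d * zrWeight p π Z - μ Z) h2 (by
      intro Z' _
      simp only [sub_mul, mul_assoc]
      rw [Finset.sum_sub_distrib, ← Finset.mul_sum, hb, h.balance]) _ Z₁ rfl hZ₁ (by
      simp only [hd]; rw [div_mul_cancel₀ _ (hw Z₁).ne', sub_self])
  have hYY : Y = Y' := isLowerSet_eq hYL hYL' (hYk.trans hYk'.symm)
  subst hYY
  have hcd : c = d := by
    have : (c - d) * zrWeight p π Y = 0 := by linear_combination -hY - hY'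
    have := (mul_eq_zero.1 this).resolve_right (hw Y).ne'
    linarith
  refine ⟨c, fun Z hZ => ?_⟩
  have := h1 Z hZ
  have := h2 Z hZ
  rw [← hcd] at this
  linarith

/-- The stationary flux of the zero-range model is the mean of `ψ` under the product measure. -/
theorem steadyFluxes_stepProb (hp0 : 0 < p) (hp1 : p < 1) (hπ0 : 0 < π) (hπ1 : π < 1)
    {k : ℕ} (hk : k ≤ n) (ψ : Config n → ℝ) :
    steadyFluxes k (stepProb p π) ψ
      = {(∑ Z : Config n with Z.card = k, zrWeight p π Z * ψ Z) / (∑ Z : Config n with Z.card = k, zrWeight p π Z) / n} := by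
  have key : ∀ μ : Config n → ℝ, IsStationaryDist k (stepProb p π) μ →
      (∑ Z, μ Z * ψ Z) / n = (∑ Z : Config n with Z.card = k, zrWeight p π Z * ψ Z) /
        (∑ Z : Config n with Z.card = k, zrWeight p π Z) / n := by
    intro μ hμ
    obtain ⟨c, hc⟩ := hμ.eq_const_mul hp0 hp1 hπ0 hπ1 hk
    have h1 : ∀ g : Config n → ℝ, ∑ Z, μ Z * g Z
        = c * ∑ Z : Config n with Z.card = k, zrWeight p π Z * g Z := by
      intro g
      rw [Finset.mul_sum, Finset.sum_filter]
      refine Finset.sum_congr rfl fun Z _ => ?_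
      split_ifs with h
      · rw [hc Z h]; ring
      · rw [hμ.support Z h, zero_mul]
    have h2 : c * ∑ Z : Config n with Z.card = k, zrWeight p π Z = 1 := by
      have := h1 (fun _ => 1)
      simp only [mul_one] at this
      rw [← this, hμ.total]
    rw [h1 ψ]
    have h3 : ∑ Z : Config n with Z.card = k, zrWeight p π Z ≠ 0 := right_ne_zero_of_mul (h2.trans_ne one_ne_zero)
    congr 1
    rw [eq_div_iff h3]
    linear_combination (∑ Z : Config n with Z.card = k, zrWeight p π Z * ψ Z) * h2
  ext x
  simp only [steadyFluxes, Set.mem_ofPred_eq, Set.mem_singleton_iff]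
  constructor
  · rintro ⟨μ, hμ, rfl⟩
    exact key μ hμ
  · rintro rfl
    obtain ⟨μ, hμ⟩ := exists_isStationaryDist (n := n) hk
      (stepProb_nonneg hp0.le hp1.le hπ0.le hπ1.le) (fun Z _ => sum_stepProb p π Z)
      (fun Z Z' h => card_eq_of_stepProb_ne_zero (n := n) h)
    exact ⟨μ, hμ, (key μ hμ).symm⟩

end ProductForm

/-! ## Counting configurations by words -/

section Counting

theorem Fin.ofNat_succ {n : ℕ} [NeZero n] (i : ℕ) : Fin.ofNat n (i + 1) = Fin.ofNat n i + 1 := by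
  ext
  simp [Fin.val_add]

theorem Fin.ofNat_val_self {n : ℕ} [NeZero n] (x : Fin n) : Fin.ofNat n x.val = x := by
  ext
  simp

theorem Fin.ofNat_self_eq_zero {n : ℕ} [NeZero n] : Fin.ofNat n n = 0 := by
  ext
  simp

theorem Fin.ofNat_zero_eq_zero {n : ℕ} [NeZero n] : Fin.ofNat n 0 = 0 := by
  ext
  simp

/-- Product of local weights over the particles: `r` if blocked, `g₂` at the head of a longer
cluster, `g₁` if free. -/
noncomputable def locWeight (r g₁ g₂ : ℝ) {n : ℕ} [NeZero n] (Z : Config n) : ℝ :=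
  ∏ i ∈ Z, if i + 1 ∈ Z then r else if i - 1 ∈ Z then g₂ else g₁

/-- The local weight of a letter, given its neighbours. -/
noncomputable def letterWeight (r g₁ g₂ : ℝ) (a b c : Bool) : ℝ :=
  if b then if c then r else if a then g₂ else g₁ else 1

/-- Weight of a queue of given length. -/
noncomputable def queueWeight (r g₁ g₂ : ℝ) : ℕ → ℝ
  | 0 => 1
  | 1 => g₁
  | m + 2 => r ^ (m + 1) * g₂

/-- Weight of a word read from left to right with `s` pending particles; words that do not end in
a hole have weight `0`. -/
noncomputable def wordWeight (f : ℕ → ℝ) : ℕ → List Bool → ℝ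
  | s, [] => if s = 0 then 1 else 0
  | s, true :: l => wordWeight f (s + 1) l
  | s, false :: l => f s * wordWeight f 0 l

variable (r g₁ g₂ : ℝ)

/-- `G 0` is the letter just before the word. In the second clause s + 1 particles are pending: the
factor r ^ s pays for the earlier ones, and the next factor is the local weight of the particle at
`G 0`, which depends on the letter after it. -/
theorem wordWeight_ofFn (m : ℕ) : ∀ (G : ℕ → Bool), G m = false →
    (G 0 = false → wordWeight (queueWeight r g₁ g₂) 0 (List.ofFn fun i : Fin m => G (i + 1))
      = ∏ i ∈ Finset.range m, letterWeight r g₁ g₂ (G i) (G (i + 1)) (G (i + 2))) ∧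
    (G 0 = true → ∀ s, wordWeight (queueWeight r g₁ g₂) (s + 1)
        (List.ofFn fun i : Fin m => G (i + 1))
      = r ^ s * (if G 1 then r else if s = 0 then g₁ else g₂) *
        ∏ i ∈ Finset.range m, letterWeight r g₁ g₂ (G i) (G (i + 1)) (G (i + 2))) := by
  induction m with
  | zero =>
    intro G hG
    refine ⟨fun _ => by simp [wordWeight], fun h => ?_⟩
    rw [hG] at h
    exact absurd h (by simp)
  | succ m ih =>
    intro G hG
    obtain ⟨ih0, ih1⟩ := ih (fun i => G (i + 1)) hG
    rw [List.ofFn_succ, Finset.prod_range_succ']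
    simp only [Fin.val_succ, Fin.val_zero] at ih0 ih1 ⊢
    simp only [Nat.zero_add, show ∀ i, i + 2 + 1 = i + 1 + 2 from fun _ => rfl] at ih0 ih1 ⊢
    refine ⟨fun h0 => ?_, fun h0 s => ?_⟩
    · cases h1 : G 1 with
      | false => rw [wordWeight, ih0 h1]; simp [letterWeight, queueWeight]
      | true =>
        rw [wordWeight, ih1 h1 0]
        simp only [letterWeight, h0, pow_zero, if_true]
        simp [mul_comm]
    · cases h1 : G 1 with
      | false =>
        rw [wordWeight, ih0 h1]
        cases s <;> simp [letterWeight, queueWeight]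
      | true =>
        rw [wordWeight, ih1 h1 (s + 1)]
        simp only [letterWeight, h0, if_true]
        simp [pow_succ]
        split_ifs <;> ring

theorem locWeight_eq_wordWeight {m : ℕ} (Z : Config (m + 1)) (hZ : Fin.last m ∉ Z) :
    locWeight r g₁ g₂ Z
      = wordWeight (queueWeight r g₁ g₂) 0 (List.ofFn fun i => decide (i ∈ Z)) := by
  -- Indices are shifted by one so that `G 0` is the last site. As it is a hole, no cluster wraps
  -- around the cut.
  let G : ℕ → Bool := fun j => decide (Fin.ofNat (m + 1) j - 1 ∈ Z)
  have hlast : (0 : Fin (m + 1)) - 1 = Fin.last m := by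
    rw [sub_eq_iff_eq_add, Fin.last_add_one]
  have hGm : G (m + 1) = false := by
    simp only [G, decide_eq_false_iff_not, Fin.ofNat_self_eq_zero]
    rwa [hlast]
  have hG0 : G 0 = false := by
    simp only [G, decide_eq_false_iff_not, Fin.ofNat_zero_eq_zero]
    rwa [hlast]
  have hG1 : ∀ i : Fin (m + 1), G (i.val + 1) = decide (i ∈ Z) := by
    intro i
    simp only [G, Fin.ofNat_succ, Fin.ofNat_val_self, add_sub_cancel_right]
  have := (wordWeight_ofFn r g₁ g₂ (m + 1) G hGm).1 hG0
  simp only [hG1] at this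
  rw [this, Finset.prod_range fun i => letterWeight r g₁ g₂ (G i) (G (i + 1)) (G (i + 2)),
    locWeight]
  rw [← Finset.prod_subset (Finset.subset_univ Z)]
  · refine Finset.prod_congr rfl fun i hi => ?_
    have h2 : G (i.val + 2) = decide (i + 1 ∈ Z) := by
      simp only [G, Fin.ofNat_succ, Fin.ofNat_val_self, add_sub_cancel_right]
    have h0 : G i.val = decide (i - 1 ∈ Z) := by
      simp only [G, Fin.ofNat_val_self]
    rw [hG1, h2, h0, letterWeight]
    simp [hi]
  · intro i _ hi
    rw [hG1, letterWeight]
    simp [hi]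

/-- Sum of the word weights over the words of length `m` with `k` particles. -/
noncomputable def wordSum (f : ℕ → ℝ) (s m k : ℕ) : ℝ :=
  ∑ v : Fin m → Bool, if ∑ i, (v i).toNat = k then wordWeight f s (List.ofFn v) else 0

theorem wordSum_succ (f : ℕ → ℝ) (s m k : ℕ) :
    wordSum f s (m + 1) k
      = (if k = 0 then 0 else wordSum f (s + 1) m (k - 1)) + f s * wordSum f 0 m k := by
  have : wordSum f s (m + 1) k = ∑ b : Bool, ∑ v : Fin m → Bool,
      if b.toNat + ∑ i, (v i).toNat = k then wordWeight f s (b :: List.ofFn v) else 0 := by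
    rw [wordSum, ← (Fin.consEquiv (fun _ : Fin (m + 1) => Bool)).sum_comp, Fintype.sum_prod_type]
    refine Finset.sum_congr rfl fun b _ => Finset.sum_congr rfl fun v _ => ?_
    simp [Fin.consEquiv, Fin.sum_univ_succ, List.ofFn_succ]
  rw [this, Fintype.sum_bool]
  congr 1
  · cases k with
    | zero => simp
    | succ k => simp [wordSum, wordWeight, Nat.add_comm 1]
  · simp [wordSum, wordWeight, Finset.mul_sum]

theorem wordSum_of_lt (f : ℕ → ℝ) (s m k : ℕ) (h : m < k) : wordSum f s m k = 0 := by
  refine Finset.sum_eq_zero fun v _ => if_neg fun h' => ?_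
  have : ∑ i, (v i).toNat ≤ ∑ _i : Fin m, 1 := Finset.sum_le_sum fun i _ => Bool.toNat_le _
  simp at this
  omega

theorem wordSum_self (f : ℕ → ℝ) (k : ℕ) : ∀ s, wordSum f s k k = if s = 0 ∧ k = 0 then 1 else 0 := by
  induction k with
  | zero => intro s; simp [wordSum, wordWeight]
  | succ k ih =>
    intro s
    rw [wordSum_succ, wordSum_of_lt f 0 k (k + 1) (by omega)]
    simp [ih]

/-- A word ending in a hole is a sequence of queues, one per hole, so its generating function is a
power. The second clause, where s pending particles are joined by t more in the first queue,
strengthens the induction. -/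
theorem wordSum_eq_coeff (f : ℕ → ℝ) (m : ℕ) : ∀ N k, m = N + k →
    wordSum f 0 m k = PowerSeries.coeff k (PowerSeries.mk f ^ N) ∧
    ∀ s, wordSum f s (m + 1) k = ∑ t ∈ Finset.range (k + 1),
      f (s + t) * PowerSeries.coeff (k - t) (PowerSeries.mk f ^ N) := by
  induction m with
  | zero =>
    intro N k h
    obtain ⟨rfl, rfl⟩ : N = 0 ∧ k = 0 := by omega
    have h0 : wordSum f 0 0 0 = 1 := by simp [wordSum_self]
    refine ⟨by simp [h0], fun s => ?_⟩
    rw [wordSum_succ, h0]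
    simp
  | succ m ih =>
    intro N k h
    have h1 : wordSum f 0 (m + 1) k = PowerSeries.coeff k (PowerSeries.mk f ^ N) := by
      cases N with
      | zero =>
        obtain rfl : m + 1 = k := by omega
        rw [wordSum_self, pow_zero, PowerSeries.coeff_one]
        simp
      | succ N =>
        rw [(ih N k (by omega)).2 0, pow_succ', PowerSeries.coeff_mul,
          Finset.Nat.sum_antidiagonal_eq_sum_range_succ_mk]
        simp
    refine ⟨h1, fun s => ?_⟩
    rw [wordSum_succ, h1]
    cases k with
    | zero => simp
    | succ k =>
      rw [Finset.sum_range_succ', if_neg (by omega), Nat.add_sub_cancel,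
        (ih N k (by omega)).2 (s + 1)]
      simp [add_assoc, add_comm 1]

theorem sum_locWeight_last_notMem {m k N : ℕ} (h : m + 1 = N + k) :
    ∑ Z : Config (m + 1) with Z.card = k ∧ Fin.last m ∉ Z, locWeight r g₁ g₂ Z
      = PowerSeries.coeff k (PowerSeries.mk (queueWeight r g₁ g₂) ^ N) := by
  rw [← (wordSum_eq_coeff _ (m + 1) N k h).1, wordSum]
  let e : Config (m + 1) ≃ (Fin (m + 1) → Bool) :=
    { toFun := fun Z i => decide (i ∈ Z)
      invFun := fun v => Finset.univ.filter fun i => v i = true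
      left_inv := fun Z => by ext; simp
      right_inv := fun v => by ext; simp }
  rw [← e.sum_comp, Finset.sum_filter]
  refine Finset.sum_congr rfl fun Z _ => ?_
  have hc : ∑ i, (e Z i).toNat = Z.card := by
    simp only [e, Equiv.coe_fn_mk]
    rw [Finset.card_eq_sum_ones, ← Finset.sum_subset (Finset.subset_univ Z)]
    · exact Finset.sum_congr rfl fun i hi => by simp [hi]
    · intro i _ hi; simp [hi]
  rw [hc]
  by_cases h1 : Z.card = k <;> by_cases h2 : Fin.last m ∈ Z
  · rw [if_neg (by simp [h2]), if_pos h1]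
    symm
    have key : ∀ (l : List Bool) (s : ℕ), wordWeight (queueWeight r g₁ g₂) s (l ++ [true]) = 0 := by
      intro l
      induction l with
      | nil => intro s; simp [wordWeight]
      | cons b l ih => intro s; cases b <;> simp [wordWeight, ih]
    rw [List.ofFn_succ', List.concat_eq_append]
    have : e Z (Fin.last m) = true := by simpa [e] using h2
    rw [this, key]
  · rw [if_pos ⟨h1, h2⟩, if_pos h1, locWeight_eq_wordWeight r g₁ g₂ Z h2]
    rfl
  · simp [h1]
  · simp [h1]

theorem locWeight_map_add {n : ℕ} [NeZero n] (c : Fin n) (Z : Config n) :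
    locWeight r g₁ g₂ (Z.map (Equiv.addRight c).toEmbedding) = locWeight r g₁ g₂ Z := by
  have hm : ∀ x : Fin n, x + c ∈ Z.map (Equiv.addRight c).toEmbedding ↔ x ∈ Z := by
    intro x
    simp
  rw [locWeight, locWeight, Finset.prod_map]
  refine Finset.prod_congr rfl fun i _ => ?_
  have h1 := hm (i + 1)
  have h2 := hm (i - 1)
  rw [show i + 1 + c = i + c + 1 by abel] at h1
  rw [show i - 1 + c = i + c - 1 by abel] at h2
  simp only [Equiv.coe_toEmbedding, Equiv.coe_addRight, h1, h2]

/-- Count pairs of a configuration and one of its N holes: a rotation carries the chosen hole to any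
prescribed one of the n sites, in particular to the cut. -/
theorem sum_locWeight {n k N : ℕ} [NeZero n] (h : n = N + k) :
    N * ∑ Z : Config n with Z.card = k, locWeight r g₁ g₂ Z
      = n * PowerSeries.coeff k (PowerSeries.mk (queueWeight r g₁ g₂) ^ N) := by
  obtain ⟨m, rfl⟩ : ∃ m, n = m + 1 := ⟨n - 1, by have := NeZero.pos n; omega⟩
  have h1 : (N : ℝ) * ∑ Z : Config (m + 1) with Z.card = k, locWeight r g₁ g₂ Z
      = ∑ x : Fin (m + 1), ∑ Z : Config (m + 1) with Z.card = k ∧ x ∉ Z,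
        locWeight r g₁ g₂ Z := by
    simp only [Finset.sum_filter, Finset.mul_sum]
    rw [Finset.sum_comm]
    refine Finset.sum_congr rfl fun Z _ => ?_
    by_cases hk : Z.card = k
    · simp only [hk, true_and, if_true]
      rw [← Finset.sum_filter, Finset.sum_const, nsmul_eq_mul]
      congr 2
      have : (Finset.univ.filter fun x => x ∉ Z) = Zᶜ := by ext; simp
      rw [this, Finset.card_compl, Fintype.card_fin]
      omega
    · simp [hk]
  rw [h1, Finset.sum_eq_card_nsmul (b := PowerSeries.coeff k
    (PowerSeries.mk (queueWeight r g₁ g₂) ^ N))]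
  · simp
  · intro x _
    rw [← sum_locWeight_last_notMem r g₁ g₂ h]
    refine Finset.sum_bij (fun Z _ => Z.map (Equiv.addRight (Fin.last m - x)).toEmbedding) ?_ ?_ ?_ ?_
    · intro Z hZ
      simp only [Finset.mem_filter, Finset.mem_univ, true_and, Finset.card_map] at hZ ⊢
      refine ⟨hZ.1, fun h' => hZ.2 ?_⟩
      simp only [Finset.mem_map, Equiv.coe_toEmbedding, Equiv.coe_addRight] at h'
      obtain ⟨a, ha, hax⟩ := h'
      have : a = x := by
        have := sub_eq_zero.2 hax
        rw [show a + (Fin.last m - x) - Fin.last m = a - x by abel, sub_eq_zero] at this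
        exact this
      exact this ▸ ha
    · intro Z _ Z' _ hZZ
      exact Finset.map_injective _ hZZ
    · intro Z hZ
      simp only [Finset.mem_filter, Finset.mem_univ, true_and] at hZ
      refine ⟨Z.map (Equiv.addRight (x - Fin.last m)).toEmbedding, ?_, ?_⟩
      · simp only [Finset.mem_filter, Finset.mem_univ, true_and, Finset.card_map]
        refine ⟨hZ.1, fun h' => hZ.2 ?_⟩
        simp only [Finset.mem_map, Equiv.coe_toEmbedding, Equiv.coe_addRight] at h'
        obtain ⟨a, ha, hax⟩ := h'
        have : a = Fin.last m := by
          have := sub_eq_zero.2 hax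
          rw [show a + (x - Fin.last m) - x = a - Fin.last m by abel, sub_eq_zero] at this
          exact this
        exact this ▸ ha
      · ext y
        simp only [Finset.mem_map, Equiv.coe_toEmbedding, Equiv.coe_addRight]
        constructor
        · rintro ⟨_, ⟨a, ha, rfl⟩, rfl⟩
          rwa [show a + (x - Fin.last m) + (Fin.last m - x) = a by abel]
        · exact fun hy => ⟨_, ⟨y, hy, rfl⟩, by abel⟩
    · intro Z _
      exact (locWeight_map_add r g₁ g₂ _ Z).symm

end Counting

/-! ## Explicit partition function -/

section Partition

/-- Number of compositions of `j` into `c` positive parts. -/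
def compCount : ℕ → ℕ → ℕ
  | 0, 0 => 1
  | 0, _ + 1 => 0
  | _ + 1, 0 => 0
  | j + 1, c + 1 => j.choose c

theorem compCount_succ_succ (j c : ℕ) :
    compCount (j + 1) (c + 1) = compCount j c + compCount j (c + 1) := by
  cases j <;> cases c <;> simp [compCount, Nat.choose_succ_succ]

theorem compCount_eq_zero_of_lt : ∀ {j c : ℕ}, j < c → compCount j c = 0
  | 0, _ + 1, _ => rfl
  | _ + 1, _ + 1, h => Nat.choose_eq_zero_of_lt (by omega)

open PowerSeries in
-- With g the geometric series, g = 1 + r X g turns into a recursion for powers of X g that matches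
-- the Pascal rule of `compCount`.
theorem coeff_X_mul_geom_pow (r : ℝ) (c : ℕ) : ∀ j,
    coeff j ((X * mk fun s => r ^ s : PowerSeries ℝ) ^ c) = r ^ (j - c) * compCount j c := by
  have hg : (mk fun s => r ^ s : PowerSeries ℝ) = 1 + C r * (X * mk fun s => r ^ s) := by
    ext j
    cases j with
    | zero => simp
    | succ j => simp [coeff_succ_X_mul, coeff_one, pow_succ, mul_comm]
  induction c with
  | zero =>
    intro j
    cases j <;> simp [compCount, coeff_one]
  | succ c ih =>
    have hrec : (X * mk fun s => r ^ s : PowerSeries ℝ) ^ (c + 1)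
        = X * ((X * mk fun s => r ^ s) ^ c + C r * (X * mk fun s => r ^ s) ^ (c + 1)) := by
      generalize (mk fun s => r ^ s : PowerSeries ℝ) = g at hg
      linear_combination (X * (X * g) ^ c) * hg
    intro j
    induction j with
    | zero => rw [hrec]; simp [compCount]
    | succ j ihj =>
      rw [hrec, coeff_succ_X_mul, map_add, coeff_C_mul, ih, ihj, compCount_succ_succ]
      push_cast
      rcases le_or_gt (c + 1) j with h | h
      · rw [show j - c = j - (c + 1) + 1 by omega, pow_succ]
        ring
      · rw [compCount_eq_zero_of_lt h]
        simp

/-- Weight of the configurations with `E` movers and `c` residual clusters. -/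
noncomputable def pairMass (r q : ℝ) (N k E c : ℕ) : ℝ :=
  N.choose E * N.choose c * compCount (k - E) c * q ^ c * r ^ (k - E - c)

open PowerSeries in
-- The queue series factors as (1 + uX)(1 + qX / (1 - rX)): at each hole, an optional mover and,
-- independently, an optional residual cluster. Expanding the N-th power separates the two counts.
theorem coeff_queueWeight_pow {r : ℝ} (hr : r ≠ 0) (q u : ℝ) (N k : ℕ) :
    coeff k (mk (queueWeight r (q + u) (q + u * (q / r))) ^ N)
      = ∑ E ∈ Finset.range (k + 1), u ^ E * ∑ c ∈ Finset.range (N + 1), pairMass r q N k E c := by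
  have hF : mk (queueWeight r (q + u) (q + u * (q / r)))
      = (1 + C u * X) * (1 + C q * (X * mk fun s => r ^ s)) := by
    ext j
    rw [add_mul, one_mul, map_add, mul_assoc, coeff_C_mul]
    match j with
    | 0 => simp [queueWeight]
    | 1 => simp [queueWeight, coeff_one, coeff_succ_X_mul]
    | j + 2 =>
      rw [show j + 2 = (j + 1) + 1 from rfl]
      simp only [coeff_succ_X_mul, coeff_mk, map_add, coeff_C_mul, coeff_one, queueWeight]
      simp [pow_succ]
      field_simp
  rw [hF, mul_pow, coeff_mul, Finset.Nat.sum_antidiagonal_eq_sum_range_succ_mk]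
  refine Finset.sum_congr rfl fun E _ => ?_
  have h1 : coeff E ((1 + C u * X : PowerSeries ℝ) ^ N) = N.choose E * u ^ E := by
    rw [add_comm, add_pow, map_sum]
    have : ∀ m ∈ Finset.range (N + 1), coeff E ((C u * X : PowerSeries ℝ) ^ m * 1 ^ (N - m)
        * (N.choose m : PowerSeries ℝ)) = if E = m then N.choose m * u ^ m else 0 := by
      intro m _
      rw [one_pow, mul_one, mul_pow, ← map_pow, mul_assoc, coeff_C_mul,
        show ((N.choose m : ℕ) : PowerSeries ℝ) = C (N.choose m : ℝ) by simp, coeff_mul_C,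
        coeff_X_pow]
      split_ifs <;> ring
    rw [Finset.sum_congr rfl this, Finset.sum_ite_eq]
    split_ifs with h
    · rfl
    · rw [Nat.choose_eq_zero_of_lt (by simpa using h)]; simp
  have h2 : coeff (k - E) ((1 + C q * (X * mk fun s => r ^ s) : PowerSeries ℝ) ^ N)
      = ∑ c ∈ Finset.range (N + 1), N.choose c * (compCount (k - E) c * q ^ c * r ^ (k - E - c)) := by
    rw [add_comm, add_pow, map_sum]
    refine Finset.sum_congr rfl fun c _ => ?_
    rw [one_pow, mul_one, mul_pow, ← map_pow,
      show ((N.choose c : ℕ) : PowerSeries ℝ) = C (N.choose c : ℝ) by simp, coeff_mul_C,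
      coeff_C_mul, coeff_X_mul_geom_pow]
    ring
  rw [h1, h2, Finset.mul_sum, Finset.mul_sum]
  refine Finset.sum_congr rfl fun c _ => ?_
  rw [pairMass]
  ring

variable {n : ℕ} [NeZero n] {p π : ℝ}

/-- The product is the generating function, in u, of the number of movers from Z. Weighted, it stays
a product of local weights, so the same counting applies for every u. -/
theorem zrWeight_mul_prod (hp1 : p < 1) (hπ0 : 0 < π) (u : ℝ) (Z : Config n) :
    zrWeight p π Z * ∏ i ∈ Z, (1 + (u - 1) * hopProb p π Z i)
      = locWeight ((1 - p) / p) ((1 - π) / π + u)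
        ((1 - π) / π + u * ((1 - π) / π / ((1 - p) / p))) Z := by
  rw [zrWeight, locWeight, ← Finset.prod_mul_distrib]
  refine Finset.prod_congr rfl fun i _ => ?_
  have h1 : 1 - p ≠ 0 := by linarith
  rw [hopProb_eq]
  split_ifs
  · ring
  · field_simp; ring
  · field_simp; ring

/-- Differentiate the marked partition function at u = 1. The factor n / N from the choice of the
cut cancels in the quotient. -/
theorem sum_zrWeight_mul_hop (hp0 : 0 < p) (hp1 : p < 1) (hπ0 : 0 < π) {k N : ℕ}
    (h : n = N + k) (hN : 0 < N) :
    (∑ Z : Config n with Z.card = k, zrWeight p π Z * ∑ i ∈ Z, hopProb p π Z i) /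
        (∑ Z : Config n with Z.card = k, zrWeight p π Z)
      = (∑ E ∈ Finset.range (k + 1), ∑ c ∈ Finset.range (N + 1),
          pairMass ((1 - p) / p) ((1 - π) / π) N k E c * E) /
        ∑ E ∈ Finset.range (k + 1), ∑ c ∈ Finset.range (N + 1),
          pairMass ((1 - p) / p) ((1 - π) / π) N k E c := by
  set r := (1 - p) / p
  set q := (1 - π) / π
  have hr : r ≠ 0 := div_ne_zero (by linarith) hp0.ne'
  have hN' : (N : ℝ) ≠ 0 := by positivity
  have hn' : (n : ℝ) ≠ 0 := by have := NeZero.pos n; positivity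
  have hfun : ∀ u : ℝ, N * ∑ Z : Config n with Z.card = k,
      zrWeight p π Z * ∏ i ∈ Z, (1 + (u - 1) * hopProb p π Z i)
      = n * ∑ E ∈ Finset.range (k + 1), u ^ E *
        ∑ c ∈ Finset.range (N + 1), pairMass r q N k E c := by
    intro u
    rw [← coeff_queueWeight_pow hr, ← sum_locWeight _ _ _ h]
    congr 1
    exact Finset.sum_congr rfl fun Z _ => zrWeight_mul_prod hp1 hπ0 u Z
  have h0 := hfun 1
  simp only [sub_self, zero_mul, add_zero, Finset.prod_const_one, mul_one, one_pow, one_mul] at h0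
  have hd1 : HasDerivAt (fun u : ℝ => N * ∑ Z : Config n with Z.card = k,
      zrWeight p π Z * ∏ i ∈ Z, (1 + (u - 1) * hopProb p π Z i))
      (N * ∑ Z : Config n with Z.card = k, zrWeight p π Z * ∑ i ∈ Z, hopProb p π Z i) 1 := by
    refine HasDerivAt.const_mul _ (HasDerivAt.fun_sum fun Z _ => HasDerivAt.const_mul _ ?_)
    have := HasDerivAt.fun_finsetProd (u := Z) (x := (1 : ℝ))
      (f := fun i u => 1 + (u - 1) * hopProb p π Z i)
      (f' := fun i => hopProb p π Z i) (fun i _ => by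
        simpa using (((hasDerivAt_id (1 : ℝ)).sub_const 1).mul_const (hopProb p π Z i)).const_add 1)
    simpa using this
  have hd2 : HasDerivAt (fun u : ℝ => n * ∑ E ∈ Finset.range (k + 1), u ^ E *
      ∑ c ∈ Finset.range (N + 1), pairMass r q N k E c)
      (n * ∑ E ∈ Finset.range (k + 1), ∑ c ∈ Finset.range (N + 1), pairMass r q N k E c * E) 1 := by
    refine HasDerivAt.const_mul _ (HasDerivAt.fun_sum fun E _ => ?_)
    have := (hasDerivAt_pow E (1 : ℝ)).mul_const
      (∑ c ∈ Finset.range (N + 1), pairMass r q N k E c)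
    rw [one_pow, mul_one, mul_comm, Finset.sum_mul] at this
    exact this
  rw [funext hfun] at hd1
  have h1 := hd1.unique hd2
  have e1 := eq_div_of_mul_eq hN' ((mul_comm _ _).trans h1)
  have e0 := eq_div_of_mul_eq hN' ((mul_comm _ _).trans h0)
  rw [e1, e0]
  field_simp

end Partition

/-! ## Concentration for the explicit partition function -/

section Concentration

variable {r q : ℝ} {N k : ℕ}

theorem compCount_mul (j c : ℕ) :
    (compCount (j + 1) c : ℝ) * ((j : ℝ) + 1 - c) = j * compCount j c := by
  match j, c with
  | 0, 0 => simp [compCount]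
  | 0, 1 => simp [compCount]
  | 0, c + 2 => simp [compCount]
  | j + 1, 0 => simp [compCount]
  | j + 1, c + 1 =>
    simp only [compCount]
    rcases le_or_gt c j with h | h
    · have := Nat.choose_mul_succ_eq j c
      have h2 : ((j + 1 - c : ℕ) : ℝ) = (j : ℝ) + 1 - c := by
        rw [Nat.cast_sub (by omega)]; push_cast; ring
      have h3 : (j.choose c : ℝ) * (j + 1) = (j + 1).choose c * ((j + 1 - c : ℕ) : ℝ) := by
        exact_mod_cast this
      rw [h2] at h3
      push_cast
      linarith
    · rw [Nat.choose_eq_zero_of_lt h]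
      rcases Nat.lt_or_ge (j + 1) c with h' | h'
      · rw [Nat.choose_eq_zero_of_lt h']; simp
      · obtain rfl : c = j + 1 := by omega
        simp

theorem compCount_mul_sub (j c : ℕ) :
    (compCount j c : ℝ) * ((j : ℝ) - c) = c * compCount j (c + 1) := by
  match j, c with
  | 0, 0 => simp [compCount]
  | 0, c + 1 => simp [compCount]
  | j + 1, 0 => simp [compCount]
  | j + 1, c + 1 =>
    simp only [compCount]
    have := Nat.choose_succ_right_eq j c
    rcases le_or_gt c j with h | h
    · have h3 : (j.choose (c + 1) : ℝ) * (c + 1) = j.choose c * ((j : ℝ) - c) := by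
        rw [← Nat.cast_sub h]
        exact_mod_cast this
      push_cast
      linarith
    · rw [Nat.choose_eq_zero_of_lt h, Nat.choose_eq_zero_of_lt (by omega)]
      simp

theorem compCount_le_succ_succ (j c : ℕ) : compCount j c ≤ compCount (j + 1) (c + 1) := by
  rw [compCount_succ_succ]; omega

theorem choose_succ_mul (N E : ℕ) :
    (N.choose (E + 1) : ℝ) * (E + 1) = N.choose E * ((N : ℝ) - E) := by
  rcases le_or_gt E N with h | h
  · rw [← Nat.cast_sub h]
    exact_mod_cast Nat.choose_succ_right_eq N E
  · rw [Nat.choose_eq_zero_of_lt h, Nat.choose_eq_zero_of_lt (by omega)]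
    simp

theorem pairMass_nonneg (hr : 0 < r) (hq : 0 < q) (E c : ℕ) : 0 ≤ pairMass r q N k E c := by
  unfold pairMass; positivity

theorem of_pairMass_ne_zero {E c : ℕ} (h : pairMass r q N k E c ≠ 0) : E ≤ N ∧ c ≤ k - E := by
  constructor
  · by_contra h'
    exact h (by simp [pairMass, Nat.choose_eq_zero_of_lt (not_le.1 h')])
  · by_contra h'
    exact h (by simp [pairMass, compCount_eq_zero_of_lt (not_le.1 h')])

/-- The ratio of neighbouring masses is cross-multiplied, so that the identity survives vanishing
masses and factors. -/
theorem pairMass_succ_left {E c : ℕ} (hE : E < k) :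
    pairMass r q N k E c * (((N : ℝ) - E) * ((k : ℝ) - E - c))
      = r * (pairMass r q N k (E + 1) c * (((E : ℝ) + 1) * ((k : ℝ) - (E + 1)))) := by
  obtain ⟨j, rfl⟩ : ∃ j, k = E + 1 + j := ⟨k - (E + 1), by omega⟩
  have h1 := compCount_mul j c
  have h2 := choose_succ_mul N E
  simp only [pairMass]
  rw [show E + 1 + j - E = j + 1 by omega, show E + 1 + j - (E + 1) = j by omega]
  push_cast
  have e1 : ((E : ℝ) + 1 + j - E - c) = j + 1 - c := by ring
  have e2 : ((E : ℝ) + 1 + j - (E + 1)) = j := by ring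
  rw [e1, e2]
  rcases le_or_gt c j with h | h
  · rw [show j + 1 - c = j - c + 1 by omega, pow_succ]
    linear_combination (N.choose E * (N - E) * N.choose c * q ^ c * r ^ (j - c) * r) * h1
      - (j * compCount j c * N.choose c * q ^ c * r ^ (j - c) * r) * h2
  · have h0 : (compCount j c : ℝ) = 0 := by rw [compCount_eq_zero_of_lt h]; simp
    have h3 : (compCount (j + 1) c : ℝ) * ((j : ℝ) + 1 - c) = 0 := by rw [h1, h0, mul_zero]
    rw [h0]
    linear_combination (N.choose E * (N - E) * N.choose c * q ^ c * r ^ (j + 1 - c)) * h3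

theorem pairMass_succ_right (E c : ℕ) (hE : E ≤ k) :
    q * (pairMass r q N k E c * (((N : ℝ) - c) * ((k : ℝ) - E - c)))
      = r * (pairMass r q N k E (c + 1) * (((c : ℝ) + 1) * c)) := by
  obtain ⟨j, rfl⟩ : ∃ j, k = E + j := ⟨k - E, by omega⟩
  have h1 := compCount_mul_sub j c
  have h2 := choose_succ_mul N c
  simp only [pairMass]
  rw [show E + j - E = j by omega]
  push_cast
  have e1 : ((E : ℝ) + j - E - c) = j - c := by ring
  rw [e1]
  rcases le_or_gt (c + 1) j with h | h
  · rw [show j - c = j - (c + 1) + 1 by omega, pow_succ, pow_succ]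
    linear_combination (N.choose E * (N - c) * N.choose c * q ^ c * r ^ (j - (c + 1)) * r * q) * h1
      - (c * compCount j (c + 1) * N.choose E * q ^ c * q * r ^ (j - (c + 1)) * r) * h2
  · have h0 : (compCount j (c + 1) : ℝ) = 0 := by rw [compCount_eq_zero_of_lt h]; simp
    have h3 : (compCount j c : ℝ) * ((j : ℝ) - c) = 0 := by rw [h1, h0, mul_zero]
    rw [h0]
    linear_combination (N.choose E * (N - c) * N.choose c * q ^ c * r ^ (j - c) * q) * h3

/-- Turn a mover into a residual cluster. Appending a part of size one injects compositions of j
into c parts into compositions of j + 1 into c + 1 parts. -/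
theorem pairMass_shift_le (hr : 0 < r) (hq : 0 < q) {E c : ℕ} (hE : E < k) :
    pairMass r q N k (E + 1) c * (((E : ℝ) + 1) * (((N : ℝ) - c) * q))
      ≤ (N - E) * (c + 1) * pairMass r q N k E (c + 1) := by
  obtain ⟨j, rfl⟩ : ∃ j, k = E + 1 + j := ⟨k - (E + 1), by omega⟩
  by_cases hEN : E ≤ N
  swap
  · have h1 : N.choose (E + 1) = 0 := Nat.choose_eq_zero_of_lt (by omega)
    have h2 : N.choose E = 0 := Nat.choose_eq_zero_of_lt (by omega)
    simp [pairMass, h1, h2]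
  have h1 : (compCount j c : ℝ) ≤ compCount (j + 1) (c + 1) := by
    exact_mod_cast compCount_le_succ_succ j c
  have h2 := choose_succ_mul N E
  have h3 := choose_succ_mul N c
  simp only [pairMass]
  rw [show E + 1 + j - E = j + 1 by omega, show E + 1 + j - (E + 1) = j by omega,
    Nat.add_sub_add_right, pow_succ]
  have hA : 0 ≤ (N.choose E : ℝ) * (N - E) * (N.choose (c + 1) * (c + 1)) * q ^ c * q * r ^ (j - c) := by
    have : (0 : ℝ) ≤ N - E := by rw [sub_nonneg]; exact_mod_cast hEN
    positivity
  have h4 := mul_le_mul_of_nonneg_left h1 hA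
  have e1 : (N.choose (E + 1) : ℝ) * N.choose c * compCount j c * q ^ c * r ^ (j - c)
      * (((E : ℝ) + 1) * (((N : ℝ) - c) * q))
      = (N.choose E : ℝ) * (N - E) * (N.choose (c + 1) * (c + 1)) * q ^ c * q * r ^ (j - c)
        * compCount j c := by
    linear_combination (N.choose c * compCount j c * q ^ c * r ^ (j - c) * (N - c) * q) * h2
      - (N.choose E * (N - E) * compCount j c * q ^ c * r ^ (j - c) * q) * h3
  rw [e1]
  refine h4.trans (le_of_eq ?_)
  ring

/-- Integration of `g` against the (unnormalised) law of the numbers of movers and clusters. -/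
noncomputable def pairSum (r q : ℝ) (N k : ℕ) (g : ℕ → ℕ → ℝ) : ℝ :=
  ∑ E ∈ Finset.range (k + 1), ∑ c ∈ Finset.range (N + 1), pairMass r q N k E c * g E c

theorem pairSum_add (g h : ℕ → ℕ → ℝ) : pairSum r q N k (fun E c => g E c + h E c)
    = pairSum r q N k g + pairSum r q N k h := by
  simp [pairSum, mul_add, Finset.sum_add_distrib]

theorem pairSum_sub (g h : ℕ → ℕ → ℝ) : pairSum r q N k (fun E c => g E c - h E c)
    = pairSum r q N k g - pairSum r q N k h := by
  simp [pairSum, mul_sub, Finset.sum_sub_distrib]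

theorem pairSum_const_mul (a : ℝ) (g : ℕ → ℕ → ℝ) : pairSum r q N k (fun E c => a * g E c)
    = a * pairSum r q N k g := by
  simp only [pairSum, Finset.mul_sum]
  exact Finset.sum_congr rfl fun E _ => Finset.sum_congr rfl fun c _ => by ring

theorem pairSum_mono (hr : 0 < r) (hq : 0 < q) {g h : ℕ → ℕ → ℝ}
    (hgh : ∀ E c, E ≤ N → c ≤ N → E + c ≤ k → g E c ≤ h E c) :
    pairSum r q N k g ≤ pairSum r q N k h := by
  refine Finset.sum_le_sum fun E hE => Finset.sum_le_sum fun c hc => ?_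
  rw [Finset.mem_range] at hE hc
  by_cases h0 : pairMass r q N k E c = 0
  · simp [h0]
  · obtain ⟨h1, h2⟩ := of_pairMass_ne_zero h0
    exact mul_le_mul_of_nonneg_left (hgh E c h1 (by omega) (by omega)) (pairMass_nonneg hr hq E c)

theorem pairSum_one_pos (hr : 0 < r) (hq : 0 < q) (hN : 0 < N) (hk : 0 < k) :
    0 < pairSum r q N k fun _ _ => 1 := by
  refine Finset.sum_pos' (fun E _ => Finset.sum_nonneg fun c _ =>
    mul_nonneg (pairMass_nonneg hr hq E c) zero_le_one) ⟨0, by simp, ?_⟩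
  refine Finset.sum_pos' (fun c _ => mul_nonneg (pairMass_nonneg hr hq 0 c) zero_le_one)
    ⟨1, by simp; omega, ?_⟩
  obtain ⟨j, rfl⟩ : ∃ j, k = j + 1 := ⟨k - 1, by omega⟩
  simp [pairMass, compCount]
  positivity

/-- Summation by parts in E: the ratio identity turns the rate of going up into the rate of going
down. With g the difference of the two rates it becomes a second-moment bound. -/
theorem pairSum_left (g : ℕ → ℕ → ℝ) :
    pairSum r q N k (fun E c => (((N : ℝ) - E) * ((k : ℝ) - E - c)) * g (E + 1) c)
      = r * pairSum r q N k (fun E c => (E * ((k : ℝ) - E)) * g E c) := by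
  rw [pairSum, pairSum, Finset.sum_range_succ _ k, Finset.sum_range_succ' _ k, mul_add]
  -- The boundary term E = k vanishes: for c = 0 the factor k - E - c is zero, and for c > 0 there
  -- is no composition of 0.
  have h1 : ∑ c ∈ Finset.range (N + 1), pairMass r q N k k c *
      ((((N : ℝ) - k) * ((k : ℝ) - k - c)) * g (k + 1) c) = 0 := by
    refine Finset.sum_eq_zero fun c _ => ?_
    cases c with
    | zero => simp
    | succ c => simp [pairMass, compCount]
  rw [h1]
  simp only [Nat.cast_zero, zero_mul, mul_zero, Finset.sum_const_zero, add_zero]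
  simp only [Finset.mul_sum]
  refine Finset.sum_congr rfl fun E hE => Finset.sum_congr rfl fun c _ => ?_
  rw [Finset.mem_range] at hE
  have := pairMass_succ_left (r := r) (q := q) (N := N) (c := c) hE
  push_cast
  linear_combination g (E + 1) c * this

theorem pairSum_right (g : ℕ → ℕ → ℝ) :
    q * pairSum r q N k (fun E c => (((N : ℝ) - c) * ((k : ℝ) - E - c)) * g E (c + 1))
      = r * pairSum r q N k (fun E c => (c * ((c : ℝ) - 1)) * g E c) := by
  rw [pairSum, pairSum, Finset.mul_sum, Finset.mul_sum]
  refine Finset.sum_congr rfl fun E hE => ?_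
  rw [Finset.mem_range] at hE
  rw [Finset.sum_range_succ, Finset.sum_range_succ', mul_add, mul_add]
  simp only [sub_self, Nat.cast_zero, zero_mul, mul_zero, add_zero]
  simp only [Finset.mul_sum]
  refine Finset.sum_congr rfl fun c _ => ?_
  have := pairMass_succ_right (r := r) (q := q) (N := N) (k := k) E c (by omega)
  push_cast
  linear_combination g E (c + 1) * this

/-- Let F be the difference of the two rates. Summation by parts replaces F² by the upward rate, of
order N k, times an increment of F, of order N + k. This is one order below the trivial bound, so
the first mean-field equation holds in mean square. -/
theorem pairSum_sq_left_le (hr : 0 < r) (hq : 0 < q) :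
    pairSum r q N k (fun E c => (((N : ℝ) - E) * ((k : ℝ) - E - c) - r * (E * ((k : ℝ) - E))) ^ 2)
      ≤ N * k * ((1 + r) * (N + k + 1)) * pairSum r q N k fun _ _ => 1 := by
  set F : ℕ → ℕ → ℝ := fun E c => ((N : ℝ) - E) * ((k : ℝ) - E - c) - r * (E * ((k : ℝ) - E))
  have h := pairSum_left (r := r) (q := q) (N := N) (k := k) F
  have e : pairSum r q N k (fun E c => F E c ^ 2) = pairSum r q N k (fun E c =>
      (((N : ℝ) - E) * ((k : ℝ) - E - c)) * (F E c - F (E + 1) c)) := by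
    have e1 : ∀ E c, F E c ^ 2 = (((N : ℝ) - E) * ((k : ℝ) - E - c)) * F E c
        - r * ((E * ((k : ℝ) - E)) * F E c) := fun E c => by simp only [F]; ring
    simp only [e1]
    rw [pairSum_sub, pairSum_const_mul, ← h, ← pairSum_sub]
    simp only [mul_sub]
  rw [e, ← pairSum_const_mul]
  refine pairSum_mono hr hq fun E c h1 h2 h3 => ?_
  have h1' : (E : ℝ) ≤ N := by exact_mod_cast h1
  have h3' : (E : ℝ) + c ≤ k := by exact_mod_cast h3
  have hE : (0 : ℝ) ≤ E := Nat.cast_nonneg E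
  have hc : (0 : ℝ) ≤ c := Nat.cast_nonneg c
  have hd : F E c - F (E + 1) c ≤ (1 + r) * (N + k + 1) := by
    have : F E c - F (E + 1) c = (N - E) + (k - E - c) - 1 + r * (k - E - E - 1) := by
      simp only [F]; push_cast; ring
    rw [this]
    have : r * (k - E - E - 1) ≤ r * (N + k + 1) := by
      apply mul_le_mul_of_nonneg_left _ hr.le; linarith
    linarith
  have hA : ((N : ℝ) - E) * ((k : ℝ) - E - c) ≤ N * k := by
    apply mul_le_mul <;> linarith
  have hA0 : 0 ≤ ((N : ℝ) - E) * ((k : ℝ) - E - c) := by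
    apply mul_nonneg <;> linarith
  rw [mul_one]
  exact (mul_le_mul_of_nonneg_left hd hA0).trans
    (mul_le_mul_of_nonneg_right hA (by positivity))

theorem pairSum_sq_right_le (hr : 0 < r) (hq : 0 < q) :
    pairSum r q N k
        (fun E c => (q * (((N : ℝ) - c) * ((k : ℝ) - E - c)) - r * (c * ((c : ℝ) - 1))) ^ 2)
      ≤ q * (N * k) * ((q + 2 * r) * (N + k + 1)) * pairSum r q N k fun _ _ => 1 := by
  set F : ℕ → ℕ → ℝ := fun E c => q * (((N : ℝ) - c) * ((k : ℝ) - E - c)) - r * (c * ((c : ℝ) - 1))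
  have h := pairSum_right (r := r) (q := q) (N := N) (k := k) F
  have e : pairSum r q N k (fun E c => F E c ^ 2) = q * pairSum r q N k (fun E c =>
      (((N : ℝ) - c) * ((k : ℝ) - E - c)) * (F E c - F E (c + 1))) := by
    have e1 : ∀ E c, F E c ^ 2 = q * ((((N : ℝ) - c) * ((k : ℝ) - E - c)) * F E c)
        - r * ((c * ((c : ℝ) - 1)) * F E c) := fun E c => by simp only [F]; ring
    simp only [e1]
    rw [pairSum_sub, pairSum_const_mul, pairSum_const_mul, ← h, ← mul_sub, ← pairSum_sub]
    simp only [mul_sub]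
  rw [e, mul_assoc, mul_assoc]
  refine mul_le_mul_of_nonneg_left ?_ hq.le
  rw [← mul_assoc, ← pairSum_const_mul]
  refine pairSum_mono hr hq fun E c h1 h2 h3 => ?_
  have h2' : (c : ℝ) ≤ N := by exact_mod_cast h2
  have h3' : (E : ℝ) + c ≤ k := by exact_mod_cast h3
  have hE : (0 : ℝ) ≤ E := Nat.cast_nonneg E
  have hc : (0 : ℝ) ≤ c := Nat.cast_nonneg c
  have hd : F E c - F E (c + 1) ≤ (q + 2 * r) * (N + k + 1) := by
    have : F E c - F E (c + 1) = q * ((N - c) + (k - E - c) - 1) + 2 * r * c := by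
      simp only [F]; push_cast; ring
    rw [this]
    have h5 : q * ((N - c) + (k - E - c) - 1) ≤ q * (N + k + 1) := by
      apply mul_le_mul_of_nonneg_left _ hq.le; linarith
    have h6 : 2 * r * c ≤ 2 * r * (N + k + 1) := by
      apply mul_le_mul_of_nonneg_left _ (by positivity); linarith
    linarith
  have hA : ((N : ℝ) - c) * ((k : ℝ) - E - c) ≤ N * k := by
    apply mul_le_mul <;> linarith
  have hA0 : 0 ≤ ((N : ℝ) - c) * ((k : ℝ) - E - c) := by
    apply mul_nonneg <;> linarith
  rw [mul_one]
  exact (mul_le_mul_of_nonneg_left hd hA0).trans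
    (mul_le_mul_of_nonneg_right hA (by positivity))

/-- Compare (E + 1, c) with (E, c + 1): when movers are many and clusters few, the first mass is a
small multiple of the second, and the shift is injective. This excludes the degenerate mean-field
root x = κ, y = 0, which the second-moment bounds cannot see. -/
theorem pairSum_sparse_le (hr : 0 < r) (hq : 0 < q) {η a : ℝ} (hη : η ≤ 1 / 2) (hη0 : 0 ≤ η)
    (ha : 0 < a) (hN : 0 < N) :
    pairSum r q N k (fun E c => if a * N ≤ E ∧ (c : ℝ) < η * N then 1 else 0)
      ≤ 2 * (η + 1 / N) / (a * q) * pairSum r q N k fun _ _ => 1 := by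
  have hN' : (0 : ℝ) < N := by exact_mod_cast hN
  set B := 2 * (η + 1 / N) / (a * q) with hB
  have hB0 : 0 ≤ B := by positivity
  rw [pairSum, pairSum, Finset.sum_range_succ' _ k, Finset.sum_range_succ _ k, mul_add]
  have h0 : ∑ c ∈ Finset.range (N + 1), pairMass r q N k 0 c *
      (if a * N ≤ ((0 : ℕ) : ℝ) ∧ (c : ℝ) < η * N then 1 else 0) = 0 := by
    refine Finset.sum_eq_zero fun c _ => ?_
    rw [if_neg, mul_zero]
    rintro ⟨h, -⟩
    have : 0 < a * N := by positivity
    simp at h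
    linarith
  rw [h0]
  refine add_le_add ?_ (mul_nonneg hB0 (Finset.sum_nonneg fun c _ =>
    mul_nonneg (pairMass_nonneg hr hq _ _) zero_le_one))
  rw [Finset.mul_sum]
  refine Finset.sum_le_sum fun E hE => ?_
  rw [Finset.mem_range] at hE
  rw [Finset.sum_range_succ, Finset.sum_range_succ', mul_add]
  have h1 : (if a * N ≤ ((E + 1 : ℕ) : ℝ) ∧ (N : ℝ) < η * N then (1 : ℝ) else 0) = 0 := by
    rw [if_neg]
    rintro ⟨-, h⟩
    nlinarith
  rw [h1, mul_zero]
  refine add_le_add ?_ (mul_nonneg hB0 (mul_nonneg (pairMass_nonneg hr hq _ _) zero_le_one))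
  rw [Finset.mul_sum]
  refine Finset.sum_le_sum fun c hc => ?_
  split_ifs with h
  · obtain ⟨h2, h3⟩ := h
    have h4 := pairMass_shift_le (r := r) (q := q) (N := N) (c := c) hr hq hE
    have m1 := pairMass_nonneg (N := N) (k := k) hr hq (E + 1) c
    have m2 := pairMass_nonneg (N := N) (k := k) hr hq E (c + 1)
    rw [mul_one, mul_one]
    push_cast at h2
    have hden : a * N * (N / 2 * q) ≤ ((E : ℝ) + 1) * (((N : ℝ) - c) * q) := by
      refine mul_le_mul h2 (mul_le_mul_of_nonneg_right ?_ hq.le) (by positivity) (by positivity)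
      nlinarith
    have hnum : ((N : ℝ) - E) * (c + 1) ≤ N * (η * N + 1) := by
      have : (0 : ℝ) ≤ E := Nat.cast_nonneg E
      have : (0 : ℝ) ≤ c := Nat.cast_nonneg c
      have hx : ((N : ℝ) - E) * (c + 1) ≤ N * (c + 1) := by
        apply mul_le_mul_of_nonneg_right <;> linarith
      exact hx.trans (mul_le_mul_of_nonneg_left (by linarith) hN'.le)
    have h5 : pairMass r q N k (E + 1) c * (a * N * (N / 2 * q))
        ≤ N * (η * N + 1) * pairMass r q N k E (c + 1) :=
      (mul_le_mul_of_nonneg_left hden m1).trans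
        (h4.trans (mul_le_mul_of_nonneg_right hnum m2))
    have e : B * pairMass r q N k E (c + 1)
        = N * (η * N + 1) * pairMass r q N k E (c + 1) / (a * N * (N / 2 * q)) := by
      rw [hB]; field_simp
    rw [e, le_div_iff₀ (by positivity)]
    exact h5
  · rw [mul_zero]
    exact mul_nonneg hB0 (mul_nonneg (pairMass_nonneg hr hq _ _) zero_le_one)

end Concentration

/-! ### The mean-field equations, their root and its limit as q → 0 -/

section LimitCurve

variable {r q : ℝ}

/-- Particles per hole as a function of the fugacity-like parameter `t`. -/
noncomputable def densityCurve (r q t : ℝ) : ℝ :=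
  t / (r + t) + q * t / (q * t + r * (1 - t)) / (1 - t)

theorem strictMonoOn_densityCurve (hr : 0 < r) (hq : 0 < q) :
    StrictMonoOn (densityCurve r q) (Set.Ioo 0 1) := by
  intro s hs t ht hst
  obtain ⟨hs0, hs1⟩ := hs
  obtain ⟨ht0, ht1⟩ := ht
  have a1 : 0 < 1 - s := by linarith
  have a2 : 0 < 1 - t := by linarith
  refine add_lt_add ?_ ?_
  · rw [div_lt_div_iff₀ (by linarith) (by linarith)]
    nlinarith
  · refine div_lt_div₀ ?_ (by linarith) (by positivity) a2
    rw [div_lt_div_iff₀ (by positivity) (by positivity)]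
    nlinarith [mul_pos (mul_pos hq hr) (sub_pos.2 hst)]

theorem exists_densityCurve_eq (hr : 0 < r) (hq : 0 < q) {κ : ℝ} (hκ : 0 < κ) :
    ∃ t ∈ Set.Ioo (0 : ℝ) 1, densityCurve r q t = κ := by
  -- At t = 1 - d with d ≤ 1/2 the second term of the curve is at least q / (2 (q + r) d), hence at
  -- least κ by the other bound on d.
  set d := min (1 / 2) (q / (2 * (q + r) * κ)) with hd
  have hd0 : 0 < d := lt_min (by norm_num) (by positivity)
  have hd1 : d ≤ 1 / 2 := min_le_left _ _
  have hd2 : d ≤ q / (2 * (q + r) * κ) := min_le_right _ _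
  have hcont : ContinuousOn (densityCurve r q) (Set.Icc 0 (1 - d)) := by
    have h1 : ∀ x ∈ Set.Icc (0 : ℝ) (1 - d), 0 < 1 - x := fun x hx => by linarith [hx.2]
    have h2 : ∀ x ∈ Set.Icc (0 : ℝ) (1 - d), 0 < q * x + r * (1 - x) := fun x hx => by
      have := hx.1; have := h1 x hx; positivity
    unfold densityCurve
    refine ContinuousOn.add (ContinuousOn.div (by fun_prop) (by fun_prop) fun x hx => ?_)
      (ContinuousOn.div (ContinuousOn.div (by fun_prop) (by fun_prop) fun x hx => (h2 x hx).ne')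
        (by fun_prop) fun x hx => (h1 x hx).ne')
    linarith [hx.1]
  have h0 : densityCurve r q 0 = 0 := by simp [densityCurve]
  have h1 : κ ≤ densityCurve r q (1 - d) := by
    have e : 1 - (1 - d) = d := by ring
    have : κ ≤ q * (1 - d) / (q * (1 - d) + r * d) / d := by
      rw [div_div, le_div_iff₀ (by have : 0 < 1 - d := by linarith
                                   positivity)]
      rw [le_div_iff₀ (by positivity)] at hd2
      have h3 : q * (1 - d) + r * d ≤ q + r := by nlinarith
      have h4 : κ * ((q * (1 - d) + r * d) * d) ≤ κ * ((q + r) * d) := by gcongr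
      nlinarith
    rw [densityCurve, e]
    have h5 : 0 ≤ (1 - d) / (r + (1 - d)) := by
      apply div_nonneg <;> linarith
    linarith
  obtain ⟨t, ht, hte⟩ := intermediate_value_Icc (by linarith) hcont (show κ ∈ Set.Icc _ _ by
    rw [h0]; exact ⟨hκ.le, h1⟩)
  refine ⟨t, ⟨lt_of_le_of_ne ht.1 ?_, by linarith [ht.2]⟩, hte⟩
  rintro rfl
  rw [h0] at hte
  linarith

/-- Let s be the fraction of residual particles beyond one per cluster. The equations express x and
y through s, and κ = x + y / (1 - s) becomes the density curve at s, which is injective. Excluding x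
= κ, y = 0 is what allows the division by κ - x. -/
theorem eq_of_meanField (hr : 0 < r) (hq : 0 < q) {κ t x y : ℝ} (hκ : 0 < κ)
    (ht : t ∈ Set.Ioo (0 : ℝ) 1) (hte : densityCurve r q t = κ) (hy : 0 ≤ y)
    (hxy : x + y ≤ κ) (h1 : (1 - x) * (κ - x - y) = r * (x * (κ - x)))
    (h2 : q * ((1 - y) * (κ - x - y)) = r * y ^ 2) (hne : ¬ (x = κ ∧ y = 0)) :
    x = t / (r + t) := by
  have hxκ : x < κ := by
    rcases lt_or_eq_of_le (show x ≤ κ by linarith) with h | h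
    · exact h
    · exact (hne ⟨h, by linarith⟩).elim
  have hd : 0 < κ - x := by linarith
  set s := (κ - x - y) / (κ - x) with hs
  have hsmul : s * (κ - x) = κ - x - y := div_mul_cancel₀ _ hd.ne'
  have hs0 : 0 ≤ s := div_nonneg (by linarith) hd.le
  have hyS : y = (1 - s) * (κ - x) := by linear_combination hsmul
  have e1 : (1 - x) * s = r * x := by
    have : ((1 - x) * s - r * x) * (κ - x) = 0 := by linear_combination h1 + (1 - x) * hsmul
    linarith [(mul_eq_zero.1 this).resolve_right hd.ne']
  have e2 : q * ((1 - y) * s) = r * (y * (1 - s)) := by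
    have : (q * ((1 - y) * s) - r * (y * (1 - s))) * (κ - x) = 0 := by
      linear_combination h2 + q * (1 - y) * hsmul + r * y * hyS
    linarith [(mul_eq_zero.1 this).resolve_right hd.ne']
  have hs1 : s < 1 := by
    have hle : s ≤ 1 := by rw [hs, div_le_one hd]; linarith
    rcases lt_or_eq_of_le hle with h | h
    · exact h
    · rw [h] at hyS e2
      have : y = 0 := by rw [hyS]; ring
      rw [this] at e2
      linarith
  have hden : 0 < r + s := by linarith
  have hx : x = s / (r + s) := by
    rw [eq_div_iff hden.ne']; linear_combination -e1
  have hs0' : 0 < s := by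
    rcases lt_or_eq_of_le hs0 with h | h
    · exact h
    · exfalso
      rw [← h] at e2 e1
      have hx0 : x = 0 := by
        have : r * x = 0 := by linarith
        exact (mul_eq_zero.1 this).resolve_left hr.ne'
      have hy0 : y = 0 := by
        have : r * y = 0 := by linarith
        exact (mul_eq_zero.1 this).resolve_left hr.ne'
      rw [hy0, hx0, ← h] at hyS
      linarith
  have hden2 : 0 < q * s + r * (1 - s) := by
    have : 0 < 1 - s := by linarith
    positivity
  have hy' : y = q * s / (q * s + r * (1 - s)) := by
    rw [eq_div_iff hden2.ne']; linear_combination -e2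
  have hκs : densityCurve r q s = κ := by
    rw [densityCurve, ← hx, ← hy', hyS, mul_comm, mul_div_assoc, div_self (by linarith)]
    ring
  have : s = t := (strictMonoOn_densityCurve hr hq).injOn ⟨hs0', hs1⟩ ht (hκs.trans hte.symm)
  rw [← this, hx]

/-- As `q → 0` the fraction of moving queues tends to `min (1 / (1 + r)) κ`. -/
theorem abs_sub_min_le (hr : 0 < r) (hq : 0 < q) {κ t ε : ℝ}
    (ht : t ∈ Set.Ioo (0 : ℝ) 1) (hte : densityCurve r q t = κ) (hε : 0 < ε)
    (hqε : q ≤ r * ε ^ 3) : |t / (r + t) - min (1 / (1 + r)) κ| ≤ ε := by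
  obtain ⟨ht0, ht1⟩ := ht
  have a1 : 0 < 1 - t := by linarith
  have hb : 0 ≤ q * t / (q * t + r * (1 - t)) / (1 - t) := by positivity
  have hle1 : t / (r + t) ≤ 1 / (1 + r) := by
    rw [div_le_div_iff₀ (by linarith) (by linarith)]; nlinarith
  have hle2 : t / (r + t) ≤ κ := by rw [← hte, densityCurve]; linarith
  rw [abs_sub_comm, abs_of_nonneg (by rw [sub_nonneg]; exact le_min hle1 hle2)]
  -- Either t is so close to 1 that t / (r + t) is nearly 1 / (1 + r), or the cluster term of the
  -- curve is at most q / (r ε²) ≤ ε and t / (r + t) is nearly κ.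
  rcases le_or_gt (1 - t) ε with h | h
  · have : 1 / (1 + r) - t / (r + t) ≤ ε := by
      have e : 1 / (1 + r) - t / (r + t) = r * (1 - t) / ((1 + r) * (r + t)) := by
        field_simp
        ring
      rw [e, div_le_iff₀ (by positivity)]
      have h1 : r * (1 - t) ≤ r * ε := by gcongr
      have h2 : r * ε ≤ ε * ((1 + r) * (r + t)) := by
        have : r ≤ (1 + r) * (r + t) := by nlinarith
        nlinarith
      linarith
    linarith [min_le_left (1 / (1 + r)) κ]
  · have : κ - t / (r + t) ≤ ε := by
      rw [← hte, densityCurve, add_sub_cancel_left, div_div, div_le_iff₀ (by positivity)]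
      have h1 : q * t ≤ q := by nlinarith
      have h2 : r * ε ^ 3 ≤ ε * ((q * t + r * (1 - t)) * (1 - t)) := by
        have h3 : r * ε ≤ q * t + r * (1 - t) := by
          have : r * ε ≤ r * (1 - t) := by gcongr
          have : 0 ≤ q * t := by positivity
          linarith
        have h4 : r * ε * ε ≤ (q * t + r * (1 - t)) * (1 - t) :=
          mul_le_mul h3 h.le hε.le (by positivity)
        calc r * ε ^ 3 = ε * (r * ε * ε) := by ring
          _ ≤ _ := by gcongr
      linarith
    linarith [min_le_right (1 / (1 + r)) κ]

/-- Off the solution of the mean-field equations, either they fail by a definite amount or there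
are few clusters. -/
theorem exists_meanField_gap (hr : 0 < r) (hq : 0 < q) {κ t ε η : ℝ} (hκ : 0 < κ)
    (ht : t ∈ Set.Ioo (0 : ℝ) 1) (hte : densityCurve r q t = κ) (hε : 0 < ε) (hη : 0 < η) :
    ∃ c₀ > 0, ∀ x y s : ℝ, 0 ≤ x → x ≤ 1 → 0 ≤ y → y ≤ 1 → s ≤ κ + 1 → x + y ≤ s →
      ε ≤ |x - t / (r + t)| → (x ≤ κ / 2 ∨ η ≤ y) →
      c₀ ≤ ((1 - x) * (s - x - y) - r * (x * (s - x))) ^ 2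
        + (q * ((1 - y) * (s - x - y)) - r * y ^ 2) ^ 2 + (s - κ) ^ 2 := by
  -- Here s stands for k / N, which only converges to κ; the third square penalises the deviation.
  -- The last alternative in `S` cuts out a neighbourhood of the degenerate root, so f is positive
  -- on a compact set.
  let f : ℝ × ℝ × ℝ → ℝ := fun v =>
    ((1 - v.1) * (v.2.2 - v.1 - v.2.1) - r * (v.1 * (v.2.2 - v.1))) ^ 2
      + (q * ((1 - v.2.1) * (v.2.2 - v.1 - v.2.1)) - r * v.2.1 ^ 2) ^ 2 + (v.2.2 - κ) ^ 2
  let S : Set (ℝ × ℝ × ℝ) := (Set.Icc 0 1 ×ˢ Set.Icc 0 1 ×ˢ Set.Icc 0 (κ + 1)) ∩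
    ({v | v.1 + v.2.1 ≤ v.2.2} ∩ ({v | ε ≤ |v.1 - t / (r + t)|} ∩
      ({v | v.1 ≤ κ / 2} ∪ {v | η ≤ v.2.1})))
  have hS : IsCompact S := by
    refine IsCompact.inter_right (isCompact_Icc.prod (isCompact_Icc.prod isCompact_Icc)) ?_
    refine (isClosed_le (by fun_prop) (by fun_prop)).inter
      ((isClosed_le (by fun_prop) (by fun_prop)).inter
        ((isClosed_le (by fun_prop) (by fun_prop)).union
          (isClosed_le (by fun_prop) (by fun_prop))))
  have hf : Continuous f := by fun_prop
  obtain ⟨c₀, hc₀, hc⟩ := hS.exists_forall_le' hf.continuousOn (a := 0) (by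
    rintro ⟨x, y, s⟩ ⟨⟨⟨hx0, hx1⟩, ⟨hy0, hy1⟩, -⟩, hxy, hfar, hor⟩
    simp only [Set.mem_ofPred_eq, Set.mem_union] at hxy hfar hor hx0 hx1 hy0 hy1
    have hnn : 0 ≤ f (x, y, s) := by positivity
    refine lt_of_le_of_ne hnn fun h0 => ?_
    simp only [f] at h0
    have b1 := sq_nonneg ((1 - x) * (s - x - y) - r * (x * (s - x)))
    have b2 := sq_nonneg (q * ((1 - y) * (s - x - y)) - r * y ^ 2)
    have b3 := sq_nonneg (s - κ)
    have c1 := pow_eq_zero_iff (two_ne_zero) |>.1 (le_antisymm (by linarith) b1)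
    have c2 := pow_eq_zero_iff (two_ne_zero) |>.1 (le_antisymm (by linarith) b2)
    have c3 := pow_eq_zero_iff (two_ne_zero) |>.1 (le_antisymm (by linarith) b3)
    obtain rfl : s = κ := by linarith
    have := eq_of_meanField hr hq hκ ht hte hy0 hxy (by linarith) (by linarith) (by
      rintro ⟨rfl, rfl⟩
      rcases hor with h | h <;> linarith)
    rw [this] at hfar
    simp at hfar
    linarith)
  refine ⟨c₀, hc₀, fun x y s hx0 hx1 hy0 hy1 hs hxy hfar hor => ?_⟩
  exact hc (x, y, s) ⟨⟨⟨hx0, hx1⟩, ⟨hy0, hy1⟩, ⟨by simp only; linarith, hs⟩⟩, hxy, hfar, hor⟩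

set_option maxHeartbeats 1000000 in
-- The expected deviation of E / N from the root is split into a near part, a sparse part with many
-- movers and few clusters, and a remainder where the mean-field equations fail by a fixed amount,
-- which has small mass by the second-moment bounds.
theorem tendsto_pairSum (hr : 0 < r) (hq : 0 < q) {κ t : ℝ} (hκ : 0 < κ)
    (ht : t ∈ Set.Ioo (0 : ℝ) 1) (hte : densityCurve r q t = κ) {N k : ℕ → ℕ}
    (hN : Tendsto N atTop atTop) (hk : Tendsto (fun n => (k n : ℝ) / N n) atTop (𝓝 κ)) :
    Tendsto (fun n => pairSum r q (N n) (k n) (fun E _ => E) /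
      pairSum r q (N n) (k n) (fun _ _ => 1) / N n) atTop (𝓝 (t / (r + t))) := by
  set x₀ := t / (r + t) with hx₀
  have hx₀0 : 0 ≤ x₀ := div_nonneg ht.1.le (by linarith [ht.1])
  have hx₀1 : x₀ ≤ 1 := by rw [hx₀, div_le_one (by linarith [ht.1])]; linarith
  have hNinv : Tendsto (fun n => 1 / (N n : ℝ)) atTop (𝓝 0) :=
    tendsto_one_div_atTop_nhds_zero_nat.comp hN
  rw [Metric.tendsto_nhds]
  intro ε' hε'
  set ε := ε' / 3 with hε
  have hε0 : 0 < ε := by positivity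
  -- Chosen so that the limiting sparse error 2 η / ((κ / 2) q) is at most ε.
  set η := min (1 / 2) (ε * κ * q / 4) with hη
  have hη0 : 0 < η := lt_min (by norm_num) (by positivity)
  have hη1 : η ≤ 1 / 2 := min_le_left _ _
  obtain ⟨c₀, hc₀, hgap⟩ := exists_meanField_gap hr hq hκ ht hte hε0 hη0
  rw [← hx₀] at hgap
  -- All error terms beyond ε, normalised, as a continuous function of s = k / N and i = 1 / N, so
  -- that only its value at (κ, 0) matters.
  obtain ⟨D, hDdef⟩ : ∃ D : ℝ → ℝ → ℝ, D = fun s i => 1 / c₀ * ((1 + r) * (s * (1 + s + i) * i)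
    + 2 * (q * ((q + 2 * r) * (s * (1 + s + i) * i))) + 2 * r ^ 2 * i ^ 2 + (s - κ) ^ 2)
    + 2 * (η + i) / (κ / 2 * q) := ⟨_, rfl⟩
  have hD : Tendsto (fun n => D ((k n : ℝ) / N n) (1 / N n)) atTop (𝓝 (D κ 0)) := by
    have hc : Continuous fun v : ℝ × ℝ => D v.1 v.2 := by simp only [hDdef]; fun_prop
    exact (hc.tendsto (κ, 0)).comp (hk.prodMk_nhds hNinv)
  have hD0 : D κ 0 < 2 * ε := by
    have : D κ 0 = η * (4 / (κ * q)) := by simp only [hDdef]; field_simp; ring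
    rw [this]
    have h2 : η * (4 / (κ * q)) ≤ ε * κ * q / 4 * (4 / (κ * q)) := by
      gcongr
      exact min_le_right _ _
    have h3 : ε * κ * q / 4 * (4 / (κ * q)) = ε := by field_simp
    linarith
  filter_upwards [hD.eventually_lt_const hD0, hN.eventually_gt_atTop 0,
    hk.eventually_lt_const (show κ < κ + 1 by linarith), hk.eventually_const_lt hκ]
    with n hDn hNn hkn hkn0
  set M := N n
  set j := k n
  have hM : (0 : ℝ) < M := by exact_mod_cast hNn
  have hj : 0 < j := by
    rcases Nat.eq_zero_or_pos j with h | h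
    · rw [h] at hkn0; simp at hkn0
    · exact h
  have hP := pairSum_one_pos (N := M) (k := j) hr hq hNn hj
  set P := pairSum r q M j fun _ _ => 1
  set F₁ : ℕ → ℕ → ℝ := fun E c =>
    (((M : ℝ) - E) * ((j : ℝ) - E - c) - r * (E * ((j : ℝ) - E))) ^ 2
  set F₂ : ℕ → ℕ → ℝ := fun E c =>
    (q * (((M : ℝ) - c) * ((j : ℝ) - E - c)) - r * (c * ((c : ℝ) - 1))) ^ 2
  set I : ℕ → ℕ → ℝ := fun E c => if κ / 2 * M ≤ E ∧ (c : ℝ) < η * M then 1 else 0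
  have hF₁ : pairSum r q M j F₁ ≤ M * j * ((1 + r) * (M + j + 1)) * P := pairSum_sq_left_le hr hq
  have hF₂ : pairSum r q M j F₂ ≤ q * (M * j) * ((q + 2 * r) * (M + j + 1)) * P :=
    pairSum_sq_right_le hr hq
  have hI : pairSum r q M j I ≤ 2 * (η + 1 / M) / (κ / 2 * q) * P :=
    pairSum_sparse_le hr hq hη1 hη0.le (by positivity) hNn
  set A := ε + 1 / c₀ * (2 * r ^ 2 * (1 / M) ^ 2 + ((j : ℝ) / M - κ) ^ 2) with hA
  have hsq : ∀ a b : ℝ, (a - b) ^ 2 ≤ 2 * a ^ 2 + 2 * b ^ 2 := fun a b => by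
    nlinarith [sq_nonneg (a + b)]
  -- The deviation never exceeds 1. If it is at least ε, either the indicator `I` equals 1 or the
  -- gap lemma makes the quadratic terms at least 1.
  have hpt : ∀ E c, E ≤ M → c ≤ M → E + c ≤ j → |(E : ℝ) / M - x₀|
      ≤ A * 1 + (1 / c₀ * (1 / M ^ 4)) * F₁ E c + (1 / c₀ * (2 / M ^ 4)) * F₂ E c + I E c := by
    intro E c hE hc hEc
    have hE' : (E : ℝ) ≤ M := by exact_mod_cast hE
    have hc' : (c : ℝ) ≤ M := by exact_mod_cast hc
    have hEc' : (E : ℝ) + c ≤ j := by exact_mod_cast hEc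
    have hF₁0 : 0 ≤ F₁ E c := sq_nonneg _
    have hF₂0 : 0 ≤ F₂ E c := sq_nonneg _
    have hI0 : 0 ≤ I E c := by simp only [I]; split_ifs <;> simp
    have hbx0 : 0 ≤ (E : ℝ) / M := by positivity
    have hbx1 : (E : ℝ) / M ≤ 1 := (div_le_one hM).2 hE'
    have hby0 : 0 ≤ (c : ℝ) / M := by positivity
    have hby1 : (c : ℝ) / M ≤ 1 := (div_le_one hM).2 hc'
    have hrest : 0 ≤ 1 / c₀ * (2 * r ^ 2 * (1 / M) ^ 2 + ((j : ℝ) / M - κ) ^ 2) := by positivity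
    have hr1 : 0 ≤ (1 / c₀ * (1 / M ^ 4)) * F₁ E c := by positivity
    have hr2 : 0 ≤ (1 / c₀ * (2 / M ^ 4)) * F₂ E c := by positivity
    rcases lt_or_ge |(E : ℝ) / M - x₀| ε with hfar | hfar
    · linarith
    have hle1 : |(E : ℝ) / M - x₀| ≤ 1 := by rw [abs_le]; constructor <;> linarith
    by_cases hcase : κ / 2 * M ≤ E ∧ (c : ℝ) < η * M
    · have : I E c = 1 := if_pos hcase
      linarith
    have hor : (E : ℝ) / M ≤ κ / 2 ∨ η ≤ (c : ℝ) / M := by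
      rw [not_and_or, not_le, not_lt] at hcase
      rcases hcase with h | h
      · left; rw [div_le_iff₀ hM]; exact h.le
      · right; rw [le_div_iff₀ hM]; exact h
    have h1 := hgap (E / M) (c / M) (j / M) hbx0 hbx1 hby0 hby1 hkn.le
      (by rw [← add_div]; gcongr) hfar hor
    have e1 : ((1 - (E : ℝ) / M) * ((j : ℝ) / M - E / M - c / M)
        - r * ((E : ℝ) / M * ((j : ℝ) / M - E / M))) ^ 2 = 1 / M ^ 4 * F₁ E c := by
      simp only [F₁]; field_simp
    -- The exact identity involves c (c - 1) and the limit equation y²; the discrepancy gives the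
    -- additional term in 1 / M².
    have e2 : (q * ((1 - (c : ℝ) / M) * ((j : ℝ) / M - E / M - c / M)) - r * ((c : ℝ) / M) ^ 2) ^ 2
        ≤ 2 / M ^ 4 * F₂ E c + 2 * r ^ 2 * (1 / M) ^ 2 := by
      set u := q * (((M : ℝ) - c) * ((j : ℝ) - E - c)) - r * (c * ((c : ℝ) - 1)) with hu
      have e3 : q * ((1 - (c : ℝ) / M) * ((j : ℝ) / M - E / M - c / M)) - r * ((c : ℝ) / M) ^ 2
          = u / M ^ 2 - r * (c / M) * (1 / M) := by
        rw [hu]; field_simp; ring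
      have e4 : F₂ E c = u ^ 2 := rfl
      have h5 : (r * (c / M) * (1 / M)) ^ 2 ≤ r ^ 2 * (1 / M) ^ 2 := by
        rw [mul_pow]
        gcongr
        have : r * (c / M) ≤ r * 1 := by gcongr
        linarith
      rw [e3, e4]
      have h6 : 2 / (M : ℝ) ^ 4 * u ^ 2 = 2 * (u / M ^ 2) ^ 2 := by field_simp
      rw [h6]
      refine (hsq _ _).trans ?_
      linarith
    rw [e1] at h1
    have h2 : c₀ ≤ 1 / M ^ 4 * F₁ E c + (2 / M ^ 4 * F₂ E c + 2 * r ^ 2 * (1 / M) ^ 2)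
        + ((j : ℝ) / M - κ) ^ 2 := by linarith
    have h3 : 1 ≤ 1 / c₀ * (1 / M ^ 4 * F₁ E c + (2 / M ^ 4 * F₂ E c + 2 * r ^ 2 * (1 / M) ^ 2)
        + ((j : ℝ) / M - κ) ^ 2) := by
      rw [one_div_mul_eq_div, one_le_div hc₀]; exact h2
    have h4 : A * 1 + (1 / c₀ * (1 / M ^ 4)) * F₁ E c + (1 / c₀ * (2 / M ^ 4)) * F₂ E c + I E c
        = ε + I E c + 1 / c₀ * (1 / M ^ 4 * F₁ E c + (2 / M ^ 4 * F₂ E c + 2 * r ^ 2 * (1 / M) ^ 2)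
        + ((j : ℝ) / M - κ) ^ 2) := by rw [hA]; ring
    rw [h4]
    linarith
  have hsum := pairSum_mono (N := M) (k := j) hr hq hpt
  rw [pairSum_add, pairSum_add, pairSum_add, pairSum_const_mul, pairSum_const_mul,
    pairSum_const_mul] at hsum
  have hbound : pairSum r q M j (fun E _ => |(E : ℝ) / M - x₀|) ≤ (ε + D (j / M) (1 / M)) * P := by
    have i1 := mul_le_mul_of_nonneg_left hF₁ (show 0 ≤ 1 / c₀ * (1 / (M : ℝ) ^ 4) by positivity)
    have i2 := mul_le_mul_of_nonneg_left hF₂ (show 0 ≤ 1 / c₀ * (2 / (M : ℝ) ^ 4) by positivity)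
    refine hsum.trans ((add_le_add (add_le_add (add_le_add le_rfl i1) i2) hI).trans (le_of_eq ?_))
    simp only [hDdef, hA]
    field_simp
    ring
  have hdiff : pairSum r q M j (fun E _ => (E : ℝ)) / P / M - x₀
      = pairSum r q M j (fun E _ => (E : ℝ) / M - x₀) / P := by
    have e : pairSum r q M j (fun E _ => (E : ℝ) / M - x₀)
        = 1 / M * pairSum r q M j (fun E _ => (E : ℝ)) - x₀ * P := by
      rw [← pairSum_const_mul, ← pairSum_const_mul, ← pairSum_sub]
      congr 1
      funext E c
      ring
    rw [e]
    field_simp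
  have habs : |pairSum r q M j (fun E _ => (E : ℝ) / M - x₀)|
      ≤ pairSum r q M j (fun E _ => |(E : ℝ) / M - x₀|) := by
    rw [abs_le]
    constructor
    · have := pairSum_mono (N := M) (k := j) hr hq (g := fun E _ => -|(E : ℝ) / M - x₀|)
        (h := fun E _ => (E : ℝ) / M - x₀) (fun E c _ _ _ => neg_abs_le _)
      have e : pairSum r q M j (fun E _ => -|(E : ℝ) / M - x₀|)
          = -1 * pairSum r q M j (fun E _ => |(E : ℝ) / M - x₀|) := by
        rw [← pairSum_const_mul]; simp
      rw [e] at this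
      linarith
    · exact pairSum_mono hr hq (fun E c _ _ _ => le_abs_self _)
  rw [Real.dist_eq, hdiff, abs_div, abs_of_pos hP, div_lt_iff₀ hP]
  have : (ε + D (j / M) (1 / M)) * P < ε' * P := by
    apply mul_lt_mul_of_pos_right _ hP
    linarith
  linarith

end LimitCurve

/-! ### The limiting flux for π < 1 and its limit as π ↑ 1 -/

section ZeroRangeFlux

variable {ρ : ℝ}

theorem tendsto_ceil_div (hρ0 : 0 ≤ ρ) :
    Tendsto (fun n : ℕ => (⌈ρ * n⌉₊ : ℝ) / n) atTop (𝓝 ρ) :=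
  (tendsto_nat_ceil_mul_div_atTop hρ0).comp tendsto_natCast_atTop_atTop

theorem eventually_ceil_lt (hρ0 : 0 ≤ ρ) (hρ1 : ρ < 1) :
    ∀ᶠ n : ℕ in atTop, ⌈ρ * n⌉₊ < n := by
  filter_upwards [(tendsto_ceil_div hρ0).eventually_lt_const hρ1, eventually_gt_atTop 0]
    with n hn hn0
  have : (0 : ℝ) < n := by exact_mod_cast hn0
  rw [div_lt_one this] at hn
  exact_mod_cast hn

theorem tendsto_holes_div (hρ0 : 0 ≤ ρ) (hρ1 : ρ < 1) :
    Tendsto (fun n : ℕ => ((n - ⌈ρ * n⌉₊ : ℕ) : ℝ) / n) atTop (𝓝 (1 - ρ)) := by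
  refine Tendsto.congr' ?_ ((tendsto_const_nhds (x := (1 : ℝ))).sub (tendsto_ceil_div hρ0))
  filter_upwards [eventually_ceil_lt hρ0 hρ1, eventually_gt_atTop 0] with n hn hn0
  have : (n : ℝ) ≠ 0 := by positivity
  rw [Nat.cast_sub hn.le, sub_div, div_self this]

theorem tendsto_holes (hρ0 : 0 ≤ ρ) (hρ1 : ρ < 1) :
    Tendsto (fun n : ℕ => n - ⌈ρ * n⌉₊) atTop atTop := by
  rw [← tendsto_natCast_atTop_iff (R := ℝ)]
  have h := (tendsto_holes_div hρ0 hρ1).pos_mul_atTop (by linarith) tendsto_natCast_atTop_atTop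
  refine Tendsto.congr' ?_ h
  filter_upwards [eventually_gt_atTop 0] with n hn0
  have : (n : ℝ) ≠ 0 := by positivity
  field_simp

theorem tendsto_particles_div_holes (hρ0 : 0 ≤ ρ) (hρ1 : ρ < 1) :
    Tendsto (fun n : ℕ => (⌈ρ * n⌉₊ : ℝ) / ((n - ⌈ρ * n⌉₊ : ℕ) : ℝ)) atTop (𝓝 (ρ / (1 - ρ))) := by
  refine Tendsto.congr' ?_ ((tendsto_ceil_div hρ0).div (tendsto_holes_div hρ0 hρ1)
    (by linarith))
  filter_upwards [eventually_gt_atTop 0] with n hn0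
  have : (n : ℝ) ≠ 0 := by positivity
  simp only [Pi.div_apply]
  rw [div_div_div_cancel_right₀ this]

theorem eventually_ceil_gt (hρ0 : 0 < ρ) (m : ℕ) : ∀ᶠ n : ℕ in atTop, m < ⌈ρ * n⌉₊ := by
  have h : Tendsto (fun n : ℕ => ρ * (n : ℝ)) atTop atTop :=
    tendsto_natCast_atTop_atTop.const_mul_atTop hρ0
  filter_upwards [h.eventually_gt_atTop (m : ℝ)] with n hn
  exact Nat.lt_ceil.2 hn

/-- To identify a limiting flux it suffices to bound the distance of every steady flux to `L`. -/
theorem isFluxLimit_of_abs_le {S : ℕ → Set ℝ} {L : ℝ} {b : ℕ → ℝ}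
    (hne : ∀ᶠ n in atTop, (S n).Nonempty) (hb : Tendsto b atTop (𝓝 0))
    (h : ∀ᶠ n in atTop, ∀ x ∈ S n, |x - L| ≤ b n) : IsFluxLimit S L := by
  refine ⟨hne, fun f hf => ?_⟩
  rw [tendsto_iff_norm_sub_tendsto_zero]
  refine squeeze_zero' (Eventually.of_forall fun n => norm_nonneg _) ?_ hb
  filter_upwards [h, hf] with n hn hfn
  exact hn _ hfn

theorem isZeroRangeFlux_of_lt_one {p π t : ℝ} (hp0 : 0 < p) (hp1 : p < 1) (hπ0 : 0 < π)
    (hπ1 : π < 1) (hρ0 : 0 < ρ) (hρ1 : ρ < 1) (ht : t ∈ Set.Ioo (0 : ℝ) 1)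
    (hte : densityCurve ((1 - p) / p) ((1 - π) / π) t = ρ / (1 - ρ)) :
    IsZeroRangeFlux p π ρ ((1 - ρ) * (t / ((1 - p) / p + t))) := by
  have hr : 0 < (1 - p) / p := div_pos (by linarith) hp0
  have hq : 0 < (1 - π) / π := div_pos (by linarith) hπ0
  set v : ℕ → ℝ := fun n => ((n - ⌈ρ * n⌉₊ : ℕ) : ℝ) / n *
    (pairSum ((1 - p) / p) ((1 - π) / π) (n - ⌈ρ * n⌉₊) ⌈ρ * n⌉₊ (fun E _ => E) /
      pairSum ((1 - p) / p) ((1 - π) / π) (n - ⌈ρ * n⌉₊) ⌈ρ * n⌉₊ (fun _ _ => 1) /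
      (n - ⌈ρ * n⌉₊ : ℕ)) with hv
  have hlim : Tendsto v atTop (𝓝 ((1 - ρ) * (t / ((1 - p) / p + t)))) :=
    (tendsto_holes_div hρ0.le hρ1).mul (tendsto_pairSum hr hq (div_pos hρ0 (by linarith)) ht hte
      (tendsto_holes hρ0.le hρ1) (tendsto_particles_div_holes hρ0.le hρ1))
  have hS : ∀ᶠ n : ℕ in atTop, steadyFluxes (n := n) ⌈ρ * n⌉₊ (stepProb p π)
      (fun Z => ∑ i ∈ Z, hopProb p π Z i) = {v n} := by
    filter_upwards [eventually_ceil_lt hρ0.le hρ1, eventually_gt_atTop 0] with n hn hn0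
    have : NeZero n := ⟨hn0.ne'⟩
    rw [steadyFluxes_stepProb hp0 hp1 hπ0 hπ1 hn.le,
      sum_zrWeight_mul_hop (N := n - ⌈ρ * n⌉₊) hp0 hp1 hπ0 (by omega) (by omega)]
    have h1 : ((n - ⌈ρ * n⌉₊ : ℕ) : ℝ) ≠ 0 := by
      have : n - ⌈ρ * n⌉₊ ≠ 0 := by omega
      exact_mod_cast this
    have e1 : pairSum ((1 - p) / p) ((1 - π) / π) (n - ⌈ρ * n⌉₊) ⌈ρ * n⌉₊ (fun _ _ => 1)
        = ∑ E ∈ Finset.range (⌈ρ * n⌉₊ + 1), ∑ c ∈ Finset.range (n - ⌈ρ * n⌉₊ + 1),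
          pairMass ((1 - p) / p) ((1 - π) / π) (n - ⌈ρ * n⌉₊) ⌈ρ * n⌉₊ E c := by
      simp [pairSum]
    rw [hv, ← e1]
    congr 1
    simp only [pairSum]
    field_simp
  refine isFluxLimit_of_abs_le (b := fun n => |v n - (1 - ρ) * (t / ((1 - p) / p + t))|) ?_ ?_ ?_
  · filter_upwards [hS] with n hn
    rw [hn]
    exact Set.singleton_nonempty _
  · simpa using (hlim.sub_const ((1 - ρ) * (t / ((1 - p) / p + t)))).abs
  · filter_upwards [hS] with n hn
    rw [hn]
    rintro x rfl
    exact le_rfl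

/-- The limiting flux for `π < 1` and its limit as `π ↑ 1`. -/
theorem exists_zeroRangeFlux {p : ℝ} (hp0 : 0 < p) (hp1 : p < 1) (hρ0 : 0 < ρ) (hρ1 : ρ < 1) :
    ∃ φ : ℝ → ℝ, (∀ π ∈ Set.Ioo (0 : ℝ) 1, IsZeroRangeFlux p π ρ (φ π)) ∧
      Tendsto φ (𝓝[<] 1) (𝓝 ((1 - ρ) * min p (ρ / (1 - ρ)))) := by
  have hr : 0 < (1 - p) / p := div_pos (by linarith) hp0
  have hκ : 0 < ρ / (1 - ρ) := div_pos hρ0 (by linarith)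
  have hex : ∀ π : ℝ, ∃ t : ℝ, π ∈ Set.Ioo (0 : ℝ) 1 → t ∈ Set.Ioo (0 : ℝ) 1 ∧
      densityCurve ((1 - p) / p) ((1 - π) / π) t = ρ / (1 - ρ) := by
    intro π
    by_cases hπ : π ∈ Set.Ioo (0 : ℝ) 1
    · obtain ⟨t, h1, h2⟩ := exists_densityCurve_eq hr
        (show 0 < (1 - π) / π from div_pos (by linarith [hπ.2]) hπ.1) hκ
      exact ⟨t, fun _ => ⟨h1, h2⟩⟩
    · exact ⟨0, fun h => (hπ h).elim⟩
  choose t ht using hex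
  refine ⟨fun π => (1 - ρ) * (t π / ((1 - p) / p + t π)), fun π hπ => ?_, ?_⟩
  · exact isZeroRangeFlux_of_lt_one hp0 hp1 hπ.1 hπ.2 hρ0 hρ1 (ht π hπ).1 (ht π hπ).2
  · refine Tendsto.const_mul _ ?_
    rw [Metric.tendsto_nhds]
    intro ε hε
    have hq : Tendsto (fun π : ℝ => (1 - π) / π) (𝓝[<] 1) (𝓝 0) := by
      have : ContinuousAt (fun π : ℝ => (1 - π) / π) 1 :=
        ContinuousAt.div (by fun_prop) (by fun_prop) one_ne_zero
      have h2 := this.tendsto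
      simp only [sub_self, zero_div] at h2
      exact h2.mono_left nhdsWithin_le_nhds
    have hpos : 0 < (1 - p) / p * (ε / 2) ^ 3 := by positivity
    filter_upwards [hq.eventually_lt_const hpos, Ioo_mem_nhdsLT (zero_lt_one' ℝ)] with π h1 hπ
    have h2 := abs_sub_min_le hr (show 0 < (1 - π) / π from div_pos (by linarith [hπ.2]) hπ.1)
      (ht π hπ).1 (ht π hπ).2 (half_pos hε) h1.le
    have h3 : 1 / (1 + (1 - p) / p) = p := by field_simp; ring
    rw [h3] at h2
    rw [Real.dist_eq]
    linarith

end ZeroRangeFlux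

/-! ## Height functions and the exponential Lyapunov function -/

section Height

variable {n : ℕ} [NeZero n]

theorem eq_zero_of_add_one_eq {D : Fin n → ℝ} (h : ∀ x, D (x + 1) = D x) (x : Fin n) :
    D x = D 0 := by
  have key : ∀ i : ℕ, D (Fin.ofNat n i) = D 0 := by
    intro i
    induction i with
    | zero => rw [Fin.ofNat_zero_eq_zero]
    | succ i ih => rw [Fin.ofNat_succ, h, ih]
  rw [← Fin.ofNat_val_self x, key]

/-- Vanishing of the total makes the partial sums a function on the circle: the recursion also holds
across the step from the last site to 0. -/
theorem sum_Iic_add_one {φ : Fin n → ℝ} (h0 : ∑ x, φ x = 0) (x : Fin n) :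
    ∑ z ∈ Finset.Iic (x + 1), φ z = ∑ z ∈ Finset.Iic x, φ z + φ (x + 1) := by
  by_cases hx : x + 1 = 0
  · have hlast : ∀ z : Fin n, z ≤ x := by
      intro z
      have hv : x = 0 - 1 := eq_sub_of_add_eq hx
      by_contra hlt
      rw [not_le] at hlt
      have : x.val + 1 < n := lt_of_le_of_lt hlt z.isLt
      have h2 := Fin.val_add_one_of_lt' this
      rw [hx] at h2
      simp at h2
    have h1 : Finset.Iic x = Finset.univ := by ext z; simp [hlast z]
    have h2 : Finset.Iic (0 : Fin n) = {0} := by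
      ext z
      simp only [Finset.mem_Iic, Finset.mem_singleton]
      exact ⟨fun h => le_antisymm h (Fin.zero_le z), fun h => h.le⟩
    rw [hx, h1, h0, h2, Finset.sum_singleton, zero_add]
  · have hv : (x + 1).val = x.val + 1 := by
      have : x.val + 1 < n := by
        by_contra hcon
        have h3 : x.val + 1 = n := by have := x.isLt; omega
        apply hx
        rw [← Fin.ofNat_val_self x, ← Fin.ofNat_succ, h3, Fin.ofNat_self_eq_zero]
      exact Fin.val_add_one_of_lt' this
    have : Finset.Iic (x + 1) = insert (x + 1) (Finset.Iic x) := by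
      ext z
      simp only [Finset.mem_Iic, Finset.mem_insert, Fin.le_def, Fin.ext_iff, hv]
      omega
    rw [this, Finset.sum_insert, add_comm]
    simp only [Finset.mem_Iic, Fin.le_def, hv]
    omega

/-- The height increment at a site: `1` at a particle and `-α` at a hole. -/
noncomputable def heightInc (α : ℝ) (Z : Config n) (x : Fin n) : ℝ := if x ∈ Z then 1 else -α

/-- The height function, periodic when there are `α` particles per hole. -/
noncomputable def height (α : ℝ) (Z : Config n) (x : Fin n) : ℝ :=
  ∑ z ∈ Finset.Iic x, heightInc α Z z

theorem sum_heightInc {α : ℝ} {Z : Config n} (hα : α * Zᶜ.card = Z.card) :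
    ∑ x, heightInc α Z x = 0 := by
  simp only [heightInc]
  rw [Finset.sum_ite, Finset.sum_const, Finset.sum_const]
  have h1 : (Finset.univ.filter fun x => x ∈ Z) = Z := by ext; simp
  have h2 : (Finset.univ.filter fun x => x ∉ Z) = Zᶜ := by ext; simp
  rw [h1, h2]
  simp only [nsmul_eq_mul]
  linarith

theorem height_add_one {α : ℝ} {Z : Config n} (hα : α * Zᶜ.card = Z.card) (x : Fin n) :
    height α Z (x + 1) = height α Z x + heightInc α Z (x + 1) :=
  sum_Iic_add_one (sum_heightInc hα) x

theorem abs_height_le {α : ℝ} (h0 : 0 ≤ α) (h1 : α ≤ 1) (Z : Config n) (x : Fin n) :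
    |height α Z x| ≤ n := by
  refine (Finset.abs_sum_le_sum_abs _ _).trans ?_
  have : ∀ z ∈ Finset.Iic x, |heightInc α Z z| ≤ 1 := by
    intro z _
    rw [heightInc]
    split_ifs
    · simp
    · rw [abs_neg, abs_of_nonneg h0]; exact h1
  refine (Finset.sum_le_sum this).trans ?_
  rw [Finset.sum_const, nsmul_eq_mul, mul_one]
  have := Finset.card_le_univ (Finset.Iic x)
  rw [Fintype.card_fin] at this
  exact_mod_cast this

theorem card_compl_moveSet {Z M : Config n} (hM : Movable Z M) :
    (moveSet Z M)ᶜ.card = Zᶜ.card := by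
  rw [Finset.card_compl, Finset.card_compl, hM.card_moveSet]

/-- A hop at x lowers the height at x by 1 + α and changes no other height, except that a hop across
the origin shifts the normalisation. So the remainder is constant around the circle. -/
theorem exists_height_moveSet {α : ℝ} {Z M : Config n} (hα : α * Zᶜ.card = Z.card)
    (hM : Movable Z M) : ∃ c, ∀ x, height α (moveSet Z M) x
      = height α Z x - (if x ∈ M then 1 + α else 0) + c := by
  have hα' : α * (moveSet Z M)ᶜ.card = (moveSet Z M).card := by
    rw [card_compl_moveSet hM, hM.card_moveSet, hα]
  set D : Fin n → ℝ := fun x =>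
    height α (moveSet Z M) x - height α Z x + (if x ∈ M then 1 + α else 0) with hD
  have hstep : ∀ x, D (x + 1) = D x := by
    intro x
    simp only [hD]
    rw [height_add_one hα', height_add_one hα]
    simp only [heightInc, mem_moveSet, add_sub_cancel_right]
    have h1 := @hM.1 (x + 1)
    have h2 := hM.2 x
    by_cases a : x + 1 ∈ Z <;> by_cases b : x + 1 ∈ M <;> by_cases c : x ∈ M <;>
      simp_all <;> ring
  refine ⟨D 0, fun x => ?_⟩
  rw [← eq_zero_of_add_one_eq hstep x, hD]
  ring

/-- Follow each hole: it steps back by one exactly when the particle on its left moves. -/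
theorem sum_holes_moveSet {Z M : Config n} (hM : Movable Z M) (F : Fin n → ℝ) :
    ∑ z ∈ (moveSet Z M)ᶜ, F z = ∑ z ∈ Zᶜ, F (if z - 1 ∈ M then z - 1 else z) := by
  symm
  have hns : ∀ z, z ∈ M → z - 1 ∉ M := fun z hz hz' => hM.2 _ hz' (by simpa using hM.1 hz)
  refine Finset.sum_bij' (fun z _ => if z - 1 ∈ M then z - 1 else z)
    (fun z _ => if z ∈ M then z + 1 else z) ?_ ?_ ?_ ?_ ?_
  · intro z hz
    rw [Finset.mem_compl] at hz ⊢
    rw [mem_moveSet]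
    split_ifs with h
    · rintro (h' | h')
      · exact h'.2 h
      · exact hns _ h h'
    · rintro (h' | h')
      · exact hz h'.1
      · exact h h'
  · intro z hz
    rw [Finset.mem_compl] at hz ⊢
    rw [mem_moveSet, not_or, not_and, not_not] at hz
    split_ifs with h
    · exact hM.2 z h
    · exact fun h' => h (hz.1 h')
  · intro z hz
    rw [Finset.mem_compl] at hz
    by_cases h : z - 1 ∈ M
    · simp [h]
    · have : z ∉ M := fun h' => hz (hM.1 h')
      simp [h, this]
  · intro z hz
    rw [Finset.mem_compl, mem_moveSet, not_or, not_and, not_not] at hz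
    by_cases h : z ∈ M
    · simp [h]
    · simp [h, hz.2]
  · intro z _
    rfl

/-- The site `z` (meant to be a hole) has a cluster of at least two particles on its left. -/
def JamHole (Z : Config n) (z : Fin n) : Prop := z - 1 ∈ Z ∧ z - 1 - 1 ∈ Z

instance (Z : Config n) (z : Fin n) : Decidable (JamHole Z z) := by
  unfold JamHole; infer_instance

/-- Exponential sum of the heights of the holes, with an extra weight on holes in front of jams. -/
noncomputable def expHeight (θ C α : ℝ) (Z : Config n) : ℝ :=
  ∑ z ∈ Zᶜ, Real.exp (θ * height α Z z) * (if JamHole Z z then 1 + C else 1)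

/-- Normal movement creates no jams: particles adjacent after the step that still have another one
behind them must have been stuck, and free particles never stay. -/
theorem FreeMoves.jamHole_of_moveSet {Z M : Config n} (hM : FreeMoves Z M) {z : Fin n} (hz : z ∉ Z)
    (h : JamHole (moveSet Z M) (if z - 1 ∈ M then z - 1 else z)) : JamHole Z z := by
  have hns : ∀ z, z - 1 ∈ M → z ∉ Z := fun z hz' => by simpa using hM.1.2 _ hz'
  have aux : ∀ w, w ∈ moveSet Z M → w - 1 ∈ moveSet Z M → w - 1 ∉ M → w ∈ Z ∧ w ∉ M := by
    intro w hw hw' h1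
    rcases mem_moveSet.1 hw with h2 | h2
    · exact h2
    · exact (h1 h2).elim
  have aux2 : ∀ w, w ∈ moveSet Z M → w - 1 ∈ moveSet Z M → w - 1 ∉ M := by
    intro w _ hw' h1
    rcases mem_moveSet.1 hw' with h2 | h2
    · exact h2.2 h1
    · exact hns _ h2 (hM.1.1 h1)
  obtain ⟨h1, h2⟩ := h
  have h3 := aux2 _ h1 h2
  have h4 := aux _ h1 h2 h3
  split_ifs at h1 h2 h3 h4 with hzM
  · exact ⟨hM.1.1 hzM, h4.1⟩
  · refine ⟨h4.1, ?_⟩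
    by_contra h5
    exact h4.2 (hM.2 _ h4.1 (by simpa using hz) h5)

/-- After adding α, a hole not in front of a jam sits at the old height of the preceding hole: this
is z - 1 if that site is empty, and z - 2 otherwise, since the lone particle at z - 1 moves. Passing
to the preceding hole is injective. -/
theorem FreeMoves.sum_nonjam_le {θ α : ℝ} {Z M : Config n} (hα : α * Zᶜ.card = Z.card)
    (hM : FreeMoves Z M) :
    ∑ z ∈ Zᶜ with ¬ JamHole Z z,
        Real.exp (θ * (height α Z z - (if z - 1 ∈ M then 1 else 0) + α))
      ≤ ∑ z ∈ Zᶜ, Real.exp (θ * height α Z z) := by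
  have h1 : ∀ z ∈ Zᶜ.filter fun z => ¬ JamHole Z z,
      Real.exp (θ * (height α Z z - (if z - 1 ∈ M then 1 else 0) + α))
        = Real.exp (θ * height α Z (if z - 1 ∈ Z then z - 1 - 1 else z - 1)) := by
    intro z hz
    rw [Finset.mem_filter, Finset.mem_compl, JamHole] at hz
    have e1 := height_add_one hα (z - 1)
    have e2 := height_add_one hα (z - 1 - 1)
    rw [sub_add_cancel, heightInc, if_neg hz.1] at e1
    rw [sub_add_cancel, heightInc] at e2
    congr 2
    by_cases h : z - 1 ∈ Z
    · have h2 : z - 1 - 1 ∉ Z := fun h' => hz.2 ⟨h, h'⟩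
      have h3 : z - 1 ∈ M := hM.2 _ h (by simpa using hz.1) h2
      rw [if_pos h] at e2
      rw [if_pos h3, if_pos h]
      linarith
    · have h3 : z - 1 ∉ M := fun h' => h (hM.1.1 h')
      rw [if_neg h3, if_neg h]
      linarith
  rw [Finset.sum_congr rfl h1]
  rw [← Finset.sum_image (f := fun w => Real.exp (θ * height α Z w))
    (g := fun z => if z - 1 ∈ Z then z - 1 - 1 else z - 1)]
  · refine Finset.sum_le_sum_of_subset_of_nonneg ?_ fun _ _ _ => (Real.exp_pos _).le
    intro w hw
    rw [Finset.mem_image] at hw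
    obtain ⟨z, hz, rfl⟩ := hw
    rw [Finset.mem_filter, Finset.mem_compl, JamHole] at hz
    rw [Finset.mem_compl]
    split_ifs with h
    · exact fun h' => hz.2 ⟨h, h'⟩
    · exact h
  · intro z hz z' hz' hzz
    rw [Finset.mem_coe, Finset.mem_filter, Finset.mem_compl, JamHole] at hz hz'
    simp only at hzz
    split_ifs at hzz with h h' h'
    · simpa using hzz
    · rw [sub_left_inj] at hzz
      rw [hzz] at h
      exact (hz'.1 h).elim
    · rw [sub_left_inj] at hzz
      rw [← hzz] at h'
      exact (hz.1 h').elim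
    · simpa using hzz

/-- One step of the dynamics: the two ingredients of the Lyapunov function, up to a common shift
of the heights. -/
theorem FreeMoves.exists_shift {θ C α : ℝ} (hC : 0 ≤ C) {Z M : Config n}
    (hα : α * Zᶜ.card = Z.card) (hM : FreeMoves Z M) :
    ∃ c, expHeight θ C α (moveSet Z M) ≤ Real.exp (θ * (c - α)) *
        (∑ z ∈ Zᶜ, Real.exp (θ * height α Z z) + (1 + C) * ∑ z ∈ Zᶜ with JamHole Z z,
          Real.exp (θ * height α Z z) *
            (if z - 1 ∈ M then Real.exp (θ * (α - 1)) else Real.exp (θ * α))) ∧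
      ∑ z ∈ (moveSet Z M)ᶜ, height α (moveSet Z M) z
        = ∑ z ∈ Zᶜ, height α Z z - M.card + Zᶜ.card * c := by
  obtain ⟨c, hc⟩ := exists_height_moveSet hα hM.1
  have hh : ∀ z ∈ Zᶜ, height α (moveSet Z M) (if z - 1 ∈ M then z - 1 else z)
      = height α Z z - (if z - 1 ∈ M then 1 else 0) + c := by
    intro z hz
    rw [Finset.mem_compl] at hz
    have e1 := height_add_one hα (z - 1)
    rw [sub_add_cancel, heightInc, if_neg hz] at e1
    rw [hc]
    by_cases h : z - 1 ∈ M
    · simp only [h, if_true]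
      linarith
    · have : z ∉ M := fun h' => hz (hM.1.1 h')
      simp [h, this]
  refine ⟨c, ?_, ?_⟩
  · rw [expHeight, sum_holes_moveSet hM.1, mul_add, ← Finset.sum_filter_not_add_sum_filter _
      (fun z => JamHole Z z)]
    refine add_le_add ?_ ?_
    · refine le_trans (le_of_eq ?_)
        (mul_le_mul_of_nonneg_left (hM.sum_nonjam_le hα) (Real.exp_pos _).le)
      rw [Finset.mul_sum]
      refine Finset.sum_congr rfl fun z hz => ?_
      rw [Finset.mem_filter] at hz
      rw [if_neg fun h => hz.2 (hM.jamHole_of_moveSet (Finset.mem_compl.1 hz.1) h), hh z hz.1,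
        mul_one, ← Real.exp_add]
      congr 1
      ring
    · rw [Finset.mul_sum, Finset.mul_sum]
      refine Finset.sum_le_sum fun z hz => ?_
      rw [Finset.mem_filter] at hz
      rw [hh z hz.1]
      have : Real.exp (θ * (height α Z z - (if z - 1 ∈ M then 1 else 0) + c))
          = Real.exp (θ * (c - α)) * (Real.exp (θ * height α Z z) *
            (if z - 1 ∈ M then Real.exp (θ * (α - 1)) else Real.exp (θ * α))) := by
        split_ifs <;> rw [← Real.exp_add, ← Real.exp_add] <;> congr 1 <;> ring
      rw [this]
      have hle : (if JamHole (moveSet Z M) (if z - 1 ∈ M then z - 1 else z) then 1 + C else 1)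
          ≤ 1 + C := by split_ifs <;> linarith
      refine (mul_le_mul_of_nonneg_left hle ?_).trans (le_of_eq ?_)
      · split_ifs <;> positivity
      · ring
  · rw [sum_holes_moveSet hM.1, Finset.sum_congr rfl hh, Finset.sum_add_distrib,
      Finset.sum_sub_distrib, Finset.sum_const, nsmul_eq_mul]
    congr 2
    rw [← Finset.sum_filter, Finset.sum_const, nsmul_eq_mul, mul_one]
    congr 1
    refine Finset.card_bij (fun z _ => z - 1) ?_ ?_ ?_
    · intro z hz
      exact (Finset.mem_filter.1 hz).2
    · intro z _ z' _ h
      exact sub_left_injective h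
    · intro z hz
      refine ⟨z + 1, ?_, by simp⟩
      rw [Finset.mem_filter, Finset.mem_compl]
      exact ⟨hM.1.2 z hz, by simpa using hz⟩

/-- The Lyapunov function: soft maximum minus mean of the hole heights, times the number of
holes. -/
noncomputable def lyap (θ C α : ℝ) (Z : Config n) : ℝ :=
  Zᶜ.card / θ * Real.log (expHeight θ C α Z) - ∑ z ∈ Zᶜ, height α Z z

theorem expHeight_pos {θ C α : ℝ} (hC : 0 ≤ C) {Z : Config n} (hZ : 0 < Zᶜ.card) :
    0 < expHeight θ C α Z := by
  refine Finset.sum_pos (fun z _ => mul_pos (Real.exp_pos _) ?_) (Finset.card_pos.1 hZ)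
  split_ifs <;> linarith

/-- The common shift c of the heights cancels between the soft maximum and the mean. What remains of
the linear terms is minus the number of non-movers, and log x ≤ x - 1 linearises the soft maximum.
-/
theorem FreeMoves.lyap_moveSet_le {θ C α : ℝ} (hθ : 0 < θ) (hC : 0 ≤ C) {Z M : Config n}
    (hZ : 0 < Zᶜ.card) (hα : α * Zᶜ.card = Z.card) (hM : FreeMoves Z M) :
    lyap θ C α (moveSet Z M) ≤ lyap θ C α Z - (Z.card - M.card) + Zᶜ.card / θ *
      ((∑ z ∈ Zᶜ, Real.exp (θ * height α Z z) + (1 + C) * ∑ z ∈ Zᶜ with JamHole Z z,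
          Real.exp (θ * height α Z z) *
            (if z - 1 ∈ M then Real.exp (θ * (α - 1)) else Real.exp (θ * α)))
        / expHeight θ C α Z - 1) := by
  obtain ⟨c, h1, h2⟩ := hM.exists_shift (θ := θ) hC hα
  set B := ∑ z ∈ Zᶜ, Real.exp (θ * height α Z z) + (1 + C) * ∑ z ∈ Zᶜ with JamHole Z z,
          Real.exp (θ * height α Z z) *
            (if z - 1 ∈ M then Real.exp (θ * (α - 1)) else Real.exp (θ * α))
  have hG := expHeight_pos (θ := θ) (α := α) hC hZ
  have hG' : 0 < expHeight θ C α (moveSet Z M) :=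
    expHeight_pos hC (by rwa [card_compl_moveSet hM.1])
  have hB : 0 < B := by
    have := hG'.trans_le h1
    exact pos_of_mul_pos_right this (Real.exp_pos _).le
  have hlog : Real.log (expHeight θ C α (moveSet Z M))
      ≤ θ * (c - α) + (Real.log (expHeight θ C α Z) + (B / expHeight θ C α Z - 1)) := by
    refine (Real.log_le_log hG' h1).trans ?_
    rw [Real.log_mul (Real.exp_pos _).ne' hB.ne', Real.log_exp]
    have := Real.log_le_sub_one_of_pos (div_pos hB hG)
    rw [Real.log_div hB.ne' hG.ne'] at this
    linarith
  have h3 : (0 : ℝ) ≤ Zᶜ.card / θ := by positivity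
  have h4 := mul_le_mul_of_nonneg_left hlog h3
  have h5 : (Zᶜ.card : ℝ) / θ * (θ * (c - α)) = Zᶜ.card * c - Z.card := by
    rw [← hα]; field_simp
  rw [lyap, lyap, card_compl_moveSet hM.1, h2]
  rw [mul_add, mul_add, h5] at h4
  linarith

/-- A particle leading a jam hops with probability p, so the jam part of the exponential sum is
multiplied on average by the bracket in `hκ`. The extra weight C absorbs it: the averaged ratio to
`expHeight` is at most 1, and the mean number of non-movers is left as drift. -/
theorem moverExp_lyap_le {p θ C α : ℝ} (hp0 : 0 ≤ p) (hp1 : p ≤ 1) (hθ : 0 < θ) (hC : 0 ≤ C)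
    (hκ : (1 + C) * (p * Real.exp (θ * (α - 1)) + (1 - p) * Real.exp (θ * α)) ≤ C)
    {Z : Config n} (hZ : 0 < Zᶜ.card) (hα : α * Zᶜ.card = Z.card) :
    moverExp p 1 Z (fun M => lyap θ C α (moveSet Z M))
      ≤ lyap θ C α Z - (Z.card - ∑ i ∈ Z, hopProb p 1 Z i) := by
  refine (moverExp_one_mono hp0 hp1 fun M hM => hM.lyap_moveSet_le hθ hC hZ hα).trans ?_
  set G := expHeight θ C α Z with hGdef
  have hG : 0 < G := expHeight_pos hC hZ
  have e1 : ∀ M : Config n, lyap θ C α Z - ((Z.card : ℝ) - M.card) + Zᶜ.card / θ *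
      ((∑ z ∈ Zᶜ, Real.exp (θ * height α Z z) + (1 + C) * ∑ z ∈ Zᶜ with JamHole Z z,
          Real.exp (θ * height α Z z) *
            (if z - 1 ∈ M then Real.exp (θ * (α - 1)) else Real.exp (θ * α))) / G - 1)
      = (lyap θ C α Z - Z.card - Zᶜ.card / θ
          + Zᶜ.card / θ * (∑ z ∈ Zᶜ, Real.exp (θ * height α Z z)) / G) + (M.card : ℝ)
        + (Zᶜ.card / θ * (1 + C) / G) * ∑ z ∈ Zᶜ with JamHole Z z, Real.exp (θ * height α Z z) *
            (if z - 1 ∈ M then Real.exp (θ * (α - 1)) else Real.exp (θ * α)) := by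
    intro M
    field_simp
    ring
  simp only [e1]
  rw [moverExp_add, moverExp_add, moverExp_const, moverExp_card, moverExp_const_mul, moverExp_sum]
  have e2 : ∑ z ∈ Zᶜ with JamHole Z z, moverExp p 1 Z (fun M => Real.exp (θ * height α Z z) *
      (if z - 1 ∈ M then Real.exp (θ * (α - 1)) else Real.exp (θ * α)))
      = (∑ z ∈ Zᶜ with JamHole Z z, Real.exp (θ * height α Z z)) *
        (p * Real.exp (θ * (α - 1)) + (1 - p) * Real.exp (θ * α)) := by
    rw [Finset.sum_mul]
    refine Finset.sum_congr rfl fun z hz => ?_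
    rw [Finset.mem_filter, Finset.mem_compl] at hz
    rw [moverExp_const_mul, moverExp_ite_mem p 1 hz.2.1, hopProb_eq, sub_add_cancel, if_neg hz.1,
      if_pos hz.2.2]
  rw [e2]
  set S := ∑ z ∈ Zᶜ, Real.exp (θ * height α Z z)
  set J := ∑ z ∈ Zᶜ with JamHole Z z, Real.exp (θ * height α Z z) with hJ
  have hJ0 : 0 ≤ J := Finset.sum_nonneg fun _ _ => (Real.exp_pos _).le
  have hGS : G = S + C * J := by
    rw [hGdef, expHeight, hJ, Finset.sum_filter, Finset.mul_sum, ← Finset.sum_add_distrib]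
    refine Finset.sum_congr rfl fun z _ => ?_
    split_ifs <;> ring
  have h1 := mul_le_mul_of_nonneg_left hκ hJ0
  have h2 : S + (1 + C) * (J * (p * Real.exp (θ * (α - 1)) + (1 - p) * Real.exp (θ * α))) ≤ G := by
    rw [hGS]; linarith
  have h3 : (0 : ℝ) ≤ Zᶜ.card / θ := by positivity
  have h4 : Zᶜ.card / θ * ((S + (1 + C) *
      (J * (p * Real.exp (θ * (α - 1)) + (1 - p) * Real.exp (θ * α)))) / G) ≤ Zᶜ.card / θ * 1 := by
    refine mul_le_mul_of_nonneg_left ?_ h3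
    rw [div_le_one hG]
    exact h2
  have h5 : Zᶜ.card / θ * S / G + Zᶜ.card / θ * (1 + C) / G *
      (J * (p * Real.exp (θ * (α - 1)) + (1 - p) * Real.exp (θ * α)))
      = Zᶜ.card / θ * ((S + (1 + C) *
      (J * (p * Real.exp (θ * (α - 1)) + (1 - p) * Real.exp (θ * α)))) / G) := by
    field_simp
  linarith

/-- Effect of the relocation of a particle of an ideal configuration. -/
theorem lyap_relocate_le {θ C α : ℝ} (hθ : 0 < θ) (hC : 0 ≤ C) (h0 : 0 ≤ α) (h1 : α ≤ 1)
    {Z : Config n} (hZ : 0 < Zᶜ.card) (hα : α * Zᶜ.card = Z.card) (hI : IsIdeal Z) {x y : Fin n}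
    (hx : x ∈ Z) (hy : y ∉ Z.erase x) :
    lyap θ C α (insert y (Z.erase x))
      ≤ lyap θ C α Z + n * (Real.log ((1 + C) * Real.exp (2 * θ) * (1 + Real.exp θ)) / θ + 4) := by
  set Λ := Real.log ((1 + C) * Real.exp (2 * θ) * (1 + Real.exp θ))
  have hexp1 : 1 ≤ Real.exp (2 * θ) := Real.one_le_exp (by positivity)
  have hΛ : 0 ≤ Λ := by
    apply Real.log_nonneg
    have h3 : 0 < Real.exp θ := Real.exp_pos θ
    have h2 : 1 ≤ (1 + C) * Real.exp (2 * θ) := by nlinarith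
    nlinarith
  have hn : (0 : ℝ) ≤ n := Nat.cast_nonneg n
  by_cases hyx : y = x
  · rw [hyx, Finset.insert_erase hx]
    have : 0 ≤ (n : ℝ) * (Λ / θ + 4) := by positivity
    linarith
  have hyZ : y ∉ Z := fun h => hy (Finset.mem_erase.2 ⟨hyx, h⟩)
  set Z₁ := insert y (Z.erase x) with hZ₁
  have hcompl : Z₁ᶜ = insert x (Zᶜ.erase y) := by
    ext z
    simp only [hZ₁, Finset.mem_compl, Finset.mem_insert, Finset.mem_erase]
    by_cases h : z = x
    · simp [h, Ne.symm hyx]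
    · simp [h]
  have hxy : x ∉ Zᶜ.erase y := fun h => (Finset.mem_compl.1 (Finset.mem_of_mem_erase h)) hx
  have hyc : y ∈ Zᶜ := Finset.mem_compl.2 hyZ
  have hcard : Z₁ᶜ.card = Zᶜ.card := by
    rw [hcompl, Finset.card_insert_of_notMem hxy, Finset.card_erase_of_mem hyc]
    omega
  have hinc : ∀ z, heightInc α Z₁ z = heightInc α Z z + (1 + α) *
      ((if z = y then 1 else 0) - (if z = x then 1 else 0)) := by
    intro z
    simp only [heightInc, hZ₁, Finset.mem_insert, Finset.mem_erase]
    by_cases h : z = x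
    · subst h
      simp [hx, Ne.symm hyx]
    · by_cases h' : z = y
      · subst h'
        simp [h, hyZ]
      · simp [h, h']
  have hh : ∀ z, |height α Z₁ z - height α Z z| ≤ 2 := by
    intro z
    have : height α Z₁ z - height α Z z = (1 + α) *
        ((if y ≤ z then 1 else 0) - (if x ≤ z then 1 else 0)) := by
      simp only [height, hinc]
      rw [Finset.sum_add_distrib, add_sub_cancel_left, ← Finset.mul_sum, Finset.sum_sub_distrib,
        Finset.sum_ite_eq', Finset.sum_ite_eq']
      simp
    rw [this, abs_le]
    constructor <;> split_ifs <;> linarith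
  have hexp : expHeight θ C α Z₁
      ≤ (1 + C) * Real.exp (2 * θ) * (1 + Real.exp θ) * expHeight θ C α Z := by
    have a1 : expHeight θ C α Z₁ ≤ (1 + C) * Real.exp (2 * θ) * ∑ z, Real.exp (θ * height α Z z) := by
      rw [expHeight, Finset.mul_sum]
      refine (Finset.sum_le_sum fun z _ => ?_).trans (Finset.sum_le_sum_of_subset_of_nonneg
        (f := fun z => (1 + C) * Real.exp (2 * θ) * Real.exp (θ * height α Z z))
        (Finset.subset_univ _) fun z _ _ => by positivity)
      rw [mul_assoc, ← Real.exp_add, mul_comm]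
      have b1 : Real.exp (θ * height α Z₁ z) ≤ Real.exp (2 * θ + θ * height α Z z) := by
        apply Real.exp_le_exp.2
        have := (abs_le.1 (hh z)).2
        nlinarith
      have b2 : (if JamHole Z₁ z then 1 + C else 1) ≤ 1 + C := by split_ifs <;> linarith
      exact mul_le_mul b2 b1 (Real.exp_pos _).le (by linarith)
    -- In an ideal configuration each particle is followed by its own hole, whose height is lower by
    -- only α ≤ 1. So the sum over all sites is controlled by the sum over holes.
    have a2 : ∑ z, Real.exp (θ * height α Z z)
        ≤ (1 + Real.exp θ) * ∑ z ∈ Zᶜ, Real.exp (θ * height α Z z) := by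
      rw [← Finset.sum_add_sum_compl Z, add_mul, one_mul, add_comm]
      refine add_le_add le_rfl ?_
      have : ∀ z ∈ Z, Real.exp (θ * height α Z z)
          ≤ Real.exp θ * Real.exp (θ * height α Z (z + 1)) := by
        intro z hz
        rw [← Real.exp_add]
        apply Real.exp_le_exp.2
        rw [height_add_one hα, heightInc, if_neg (isIdeal_iff.1 hI z hz)]
        nlinarith
      refine (Finset.sum_le_sum this).trans ?_
      rw [← Finset.mul_sum]
      refine mul_le_mul_of_nonneg_left ?_ (Real.exp_pos _).le
      rw [← Finset.sum_image (f := fun w => Real.exp (θ * height α Z w)) (g := fun z => z + 1)]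
      · refine Finset.sum_le_sum_of_subset_of_nonneg ?_ fun _ _ _ => (Real.exp_pos _).le
        intro w hw
        obtain ⟨z, hz, rfl⟩ := Finset.mem_image.1 hw
        exact Finset.mem_compl.2 (isIdeal_iff.1 hI z hz)
      · intro z _ z' _ h
        exact add_right_cancel h
    have a3 : ∑ z ∈ Zᶜ, Real.exp (θ * height α Z z) ≤ expHeight θ C α Z := by
      refine Finset.sum_le_sum fun z _ => ?_
      refine le_mul_of_one_le_right (Real.exp_pos _).le ?_
      split_ifs <;> linarith
    refine a1.trans ?_
    rw [mul_assoc ((1 + C) * Real.exp (2 * θ))]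
    refine mul_le_mul_of_nonneg_left (a2.trans ?_) (by positivity)
    exact mul_le_mul_of_nonneg_left a3 (by positivity)
  have hG := expHeight_pos (θ := θ) (α := α) hC hZ
  have hG₁ : 0 < expHeight θ C α Z₁ := expHeight_pos hC (by rwa [hcard])
  have hlog : Real.log (expHeight θ C α Z₁) ≤ Λ + Real.log (expHeight θ C α Z) := by
    rw [← Real.log_mul (by positivity) hG.ne']
    exact Real.log_le_log hG₁ hexp
  have hsum : ∑ z ∈ Zᶜ, height α Z z - 4 * n ≤ ∑ z ∈ Z₁ᶜ, height α Z₁ z := by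
    have b1 : ∑ z ∈ Z₁ᶜ, (height α Z z - 2) ≤ ∑ z ∈ Z₁ᶜ, height α Z₁ z :=
      Finset.sum_le_sum fun z _ => by linarith [(abs_le.1 (hh z)).1]
    rw [Finset.sum_sub_distrib, Finset.sum_const, nsmul_eq_mul, hcard] at b1
    rw [hcompl, Finset.sum_insert hxy] at b1
    rw [hcompl]
    have b2 := Finset.add_sum_erase Zᶜ (fun z => height α Z z) hyc
    have b3 := abs_le.1 (abs_height_le h0 h1 Z x)
    have b4 := abs_le.1 (abs_height_le h0 h1 Z y)
    have b5 : (Zᶜ.card : ℝ) ≤ n := by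
      have := Finset.card_le_univ Zᶜ
      rw [Fintype.card_fin] at this
      exact_mod_cast this
    linarith
  have hN : (Zᶜ.card : ℝ) ≤ n := by
    have := Finset.card_le_univ Zᶜ
    rw [Fintype.card_fin] at this
    exact_mod_cast this
  rw [lyap, lyap, hcard]
  have c1 : (Zᶜ.card : ℝ) / θ * Real.log (expHeight θ C α Z₁)
      ≤ Zᶜ.card / θ * (Λ + Real.log (expHeight θ C α Z)) :=
    mul_le_mul_of_nonneg_left hlog (by positivity)
  have c2 : (Zᶜ.card : ℝ) / θ * Λ ≤ n * (Λ / θ) := by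
    have : (Zᶜ.card : ℝ) * (Λ / θ) ≤ n * (Λ / θ) := by gcongr
    calc (Zᶜ.card : ℝ) / θ * Λ = Zᶜ.card * (Λ / θ) := by ring
      _ ≤ _ := this
  linarith

end Height

/-! ## The chain with A-perturbations -/

section Perturbed

variable {n : ℕ} {p lam : ℝ}

/-- Mean of `f` after the relocation of a random particle of `Z` to a random hole. -/
noncomputable def relocExp (f : Config n → ℝ) (Z : Config n) : ℝ :=
  ∑ x ∈ Z, ∑ y ∈ (Z.erase x)ᶜ, pickProb Z x * f (insert y (Z.erase x))

/-- Mean of `f` after the possible perturbation of `Z`. -/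
noncomputable def afterExp (lam : ℝ) (f : Config n → ℝ) (Z : Config n) : ℝ :=
  if IsIdeal Z then (1 - perturbRate lam n) * f Z + perturbRate lam n * relocExp f Z else f Z

theorem perturbRate_nonneg (h : 0 ≤ lam) (n : ℕ) : 0 ≤ perturbRate lam n :=
  le_min zero_le_one (by positivity)

theorem perturbRate_le_one (lam : ℝ) (n : ℕ) : perturbRate lam n ≤ 1 := min_le_left _ _

theorem perturbRate_mul_le (h : 0 ≤ lam) (n : ℕ) : perturbRate lam n * n ≤ lam := by
  rcases Nat.eq_zero_or_pos n with rfl | hn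
  · simpa using h
  · have hn' : (0 : ℝ) < n := Nat.cast_pos.2 hn
    rw [← le_div_iff₀ hn']
    exact min_le_right _ _

theorem pickProb_nonneg (Z : Config n) (x : Fin n) : 0 ≤ pickProb Z x := by
  rw [pickProb]; positivity

theorem card_compl_erase_pos (Z : Config n) (x : Fin n) : 0 < (Z.erase x)ᶜ.card :=
  Finset.card_pos.2 ⟨x, by simp⟩

theorem sum_pickProb {Z : Config n} (hZ : Z.Nonempty) :
    ∑ x ∈ Z, ∑ _y ∈ (Z.erase x)ᶜ, pickProb Z x = 1 := by
  have h1 : ∀ x ∈ Z, ∑ _y ∈ (Z.erase x)ᶜ, pickProb Z x = (Z.card : ℝ)⁻¹ := by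
    intro x _
    have := card_compl_erase_pos Z x
    rw [Finset.sum_const, nsmul_eq_mul, pickProb]
    field_simp
  have : (Z.card : ℝ) ≠ 0 := by exact_mod_cast (Finset.card_pos.2 hZ).ne'
  rw [Finset.sum_congr rfl h1, Finset.sum_const, nsmul_eq_mul, mul_inv_cancel₀ this]

theorem relocExp_le {f : Config n → ℝ} {Z : Config n} {c : ℝ} (hZ : Z.Nonempty)
    (h : ∀ x ∈ Z, ∀ y, y ∉ Z.erase x → f (insert y (Z.erase x)) ≤ c) : relocExp f Z ≤ c := by
  calc relocExp f Z ≤ ∑ x ∈ Z, ∑ y ∈ (Z.erase x)ᶜ, pickProb Z x * c :=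
        Finset.sum_le_sum fun x hx => Finset.sum_le_sum fun y hy =>
          mul_le_mul_of_nonneg_left (h x hx y (Finset.mem_compl.1 hy)) (pickProb_nonneg Z x)
    _ = c := by
        simp only [← Finset.sum_mul]
        rw [sum_pickProb hZ, one_mul]

theorem relocExp_neg (f : Config n → ℝ) (Z : Config n) :
    relocExp (fun Y => -f Y) Z = -relocExp f Z := by
  simp [relocExp, Finset.sum_neg_distrib]

theorem le_relocExp {f : Config n → ℝ} {Z : Config n} {c : ℝ} (hZ : Z.Nonempty)
    (h : ∀ x ∈ Z, ∀ y, y ∉ Z.erase x → c ≤ f (insert y (Z.erase x))) : c ≤ relocExp f Z := by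
  have := relocExp_le (f := fun Y => -f Y) (c := -c) hZ
    fun x hx y hy => neg_le_neg (h x hx y hy)
  rw [relocExp_neg] at this
  linarith

theorem card_relocate {Z : Config n} {x y : Fin n} (hx : x ∈ Z) (hy : y ∉ Z.erase x) :
    (insert y (Z.erase x)).card = Z.card := by
  rw [Finset.card_insert_of_notMem hy, Finset.card_erase_add_one hx]

theorem sum_afterProb_mul (lam : ℝ) (Z : Config n) (f : Config n → ℝ) :
    ∑ Z', afterProb lam Z Z' * f Z' = afterExp lam f Z := by
  have hI : ∑ Z', (if Z = Z' then (1 : ℝ) else 0) * f Z' = f Z := by simp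
  by_cases h : IsIdeal Z
  · simp only [afterProb, afterExp, if_pos h, add_mul, Finset.sum_add_distrib, mul_assoc]
    rw [← Finset.mul_sum, ← Finset.mul_sum, hI]
    congr 2
    simp only [perturbProb, relocExp, Finset.sum_mul]
    rw [Finset.sum_comm]
    refine Finset.sum_congr rfl fun x _ => ?_
    rw [Finset.sum_comm]
    refine Finset.sum_congr rfl fun y _ => ?_
    simp
  · simp only [afterProb, afterExp, if_neg h]
    exact hI

theorem sum_aStepProb_mul [NeZero n] (p lam : ℝ) (Z : Config n) (f : Config n → ℝ) :
    ∑ Z', aStepProb p lam Z Z' * f Z'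
      = moverExp p 1 Z (fun M => afterExp lam f (moveSet Z M)) := by
  rw [← sum_stepProb_mul]
  simp only [aStepProb, Finset.sum_mul]
  rw [Finset.sum_comm]
  refine Finset.sum_congr rfl fun Z' _ => ?_
  rw [← sum_afterProb_mul, Finset.mul_sum]
  exact Finset.sum_congr rfl fun _ _ => by ring

theorem perturbProb_nonneg (Z Z' : Config n) : 0 ≤ perturbProb Z Z' :=
  Finset.sum_nonneg fun x _ => Finset.sum_nonneg fun y _ =>
    mul_nonneg (pickProb_nonneg Z x) (by split_ifs <;> simp)

theorem afterProb_nonneg (h : 0 ≤ lam) (Z Z' : Config n) : 0 ≤ afterProb lam Z Z' := by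
  have h1 := perturbRate_nonneg h n
  have h2 := perturbRate_le_one lam n
  have h3 := perturbProb_nonneg Z Z'
  rw [afterProb]
  split_ifs <;> nlinarith

theorem aStepProb_nonneg [NeZero n] (hp0 : 0 ≤ p) (hp1 : p ≤ 1) (h : 0 ≤ lam) (Z Z' : Config n) :
    0 ≤ aStepProb p lam Z Z' :=
  Finset.sum_nonneg fun Y _ => mul_nonneg (stepProb_nonneg hp0 hp1 zero_le_one le_rfl Z Y)
    (afterProb_nonneg h Y Z')

theorem afterExp_le (h : 0 ≤ lam) {f : Config n → ℝ} {Z : Config n} {c d : ℝ}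
    (hc : f Z ≤ c) (hd : 0 ≤ d) (hr : IsIdeal Z → relocExp f Z ≤ f Z + d) :
    afterExp lam f Z ≤ c + perturbRate lam n * d := by
  have h1 := perturbRate_nonneg h n
  rw [afterExp]
  split_ifs with hI
  · have := mul_le_mul_of_nonneg_left (hr hI) h1
    linarith
  · have := mul_nonneg h1 hd
    linarith

theorem relocExp_const {Z : Config n} (hZ : Z.Nonempty) (c : ℝ) : relocExp (fun _ => c) Z = c :=
  le_antisymm (relocExp_le hZ fun _ _ _ _ => le_rfl) (le_relocExp hZ fun _ _ _ _ => le_rfl)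

theorem afterExp_const {Z : Config n} (hZ : Z.Nonempty) (c : ℝ) :
    afterExp lam (fun _ => c) Z = c := by
  rw [afterExp, relocExp_const hZ]
  split_ifs <;> ring

theorem Movable.nonempty_moveSet [NeZero n] {Z M : Config n} (hM : Movable Z M) (hZ : Z.Nonempty) :
    (moveSet Z M).Nonempty := by
  rw [← Finset.card_pos, hM.card_moveSet]
  exact Finset.card_pos.2 hZ

theorem sum_aStepProb [NeZero n] (hp0 : 0 ≤ p) (hp1 : p ≤ 1) {Z : Config n} (hZ : Z.Nonempty) :
    ∑ Z', aStepProb p lam Z Z' = 1 := by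
  have := sum_aStepProb_mul p lam Z (fun _ => 1)
  simp only [mul_one] at this
  rw [this, moverExp_one_congr hp0 hp1 (G := fun _ => 1), moverExp_const]
  intro M hM
  exact afterExp_const (hM.1.nonempty_moveSet hZ) 1

theorem afterProb_ne_zero {Z Z' : Config n} (h : afterProb lam Z Z' ≠ 0) :
    Z' = Z ∨ (IsIdeal Z ∧ ∃ x ∈ Z, ∃ y, y ∉ Z.erase x ∧ Z' = insert y (Z.erase x)) := by
  by_cases he : Z = Z'
  · exact Or.inl he.symm
  rw [afterProb] at h
  split_ifs at h with hI
  · right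
    refine ⟨hI, ?_⟩
    have h2 : perturbProb Z Z' ≠ 0 := by
      intro h3
      rw [h3] at h
      simp at h
    obtain ⟨x, hx, hx'⟩ := Finset.exists_ne_zero_of_sum_ne_zero h2
    obtain ⟨y, hy, hy'⟩ := Finset.exists_ne_zero_of_sum_ne_zero hx'
    refine ⟨x, hx, y, Finset.mem_compl.1 hy, ?_⟩
    by_contra hne
    rw [if_neg (Ne.symm hne), mul_zero] at hy'
    exact hy' rfl
  · exact absurd rfl h

theorem aStepProb_ne_zero [NeZero n] {Z Z' : Config n} (h : aStepProb p lam Z Z' ≠ 0) :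
    ∃ Y, stepProb p 1 Z Y ≠ 0 ∧ afterProb lam Y Z' ≠ 0 := by
  obtain ⟨Y, _, hY⟩ := Finset.exists_ne_zero_of_sum_ne_zero h
  exact ⟨Y, left_ne_zero_of_mul hY, right_ne_zero_of_mul hY⟩

theorem card_eq_of_aStepProb_ne_zero [NeZero n] {Z Z' : Config n}
    (h : aStepProb p lam Z Z' ≠ 0) : Z'.card = Z.card := by
  obtain ⟨Y, h1, h2⟩ := aStepProb_ne_zero h
  rw [← card_eq_of_stepProb_ne_zero h1]
  rcases afterProb_ne_zero h2 with rfl | ⟨_, x, hx, y, hy, rfl⟩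
  · rfl
  · exact card_relocate hx hy

theorem exists_isStationaryDist_aStepProb [NeZero n] {k : ℕ} (hp0 : 0 ≤ p) (hp1 : p ≤ 1)
    (h : 0 ≤ lam) (hk0 : 0 < k) (hk : k ≤ n) :
    ∃ μ : Config n → ℝ, IsStationaryDist k (aStepProb p lam) μ :=
  exists_isStationaryDist hk (aStepProb_nonneg hp0 hp1 h)
    (fun _ hZ => sum_aStepProb hp0 hp1 (Finset.card_pos.1 (hZ ▸ hk0)))
    fun _ _ h => card_eq_of_aStepProb_ne_zero h

theorem perturbDist_nonneg (Z : Config n) : 0 ≤ perturbDist Z :=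
  Finset.sum_nonneg fun x _ => Finset.sum_nonneg fun _ _ =>
    mul_nonneg (pickProb_nonneg _ x) (Nat.cast_nonneg _)

theorem perturbDist_le [NeZero n] (Z : Config n) : perturbDist Z ≤ n := by
  rcases Z.eq_empty_or_nonempty with rfl | hZ
  · simp [perturbDist]
  calc perturbDist Z ≤ ∑ x ∈ Z, ∑ y ∈ (Z.erase x)ᶜ, pickProb Z x * (n : ℝ) :=
        Finset.sum_le_sum fun x _ => Finset.sum_le_sum fun y _ =>
          mul_le_mul_of_nonneg_left
            (Nat.cast_le.2 (Nat.mod_lt _ (NeZero.pos n)).le) (pickProb_nonneg Z x)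
    _ = n := by
        simp only [← Finset.sum_mul]
        rw [sum_pickProb hZ, one_mul]

/-- Probability that the normal movement from `Z` leads to an ideal configuration. -/
noncomputable def idealProb [NeZero n] (p : ℝ) (Z : Config n) : ℝ :=
  moverExp p 1 Z (fun M => if IsIdeal (moveSet Z M) then 1 else 0)

/-- A relocation covers less than n sites and has probability at most λ / n, so it adds at most λ
times the probability of reaching an ideal configuration. -/
theorem aDist_mem [NeZero n] (hp0 : 0 ≤ p) (hp1 : p ≤ 1) (h : 0 ≤ lam) (Z : Config n) :
    ∑ i ∈ Z, hopProb p 1 Z i ≤ aDist p lam Z ∧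
      aDist p lam Z ≤ ∑ i ∈ Z, hopProb p 1 Z i + lam * idealProb p Z := by
  have e : aDist p lam Z = ∑ i ∈ Z, hopProb p 1 Z i + moverExp p 1 Z (fun M =>
      if IsIdeal (moveSet Z M) then perturbRate lam n * perturbDist (moveSet Z M) else 0) := by
    rw [aDist, sum_stepProb_mul p 1 Z
      (fun Z' => if IsIdeal Z' then perturbRate lam n * perturbDist Z' else 0)]
  have h1 := perturbRate_nonneg h n
  rw [e]
  constructor
  · have : moverExp p 1 Z (fun _ => (0 : ℝ)) ≤ moverExp p 1 Z (fun M =>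
      if IsIdeal (moveSet Z M) then perturbRate lam n * perturbDist (moveSet Z M) else 0) := by
      refine moverExp_one_mono hp0 hp1 fun M _ => ?_
      split_ifs
      · exact mul_nonneg h1 (perturbDist_nonneg _)
      · exact le_rfl
    rw [moverExp_const] at this
    linarith
  · rw [idealProb, ← moverExp_const_mul]
    refine add_le_add le_rfl (moverExp_one_mono hp0 hp1 fun M _ => ?_)
    split_ifs
    · rw [mul_one]
      exact (mul_le_mul_of_nonneg_left (perturbDist_le _) h1).trans (perturbRate_mul_le h n)
    · simp

theorem idealProb_le_one [NeZero n] (hp0 : 0 ≤ p) (hp1 : p ≤ 1) (Z : Config n) :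
    idealProb p Z ≤ 1 := by
  rw [← moverExp_const p 1 Z 1]
  refine moverExp_one_mono hp0 hp1 fun M _ => ?_
  split_ifs <;> norm_num

theorem IsStationaryDist.sum_mul_moverExp [NeZero n] {k : ℕ} {μ : Config n → ℝ}
    (hμ : IsStationaryDist k (aStepProb p lam) μ) (f : Config n → ℝ) :
    ∑ Z, μ Z * moverExp p 1 Z (fun M => afterExp lam f (moveSet Z M)) = ∑ Z, μ Z * f Z := by
  rw [← hμ.sum_mul_step f]
  exact Finset.sum_congr rfl fun Z _ => by rw [sum_aStepProb_mul]

/-- Comparison of means under a distribution carried by the `k`-particle configurations. -/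
theorem IsStationaryDist.sum_mul_le {k : ℕ} {P : Config n → Config n → ℝ} {μ : Config n → ℝ}
    (hμ : IsStationaryDist k P μ) {f g : Config n → ℝ} (h : ∀ Z, Z.card = k → μ Z ≠ 0 → f Z ≤ g Z) :
    ∑ Z, μ Z * f Z ≤ ∑ Z, μ Z * g Z := by
  refine Finset.sum_le_sum fun Z _ => ?_
  by_cases h0 : μ Z = 0
  · simp [h0]
  · exact mul_le_mul_of_nonneg_left (h Z (by_contra fun hk => h0 (hμ.support Z hk)) h0)
      (hμ.nonneg Z)

theorem IsStationaryDist.sum_mul_const {k : ℕ} {P : Config n → Config n → ℝ} {μ : Config n → ℝ}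
    (hμ : IsStationaryDist k P μ) (c : ℝ) : ∑ Z, μ Z * c = c := by
  rw [← Finset.sum_mul, hμ.total, one_mul]

end Perturbed

/-! ## Low density: almost all particles are free -/

section LowDensity

/-- The bracket is the exponential moment of α minus a Bernoulli variable of mean p, whose
expectation α - p is negative, so a small θ works. -/
theorem exists_exp_mean_lt_one {p α : ℝ} (hp0 : 0 ≤ p) (hp1 : p ≤ 1) (hα : α < p) :
    ∃ θ : ℝ, 0 < θ ∧ p * Real.exp (θ * (α - 1)) + (1 - p) * Real.exp (θ * α) < 1 := by
  refine ⟨(p - α) / 2, by linarith, ?_⟩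
  set θ := (p - α) / 2 with hθ
  have hθ0 : 0 < θ := by rw [hθ]; linarith
  have e1 : p * Real.exp (θ * (α - 1)) + (1 - p) * Real.exp (θ * α)
      = Real.exp (θ * α) * (1 - p + p * Real.exp (-θ)) := by
    rw [show θ * (α - 1) = θ * α + -θ by ring, Real.exp_add]
    ring
  have h1 : Real.exp (-θ) ≤ 1 - θ / (1 + θ) := by
    rw [Real.exp_neg, show 1 - θ / (1 + θ) = (1 + θ)⁻¹ by field_simp; ring]
    apply inv_anti₀ (by linarith)
    linarith [Real.add_one_le_exp θ]
  have h2 : 1 - p + p * Real.exp (-θ) ≤ Real.exp (-(p * (θ / (1 + θ)))) := by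
    have := Real.add_one_le_exp (-(p * (θ / (1 + θ))))
    nlinarith
  rw [e1]
  refine (mul_le_mul_of_nonneg_left h2 (Real.exp_pos _).le).trans_lt ?_
  rw [← Real.exp_add, Real.exp_lt_one_iff]
  have h3 : α * (1 + θ) < p := by rw [hθ]; nlinarith
  have h4 : α < p / (1 + θ) := by rwa [lt_div_iff₀ (by linarith)]
  have : θ * α + -(p * (θ / (1 + θ))) = θ * (α - p / (1 + θ)) := by ring
  rw [this]
  exact mul_neg_of_pos_of_neg hθ0 (by linarith)

variable {n k : ℕ} [NeZero n] {p lam : ℝ} {μ : Config n → ℝ}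

theorem cast_card_compl (Z : Config n) : (Zᶜ.card : ℝ) = n - Z.card := by
  rw [Finset.card_compl, Fintype.card_fin, Nat.cast_sub (by simpa using Finset.card_le_univ Z)]

theorem sum_hopProb_le (hp1 : p ≤ 1) (Z : Config n) :
    ∑ i ∈ Z, hopProb p 1 Z i ≤ Z.card := by
  refine (Finset.sum_le_sum fun i _ => hopProb_le_one hp1 le_rfl Z i).trans ?_
  simp

/-- In equilibrium the mean change of `lyap` is zero: the normal drift, minus the mean number of
non-movers, is balanced by relocations, which gain O(n) with probability at most λ / n. -/
theorem IsStationaryDist.card_sub_sum_hopProb_le {θ C α : ℝ} (hp0 : 0 ≤ p) (hp1 : p ≤ 1)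
    (hlam : 0 ≤ lam) (hk0 : 0 < k) (hkn : k < n) (hα : α * (n - k) = k) (hα1 : α ≤ 1)
    (hθ : 0 < θ) (hC : 0 ≤ C)
    (hκ : (1 + C) * (p * Real.exp (θ * (α - 1)) + (1 - p) * Real.exp (θ * α)) ≤ C)
    (hμ : IsStationaryDist k (aStepProb p lam) μ) :
    k - ∑ Z, μ Z * ∑ i ∈ Z, hopProb p 1 Z i
      ≤ lam * |Real.log ((1 + C) * Real.exp (2 * θ) * (1 + Real.exp θ)) / θ + 4| := by
  set K := Real.log ((1 + C) * Real.exp (2 * θ) * (1 + Real.exp θ)) / θ + 4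
  have hn : (0 : ℝ) < n - k := by
    have : (k : ℝ) < n := Nat.cast_lt.2 hkn
    linarith
  have hα0 : 0 ≤ α := by
    by_contra h
    have h1 : (0 : ℝ) ≤ k := Nat.cast_nonneg k
    nlinarith
  have hr := perturbRate_nonneg hlam n
  have h1 := hμ.sum_mul_moverExp (lyap θ C α)
  have h2 : ∑ Z, μ Z * moverExp p 1 Z (fun M => afterExp lam (lyap θ C α) (moveSet Z M))
      ≤ ∑ Z, μ Z * (lyap θ C α Z + ∑ i ∈ Z, hopProb p 1 Z i + (lam * |K| - k)) := by
    refine hμ.sum_mul_le fun Z hZ _ => ?_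
    have hZα : α * Zᶜ.card = Z.card := by rw [cast_card_compl, hZ, hα]
    have hZc : 0 < Zᶜ.card := by
      rw [Finset.card_compl, Fintype.card_fin, hZ]
      omega
    have hZne : Z.Nonempty := Finset.card_pos.1 (hZ ▸ hk0)
    have h3 := moverExp_lyap_le hp0 hp1 hθ hC hκ hZc hZα
    rw [hZ] at h3
    have h4 : moverExp p 1 Z (fun M => afterExp lam (lyap θ C α) (moveSet Z M))
        ≤ moverExp p 1 Z (fun M => lyap θ C α (moveSet Z M) + perturbRate lam n * (n * |K|)) := by
      refine moverExp_one_mono hp0 hp1 fun M hM => ?_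
      refine afterExp_le hlam le_rfl (by positivity) fun hI => ?_
      refine relocExp_le (hM.1.nonempty_moveSet hZne) fun x hx y hy => ?_
      refine (lyap_relocate_le hθ hC hα0 hα1 ?_ ?_ hI hx hy).trans ?_
      · rwa [card_compl_moveSet hM.1]
      · rwa [card_compl_moveSet hM.1, hM.1.card_moveSet]
      · gcongr
        exact le_abs_self K
    rw [moverExp_add, moverExp_const] at h4
    have h5 := mul_le_mul_of_nonneg_right (perturbRate_mul_le hlam n) (abs_nonneg K)
    linarith
  rw [h1] at h2
  simp only [mul_add] at h2
  rw [Finset.sum_add_distrib, Finset.sum_add_distrib] at h2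
  have h6 := hμ.sum_mul_const (lam * |K| - k)
  simp only [mul_sub] at h2 h6
  linarith

theorem isTypicalFlux_of_lt {ρ : ℝ} (hp0 : 0 < p) (hp1 : p < 1) (hρ0 : 0 < ρ) (hρ1 : ρ < 1)
    (hρ : ρ / (1 - ρ) < p) (hlam : 0 < lam) : IsTypicalFlux p lam ρ ρ := by
  have hκ : 0 < ρ / (1 - ρ) := div_pos hρ0 (by linarith)
  -- The actual ratio k / (n - k) eventually lies below this α, so θ and C can be fixed
  -- independently of n.
  obtain ⟨α, hα0, hαp⟩ := exists_between hρ
  obtain ⟨θ, hθ, hlt⟩ := exists_exp_mean_lt_one hp0.le hp1.le hαp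
  set E := p * Real.exp (θ * (α - 1)) + (1 - p) * Real.exp (θ * α) with hE
  have hE0 : 0 < E := by
    have : 0 < 1 - p := by linarith
    positivity
  set C := E / (1 - E) with hC
  have hC0 : 0 ≤ C := div_nonneg hE0.le (by linarith)
  have hCE : (1 + C) * E = C := by
    have : (1 - E) ≠ 0 := by linarith
    rw [hC]
    field_simp
    ring
  set K := |Real.log ((1 + C) * Real.exp (2 * θ) * (1 + Real.exp θ)) / θ + 4|
  refine isFluxLimit_of_abs_le
    (b := fun n : ℕ => |(⌈ρ * n⌉₊ : ℝ) / n - ρ| + lam * (1 + K) / n) ?_ ?_ ?_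
  · filter_upwards [eventually_ceil_lt hρ0.le hρ1, eventually_ceil_gt hρ0 0] with n h1 h2
    have : NeZero n := ⟨by omega⟩
    obtain ⟨μ, hμ⟩ := exists_isStationaryDist_aStepProb hp0.le hp1.le hlam.le h2 h1.le
    exact ⟨_, μ, hμ, rfl⟩
  · have h1 := ((tendsto_ceil_div hρ0.le).sub_const ρ).abs
    have h2 := tendsto_const_div_atTop_nhds_zero_nat (lam * (1 + K))
    simpa using h1.add h2
  · filter_upwards [eventually_ceil_lt hρ0.le hρ1, eventually_ceil_gt hρ0 0,
      (tendsto_particles_div_holes hρ0.le hρ1).eventually_lt_const hα0] with n h1 h2 h3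
    have : NeZero n := ⟨by omega⟩
    have hn : (0 : ℝ) < n := by exact_mod_cast NeZero.pos n
    rintro x ⟨μ, hμ, rfl⟩
    set k := ⌈ρ * n⌉₊ with hk
    have hkn : (k : ℝ) < n := Nat.cast_lt.2 h1
    have hcast : ((n - k : ℕ) : ℝ) = n - k := Nat.cast_sub h1.le
    rw [hcast] at h3
    have hle : (1 + C) * (p * Real.exp (θ * (k / (n - k) - 1))
        + (1 - p) * Real.exp (θ * (k / (n - k)))) ≤ C := by
      refine le_trans ?_ hCE.le
      rw [hE]
      have : 0 ≤ 1 - p := by linarith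
      gcongr
    have hne : (n : ℝ) - k ≠ 0 := by linarith
    have hα1 : (k : ℝ) / (n - k) ≤ 1 := by linarith
    have h4 := hμ.card_sub_sum_hopProb_le hp0.le hp1.le hlam.le h2 h1
      (div_mul_cancel₀ (k : ℝ) hne) hα1 hθ hC0 hle
    have h5 : ∑ Z, μ Z * aDist p lam Z ≤ ∑ Z, μ Z * (k + lam) := by
      refine hμ.sum_mul_le fun Z hZ _ => ?_
      have a1 := (aDist_mem hp0.le hp1.le hlam.le Z).2
      have a2 := sum_hopProb_le hp1.le Z
      have a3 := mul_le_mul_of_nonneg_left (idealProb_le_one hp0.le hp1.le Z) hlam.le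
      rw [hZ] at a2
      linarith
    have h6 : ∑ Z, μ Z * ∑ i ∈ Z, hopProb p 1 Z i ≤ ∑ Z, μ Z * aDist p lam Z :=
      hμ.sum_mul_le fun Z _ _ => (aDist_mem hp0.le hp1.le hlam.le Z).1
    rw [hμ.sum_mul_const] at h5
    have h7 : |(∑ Z, μ Z * aDist p lam Z) / n - k / n| ≤ lam * (1 + K) / n := by
      rw [← sub_div, abs_div, abs_of_pos hn]
      gcongr
      have : 0 ≤ lam * K := mul_nonneg hlam.le (abs_nonneg _)
      rw [abs_le]
      constructor <;> linarith
    have h8 := abs_sub_le ((∑ Z, μ Z * aDist p lam Z) / n) (k / n) ρ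
    linarith

/-- The particles with a hole on their right. -/
def heads (Z : Config n) : Config n := Z.filter fun i => i + 1 ∉ Z

theorem freeMoves_heads (Z : Config n) : FreeMoves Z (heads Z) :=
  ⟨⟨Finset.filter_subset _ _, fun _ hi => (Finset.mem_filter.1 hi).2⟩,
    fun _ hi h _ => Finset.mem_filter.2 ⟨hi, h⟩⟩

theorem moversProb_pos_of_freeMoves (hp0 : 0 < p) (hp1 : p < 1) {Z M : Config n}
    (hM : FreeMoves Z M) : 0 < moversProb p 1 Z M := by
  refine Finset.prod_pos fun i hi => ?_
  rw [hopProb_eq]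
  by_cases h1 : i + 1 ∈ Z
  · rw [if_neg fun h => hM.1.2 i h h1, if_pos h1]
    norm_num
  · by_cases h2 : i - 1 ∈ Z
    · rw [if_neg h1, if_pos h2]
      split_ifs <;> linarith
    · rw [if_neg h1, if_neg h2, if_pos (hM.2 i hi h1 h2)]
      norm_num

theorem stepProb_ne_zero_of_freeMoves (hp0 : 0 < p) (hp1 : p < 1) {Z M : Config n}
    (hM : FreeMoves Z M) : stepProb p 1 Z (moveSet Z M) ≠ 0 :=
  ((moversProb_pos_of_freeMoves hp0 hp1 hM).trans_le
    (stepProb_moveSet_ge hp0.le hp1.le zero_le_one le_rfl hM.1.1)).ne'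

theorem FreeMoves.eq_of_isIdeal {Z M : Config n} (hM : FreeMoves Z M) (hZ : IsIdeal Z) : M = Z := by
  refine Finset.Subset.antisymm hM.1.1 fun i hi => hM.2 i hi (isIdeal_iff.1 hZ i hi) fun h => ?_
  exact isIdeal_iff.1 hZ _ h (by simpa using hi)

theorem FreeMoves.isIdeal_moveSet {Z M : Config n} (hM : FreeMoves Z M) (hZ : IsIdeal Z) :
    IsIdeal (moveSet Z M) := by
  rw [hM.eq_of_isIdeal hZ, isIdeal_iff]
  intro i hi h
  rw [mem_moveSet] at hi h
  simp only [and_not_self, false_or, add_sub_cancel_right] at hi h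
  exact isIdeal_iff.1 hZ _ hi (by simpa using h)

theorem isIdeal_iff_heads {Z : Config n} : IsIdeal Z ↔ (heads Z).card = Z.card := by
  rw [isIdeal_iff, heads, Finset.card_filter_eq_iff]

theorem sum_hopProb_of_isIdeal {Z : Config n} (hZ : IsIdeal Z) :
    ∑ i ∈ Z, hopProb p 1 Z i = Z.card := by
  rw [Finset.sum_congr rfl (g := fun _ => (1 : ℝ)), Finset.sum_const, nsmul_eq_mul, mul_one]
  intro i hi
  rw [hopProb_eq, if_neg (isIdeal_iff.1 hZ i hi), if_neg]
  intro h
  exact isIdeal_iff.1 hZ _ h (by simpa using hi)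

/-- When every movable particle moves, each jam hole gains the factor exp (θ (α - 1)) surely instead
of on average. So the Lyapunov function drops strictly as soon as the ratio α is below 1, not only
below p. -/
theorem lyap_heads_lt {θ C α : ℝ} (hθ : 0 < θ) (hC : 0 ≤ C)
    (hκ : (1 + C) * Real.exp (θ * (α - 1)) ≤ C) {Z : Config n} (hZ : 0 < Zᶜ.card)
    (hα : α * Zᶜ.card = Z.card) (hI : ¬ IsIdeal Z) :
    lyap θ C α (moveSet Z (heads Z)) < lyap θ C α Z := by
  have h1 := (freeMoves_heads Z).lyap_moveSet_le hθ hC hZ hα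
  have h2 : ∑ z ∈ Zᶜ with JamHole Z z, Real.exp (θ * height α Z z) *
      (if z - 1 ∈ heads Z then Real.exp (θ * (α - 1)) else Real.exp (θ * α))
      = (∑ z ∈ Zᶜ with JamHole Z z, Real.exp (θ * height α Z z)) * Real.exp (θ * (α - 1)) := by
    rw [Finset.sum_mul]
    refine Finset.sum_congr rfl fun z hz => ?_
    rw [Finset.mem_filter, Finset.mem_compl] at hz
    rw [if_pos]
    exact Finset.mem_filter.2 ⟨hz.2.1, by simpa using hz.1⟩
  rw [h2] at h1
  set S := ∑ z ∈ Zᶜ, Real.exp (θ * height α Z z)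
  set J := ∑ z ∈ Zᶜ with JamHole Z z, Real.exp (θ * height α Z z) with hJ
  have hJ0 : 0 ≤ J := Finset.sum_nonneg fun _ _ => (Real.exp_pos _).le
  have hG := expHeight_pos (θ := θ) (α := α) hC hZ
  have hGS : expHeight θ C α Z = S + C * J := by
    rw [expHeight, hJ, Finset.sum_filter, Finset.mul_sum, ← Finset.sum_add_distrib]
    refine Finset.sum_congr rfl fun z _ => ?_
    split_ifs <;> ring
  have h3 := mul_le_mul_of_nonneg_left hκ hJ0
  have h4 : (S + (1 + C) * (J * Real.exp (θ * (α - 1)))) / expHeight θ C α Z ≤ 1 := by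
    rw [div_le_one hG, hGS]
    linarith
  have h5 : (Zᶜ.card : ℝ) / θ * ((S + (1 + C) * (J * Real.exp (θ * (α - 1))))
      / expHeight θ C α Z - 1) ≤ 0 :=
    mul_nonpos_of_nonneg_of_nonpos (by positivity) (by linarith)
  have h6 : ((heads Z).card : ℝ) < Z.card :=
    Nat.cast_lt.2 (lt_of_le_of_ne (Finset.card_filter_le _ _) fun h => hI (isIdeal_iff_heads.2 h))
  linarith

/-- Ideal configurations form a closed set. It can be reached from everywhere: a reachable minimiser
of `lyap` must be ideal, since otherwise moving all heads would lower it further. Here 2 k < n gives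
α < 1. -/
theorem IsStationaryDist.isIdeal_of_ne_zero (hp0 : 0 < p) (hp1 : p < 1) (hkn : 2 * k < n)
    (hμ : IsStationaryDist k (stepProb p 1) μ) {Z : Config n} (hZ : μ Z ≠ 0) : IsIdeal Z := by
  classical
  refine hμ.mem_of_ne_zero (stepProb_nonneg hp0.le hp1.le zero_le_one le_rfl)
    (fun Z _ => sum_stepProb p 1 Z) (D := IsIdeal) ?_ ?_ hZ
  · intro Z Z' hI h
    obtain ⟨M, hM, hne, rfl⟩ := exists_movers_of_stepProb_ne_zero h
    exact (freeMoves_of_moversProb_ne_zero hM hne).isIdeal_moveSet hI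
  · intro Z hZk
    have hkn' : 2 * (k : ℝ) < n := by exact_mod_cast hkn
    have hk0 : (0 : ℝ) ≤ k := Nat.cast_nonneg k
    set α : ℝ := k / (n - k)
    have hα1 : α < 1 := by rw [div_lt_one (by linarith)]; linarith
    have hE : Real.exp (1 * (α - 1)) < 1 := by
      rw [Real.exp_lt_one_iff]
      linarith
    set E := Real.exp (1 * (α - 1))
    have hE0 : 0 < E := Real.exp_pos _
    set C := E / (1 - E) with hC
    have hC0 : 0 ≤ C := div_nonneg hE0.le (by linarith)
    have hCE : (1 + C) * E = C := by
      have : (1 - E) ≠ 0 := by linarith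
      rw [hC]
      field_simp
      ring
    set R := Finset.univ.filter fun Y => Relation.ReflTransGen
      (fun Y Y' : Config n => stepProb p 1 Y Y' ≠ 0) Z Y
    obtain ⟨Y, hY, hmin⟩ := R.exists_min_image (lyap 1 C α)
      ⟨Z, Finset.mem_filter.2 ⟨Finset.mem_univ _, Relation.ReflTransGen.refl⟩⟩
    have hYr := (Finset.mem_filter.1 hY).2
    refine ⟨Y, hYr, ?_⟩
    by_contra hI
    have hYk : Y.card = k := by
      clear hmin hY hI
      induction hYr with
      | refl => exact hZk
      | tail _ hstep ih => rw [card_eq_of_stepProb_ne_zero hstep, ih]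
    have hlt := lyap_heads_lt one_pos hC0 hCE.le (Z := Y)
      (by rw [Finset.card_compl, Fintype.card_fin, hYk]; omega)
      (by rw [cast_card_compl, hYk]; exact div_mul_cancel₀ _ (by linarith)) hI
    have hmem : moveSet Y (heads Y) ∈ R := Finset.mem_filter.2 ⟨Finset.mem_univ _,
      hYr.tail (stepProb_ne_zero_of_freeMoves hp0 hp1 (freeMoves_heads Y))⟩
    exact absurd (hmin _ hmem) (not_le.2 hlt)

theorem isZeroRangeFlux_one {ρ : ℝ} (hp0 : 0 < p) (hp1 : p < 1) (hρ0 : 0 < ρ) (hρ : ρ < 1 / 2) :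
    IsZeroRangeFlux p 1 ρ ρ := by
  have hρ1 : ρ < 1 := by linarith
  refine isFluxLimit_of_abs_le (b := fun n : ℕ => |(⌈ρ * n⌉₊ : ℝ) / n - ρ|) ?_ ?_ ?_
  · filter_upwards [eventually_ceil_lt hρ0.le hρ1, eventually_ceil_gt hρ0 0] with n h1 h2
    have : NeZero n := ⟨by omega⟩
    obtain ⟨μ, hμ⟩ := exists_isStationaryDist (n := n) h1.le
      (stepProb_nonneg hp0.le hp1.le zero_le_one le_rfl) (fun Z _ => sum_stepProb p 1 Z)
      (fun _ _ h => card_eq_of_stepProb_ne_zero (n := n) h)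
    exact ⟨_, μ, hμ, rfl⟩
  · simpa using ((tendsto_ceil_div hρ0.le).sub_const ρ).abs
  · filter_upwards [(tendsto_ceil_div hρ0.le).eventually_lt_const hρ, eventually_ceil_gt hρ0 0,
      eventually_gt_atTop 0] with n h1 h2 h3
    have : NeZero n := ⟨by omega⟩
    rintro x ⟨μ, hμ, rfl⟩
    have hn : (0 : ℝ) < n := Nat.cast_pos.2 h3
    have h4 : 2 * ⌈ρ * n⌉₊ < n := by
      rw [div_lt_iff₀ hn] at h1
      have : 2 * (⌈ρ * n⌉₊ : ℝ) < n := by linarith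
      exact_mod_cast this
    have h5 : ∑ Z, μ Z * ∑ i ∈ Z, hopProb p 1 Z i = ∑ Z, μ Z * (⌈ρ * n⌉₊ : ℝ) := by
      refine Finset.sum_congr rfl fun Z _ => ?_
      by_cases h0 : μ Z = 0
      · simp [h0]
      · rw [sum_hopProb_of_isIdeal (hμ.isIdeal_of_ne_zero hp0 hp1 h4 h0),
          by_contra fun hk => h0 (hμ.support Z hk)]
    rw [h5, hμ.sum_mul_const]

end LowDensity

/-! ## Functionals of binary words -/

section Words

/-- Sum over the letters `false` of `exp (-θ (T - β F))`, where `T` and `F` are the numbers of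
letters `true` and `false` before. -/
noncomputable def jamSum (θ β : ℝ) : List Bool → ℝ
  | [] => 0
  | true :: l => Real.exp (-θ) * jamSum θ β l
  | false :: l => 1 + Real.exp (θ * β) * jamSum θ β l

/-- The weight `exp (-θ (T - β F))` of a word. -/
noncomputable def jamWeight (θ β : ℝ) (l : List Bool) : ℝ :=
  Real.exp (-θ * l.count true + θ * β * l.count false)

theorem jamWeight_append (θ β : ℝ) (a b : List Bool) :
    jamWeight θ β (a ++ b) = jamWeight θ β a * jamWeight θ β b := by
  simp only [jamWeight, ← Real.exp_add, List.count_append]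
  congr 1
  push_cast
  ring

theorem jamSum_append (θ β : ℝ) (a b : List Bool) :
    jamSum θ β (a ++ b) = jamSum θ β a + jamWeight θ β a * jamSum θ β b := by
  induction a with
  | nil => simp [jamSum, jamWeight]
  | cons c a ih =>
    have h : jamWeight θ β (c :: a) = jamWeight θ β [c] * jamWeight θ β a :=
      jamWeight_append θ β [c] a
    rw [h]
    cases c
    · simp only [List.cons_append, jamSum, ih]
      simp [jamWeight]
      ring
    · simp only [List.cons_append, jamSum, ih]
      simp [jamWeight]
      ring

theorem jamSum_nonneg (θ β : ℝ) (l : List Bool) : 0 ≤ jamSum θ β l := by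
  induction l with
  | nil => exact le_rfl
  | cons c l ih => cases c <;> simp only [jamSum] <;> positivity

theorem jamSum_replicate (θ β : ℝ) (m : ℕ) : jamSum θ β (List.replicate m true) = 0 := by
  induction m with
  | zero => rfl
  | succ m ih => simp [List.replicate_succ, jamSum, ih]

theorem jamWeight_replicate (θ β : ℝ) (m : ℕ) :
    jamWeight θ β (List.replicate m true) = Real.exp (-θ * m) := by
  simp [jamWeight, List.count_replicate]

theorem jamSum_jam (θ β : ℝ) (m : ℕ) (l : List Bool) :
    jamSum θ β (List.replicate m true ++ false :: l)
      = Real.exp (-θ * m) * (1 + Real.exp (θ * β) * jamSum θ β l) := by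
  rw [jamSum_append, jamSum_replicate, jamWeight_replicate, zero_add, jamSum]

/-- Effect of a step in which the jam head stays: the hole behind the jam disappears from its place
and reappears at the end. The later holes gain exp (-θ β), and only the new last hole adds a term.
-/
theorem jamSum_stay_le {θ β : ℝ} (m : ℕ) (l : List Bool) :
    jamSum θ β (List.replicate m true ++ (l ++ [false]))
      ≤ Real.exp (-θ * β) * jamSum θ β (List.replicate m true ++ false :: l)
        + jamWeight θ β (List.replicate m true ++ l) := by
  rw [jamSum_jam, jamSum_append, jamSum_append, jamSum_replicate, jamWeight_append,
    jamWeight_replicate, zero_add]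
  simp only [jamSum, mul_zero, add_zero, mul_one]
  have h : Real.exp (-θ * β) * (Real.exp (-θ * m) * (1 + Real.exp (θ * β) * jamSum θ β l))
      = Real.exp (-θ * β) * Real.exp (-θ * m) + Real.exp (-θ * m) * jamSum θ β l := by
    have : Real.exp (-θ * β) * Real.exp (θ * β) = 1 := by
      rw [← Real.exp_add]
      simp
    linear_combination Real.exp (-θ * m) * jamSum θ β l * this
  rw [h, mul_add]
  have : 0 ≤ Real.exp (-θ * β) * Real.exp (-θ * m) := by positivity
  linarith

/-- Effect of a step in which the head leaves: both the head and the hole behind the jam go to the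
end of the word, so later holes gain exp (θ (1 - β)), again up to one new term. -/
theorem jamSum_leave_le {θ β : ℝ} (m : ℕ) (l : List Bool) :
    jamSum θ β (List.replicate m true ++ (l ++ [true, false]))
      ≤ Real.exp (θ * (1 - β)) * jamSum θ β (List.replicate (m + 1) true ++ false :: l)
        + jamWeight θ β (List.replicate (m + 1) true ++ l) := by
  rw [jamSum_jam, jamSum_append, jamSum_append, jamSum_replicate, jamWeight_append,
    jamWeight_replicate, jamWeight_replicate, zero_add]
  simp only [jamSum, mul_zero, add_zero, mul_one]
  push_cast
  have e1 : Real.exp (-θ * (m + 1)) = Real.exp (-θ * m) * Real.exp (-θ) := by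
    rw [← Real.exp_add]; congr 1; ring
  have e2 : Real.exp (θ * (1 - β)) * Real.exp (-θ * (m + 1)) * Real.exp (θ * β)
      = Real.exp (-θ * m) := by
    rw [← Real.exp_add, ← Real.exp_add]; congr 1; ring
  have h : Real.exp (θ * (1 - β)) * (Real.exp (-θ * (m + 1)) *
        (1 + Real.exp (θ * β) * jamSum θ β l))
      = Real.exp (θ * (1 - β)) * Real.exp (-θ * (m + 1)) + Real.exp (-θ * m) * jamSum θ β l := by
    linear_combination jamSum θ β l * e2
  rw [h, e1, mul_add]
  have : 0 ≤ Real.exp (θ * (1 - β)) * (Real.exp (-θ * m) * Real.exp (-θ)) := by positivity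
  linarith

/-- If every prefix has at least α particles per hole up to a constant a, the successive holes
contribute at most a geometric series of ratio exp (-θ (α - β)). -/
theorem jamSum_le_of_prefix {θ β α : ℝ} (hθ : 0 < θ) (hβα : β < α) (l : List Bool) :
    ∀ a : ℝ, (∀ j, α * (l.take j).count false - (l.take j).count true ≤ a) →
      jamSum θ β l ≤ Real.exp (θ * a) / (1 - Real.exp (-θ * (α - β))) := by
  set r := Real.exp (-θ * (α - β)) with hr
  have hr1 : r < 1 := by
    rw [hr, Real.exp_lt_one_iff]
    nlinarith
  have hr2 : 0 < 1 - r := by linarith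
  induction l with
  | nil =>
    intro a _
    simp only [jamSum]
    positivity
  | cons c l ih =>
    intro a h
    cases c
    · have h0 : 1 ≤ Real.exp (θ * a) := by
        apply Real.one_le_exp
        have := h 0
        simp at this
        positivity
      have h1 := ih (a - α) fun j => by
        have := h (j + 1)
        simp at this
        linarith
      have e : Real.exp (θ * β) * Real.exp (θ * (a - α)) = Real.exp (θ * a) * r := by
        rw [hr, ← Real.exp_add, ← Real.exp_add]; congr 1; ring
      simp only [jamSum]
      calc 1 + Real.exp (θ * β) * jamSum θ β l
          ≤ Real.exp (θ * a) + Real.exp (θ * β) * (Real.exp (θ * (a - α)) / (1 - r)) := by gcongr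
        _ = Real.exp (θ * a) / (1 - r) := by
          rw [← mul_div_assoc, e]
          field_simp
          ring
    · have h1 := ih (a + 1) fun j => by
        have := h (j + 1)
        simp at this
        linarith
      simp only [jamSum]
      calc Real.exp (-θ) * jamSum θ β l
          ≤ Real.exp (-θ) * (Real.exp (θ * (a + 1)) / (1 - r)) := by gcongr
        _ = Real.exp (θ * a) / (1 - r) := by
          rw [← mul_div_assoc, ← Real.exp_add]
          congr 2
          ring

/-- Number of pairs of a letter `true` and a later letter `false`. -/
def jamInv : List Bool → ℕ
  | [] => 0
  | true :: l => l.count false + jamInv l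
  | false :: l => jamInv l

theorem jamInv_append (a b : List Bool) :
    jamInv (a ++ b) = jamInv a + jamInv b + a.count true * b.count false := by
  induction a with
  | nil => simp [jamInv]
  | cons c a ih =>
    cases c
    · simp [jamInv, ih]
    · simp [jamInv, ih, List.count_append]
      ring

theorem jamInv_replicate (m : ℕ) : jamInv (List.replicate m true) = 0 := by
  induction m with
  | zero => rfl
  | succ m ih => simp [List.replicate_succ, jamInv, ih, List.count_replicate]

theorem jamInv_le (l : List Bool) : jamInv l ≤ l.count true * l.count false := by
  induction l with
  | nil => simp [jamInv]
  | cons c l ih =>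
    cases c
    · simp only [jamInv, List.count_cons]
      simp
      nlinarith
    · simp only [jamInv, List.count_cons]
      simp
      nlinarith

theorem jamInv_stay (m : ℕ) (l : List Bool) :
    jamInv (List.replicate m true ++ (l ++ [false]))
      = jamInv (List.replicate m true ++ false :: l) + l.count true := by
  simp only [jamInv_append, jamInv, jamInv_replicate, List.count_append, List.count_replicate,
    List.count_cons, List.count_nil]
  simp
  ring

/-- Together with `jamInv_stay`: the inversion count gains one per particle behind the jam, and
loses one per remaining hole exactly when the head leaves. The loss is written additively to avoid
truncated subtraction. -/
theorem jamInv_leave (m : ℕ) (l : List Bool) :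
    jamInv (List.replicate m true ++ (l ++ [true, false])) + l.count false
      = jamInv (List.replicate (m + 1) true ++ false :: l) + l.count true := by
  simp only [jamInv_append, jamInv, jamInv_replicate, List.count_append, List.count_replicate,
    List.count_cons, List.count_nil]
  simp
  ring

end Words

/-! ## Configurations with a single jam -/

section Jam

variable {n : ℕ} [NeZero n] {Z M : Config n} {b : Fin n} {m : ℕ}

/-- Occupation of the `i`-th site met when walking counterclockwise from `b`. -/
def Occ (Z : Config n) (b : Fin n) (i : ℕ) : Prop := b - Fin.ofNat n i ∈ Z

instance (Z : Config n) (b : Fin n) : DecidablePred (Occ Z b) :=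
  fun _ => inferInstanceAs (Decidable (_ ∈ Z))

theorem occ_zero : Occ Z b 0 ↔ b ∈ Z := by
  rw [Occ, Fin.ofNat_zero_eq_zero, sub_zero]

theorem occ_succ (i : ℕ) : Occ Z b (i + 1) ↔ b - Fin.ofNat n i - 1 ∈ Z := by
  rw [Occ, Fin.ofNat_succ, sub_sub]

theorem occ_one : Occ Z b 1 ↔ b - 1 ∈ Z := by
  refine (occ_succ 0).trans ?_
  rw [Fin.ofNat_zero_eq_zero, sub_zero]

theorem occ_sub_one (i : ℕ) : Occ Z (b - 1) i ↔ Occ Z b (i + 1) := by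
  rw [Occ, occ_succ, sub_right_comm]

theorem occ_self : Occ Z b n ↔ b ∈ Z := by
  rw [Occ, Fin.ofNat_self_eq_zero, sub_zero]

theorem sub_ofNat_succ_add_one (b : Fin n) (i : ℕ) :
    b - Fin.ofNat n (i + 1) + 1 = b - Fin.ofNat n i := by
  rw [Fin.ofNat_succ, ← sub_sub, sub_add_cancel]

theorem exists_sub_ofNat_eq (b x : Fin n) : ∃ i < n, b - Fin.ofNat n i = x :=
  ⟨(b - x).val, (b - x).isLt, by rw [Fin.ofNat_val_self, sub_sub_cancel]⟩

theorem sum_eq_sum_range_sub {A : Type*} [AddCommMonoid A] (b : Fin n) (g : Fin n → A) :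
    ∑ x, g x = ∑ i ∈ Finset.range n, g (b - Fin.ofNat n i) := by
  rw [Finset.sum_range, ← Equiv.sum_comp (Equiv.subLeft b) g]
  refine Finset.sum_congr rfl fun i _ => ?_
  rw [Equiv.subLeft_apply, Fin.ofNat_val_self]

/-- The configuration read counterclockwise from `b`. -/
def readWord (Z : Config n) (b : Fin n) : List Bool :=
  (List.range n).map fun i => decide (Occ Z b i)

theorem count_map_range (f : ℕ → Bool) (c : Bool) (r : ℕ) :
    ((List.range r).map f).count c = ∑ i ∈ Finset.range r, if f i = c then 1 else 0 := by
  induction r with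
  | zero => simp
  | succ r ih =>
    rw [List.range_succ, List.map_append, List.count_append, ih, Finset.sum_range_succ]
    simp [List.count_singleton]

theorem count_true_readWord (Z : Config n) (b : Fin n) : (readWord Z b).count true = Z.card := by
  rw [readWord, count_map_range]
  have := sum_eq_sum_range_sub b (fun x => if x ∈ Z then 1 else 0)
  simp only [Finset.sum_ite_mem, Finset.univ_inter, Finset.sum_const, smul_eq_mul, mul_one] at this
  rw [this]
  refine Finset.sum_congr rfl fun i _ => ?_
  by_cases h : Occ Z b i
  · rw [if_pos (decide_eq_true h)]
    exact (if_pos h).symm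
  · rw [if_neg (by simpa using h)]
    exact (if_neg h).symm

theorem count_false_readWord (Z : Config n) (b : Fin n) :
    (readWord Z b).count false = n - Z.card := by
  have h1 : (readWord Z b).length = n := by simp [readWord]
  have h2 := List.count_true_add_count_false (readWord Z b)
  rw [h1, count_true_readWord] at h2
  omega

/-- The `a` sites met first are occupied and later occupied sites are followed by holes. -/
def JamTail (Z : Config n) (b : Fin n) (a : ℕ) : Prop :=
  a < n ∧ (∀ i < a, Occ Z b i) ∧ ∀ i, a ≤ i → i < n → Occ Z b i → i + 1 < n ∧ ¬ Occ Z b (i + 1)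

/-- There is a single jam, of `m` particles, with its head at `b`. -/
def IsJam (Z : Config n) (b : Fin n) (m : ℕ) : Prop := 2 ≤ m ∧ JamTail Z b m ∧ ¬ Occ Z b m

/-- Site a may be occupied by a particle that has just caught up, so the jam has a or a + 1
particles; a run of length 1 is no jam. -/
theorem JamTail.isIdeal_or_isJam {a : ℕ} (h : JamTail Z b a) (ha : 1 ≤ a) :
    IsIdeal Z ∨ ∃ m, IsJam Z b m := by
  obtain ⟨h1, h2, h3⟩ := h
  by_cases h0 : Occ Z b a
  · obtain ⟨h4, h5⟩ := h3 a le_rfl h1 h0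
    refine Or.inr ⟨a + 1, by omega, ⟨h4, fun i hi => ?_, fun i hi => h3 i (by omega)⟩, h5⟩
    rcases Nat.lt_succ_iff_lt_or_eq.1 hi with h | rfl
    · exact h2 i h
    · exact h0
  · by_cases ha2 : 2 ≤ a
    · exact Or.inr ⟨a, ha2, ⟨h1, h2, h3⟩, h0⟩
    · left
      have ha1 : a = 1 := by omega
      subst ha1
      rw [isIdeal_iff]
      intro x hx hx1
      obtain ⟨i, hi, hix⟩ := exists_sub_ofNat_eq b (x + 1)
      have e1 : Occ Z b i := by rwa [Occ, hix]
      have e2 : Occ Z b (i + 1) := by rwa [occ_succ, hix, add_sub_cancel_right]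
      rcases Nat.eq_zero_or_pos i with rfl | hi0
      · exact h0 e2
      · exact (h3 i hi0 hi e1).2 e2

theorem IsJam.not_isIdeal (h : IsJam Z b m) : ¬ IsIdeal Z := by
  obtain ⟨h1, ⟨h2, h3, h4⟩, h5⟩ := h
  intro hI
  have e0 := h3 0 (by omega)
  have e1 := h3 1 (by omega)
  rw [occ_zero] at e0
  rw [occ_one] at e1
  exact isIdeal_iff.1 hI _ e1 (by simpa using e0)

theorem IsJam.add_one_notMem (h : IsJam Z b m) : b + 1 ∉ Z := by
  obtain ⟨h1, ⟨h2, h3, h4⟩, h5⟩ := h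
  intro hb
  have hn : n - 1 + 1 = n := by omega
  have e : b - Fin.ofNat n (n - 1) = b + 1 := by
    have := sub_ofNat_succ_add_one b (n - 1)
    rw [hn, Fin.ofNat_self_eq_zero, sub_zero] at this
    exact this.symm
  have := (h4 (n - 1) (by omega) (by omega) (by rwa [Occ, e])).1
  omega

/-- Makes the head well defined, so that functions defined through a chosen head can be evaluated at
any known one. -/
theorem IsJam.unique {b' : Fin n} {m' : ℕ} (h : IsJam Z b m) (h' : IsJam Z b' m') : b' = b := by
  have hb := h'.add_one_notMem
  obtain ⟨h1', ⟨h2', h3', h4'⟩, h5'⟩ := h'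
  have e0 := h3' 0 (by omega)
  have e1 := h3' 1 (by omega)
  rw [occ_zero] at e0
  rw [occ_one] at e1
  obtain ⟨h1, ⟨h2, h3, h4⟩, h5⟩ := h
  obtain ⟨i, hi, rfl⟩ := exists_sub_ofNat_eq b b'
  by_cases him : m ≤ i
  · refine absurd ?_ (h4 i him hi e0).2
    rwa [occ_succ]
  · rcases Nat.eq_zero_or_pos i with rfl | hi0
    · rw [Fin.ofNat_zero_eq_zero, sub_zero]
    · obtain ⟨j, rfl⟩ : ∃ j, i = j + 1 := ⟨i - 1, by omega⟩
      rw [sub_ofNat_succ_add_one] at hb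
      exact absurd (h3 j (by omega)) hb

theorem map_range_eq_replicate {f : ℕ → Bool} (h : ∀ i < m, f i = true) :
    (List.range m).map f = List.replicate m true := by
  refine List.eq_replicate_iff.2 ⟨by simp, fun c hc => ?_⟩
  obtain ⟨i, hi, rfl⟩ := List.mem_map.1 hc
  exact h i (List.mem_range.1 hi)

/-- The word behind the first hole behind the jam. -/
def jamRest (Z : Config n) (b : Fin n) (m : ℕ) : List Bool :=
  (List.range (n - m - 1)).map fun i => decide (Occ Z b (m + 1 + i))

theorem map_range_split (f : ℕ → Bool) {r : ℕ} (hn : n = m + 1 + r) :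
    (List.range n).map f = (List.range m).map f ++ f m ::
      (List.range r).map fun i => f (m + 1 + i) := by
  have : List.range n = List.range m ++ [m] ++ (List.range r).map (m + 1 + ·) := by
    rw [hn, List.range_add, List.range_succ]
  rw [this]
  simp [Function.comp_def]

theorem IsJam.readWord_eq (h : IsJam Z b m) :
    readWord Z b = List.replicate m true ++ false :: jamRest Z b m := by
  obtain ⟨h1, ⟨h2, h3, h4⟩, h5⟩ := h
  rw [readWord, map_range_split _ (show n = m + 1 + (n - m - 1) by omega), jamRest,
    map_range_eq_replicate fun i hi => by simpa using h3 i hi]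
  simp [h5]

theorem IsJam.count_true_rest (h : IsJam Z b m) : m + (jamRest Z b m).count true = Z.card := by
  rw [← count_true_readWord Z b, h.readWord_eq]
  simp [List.count_append]

theorem IsJam.count_false_rest (h : IsJam Z b m) :
    (jamRest Z b m).count false + 1 = n - Z.card := by
  rw [← count_false_readWord Z b, h.readWord_eq]
  simp [List.count_append, List.count_replicate]

/-- Apart from the head the step is deterministic: the other jam particles are blocked, and every
particle outside the jam is free. -/
theorem IsJam.mem_movers_iff (h : IsJam Z b m) (hM : FreeMoves Z M) {i : ℕ} (hi0 : 0 < i)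
    (hi : i < n) : b - Fin.ofNat n i ∈ M ↔ m < i ∧ Occ Z b i := by
  obtain ⟨h1, ⟨h2, h3, h4⟩, h5⟩ := h
  obtain ⟨j, rfl⟩ : ∃ j, i = j + 1 := ⟨i - 1, by omega⟩
  constructor
  · intro hm
    have hocc : Occ Z b (j + 1) := hM.1.1 hm
    have hr := hM.1.2 _ hm
    rw [sub_ofNat_succ_add_one] at hr
    refine ⟨?_, hocc⟩
    rcases lt_trichotomy m (j + 1) with hlt | rfl | hgt
    · exact hlt
    · exact absurd hocc h5
    · exact absurd (h3 j (by omega)) hr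
  · rintro ⟨hmi, hocc⟩
    refine hM.2 _ hocc ?_ ?_
    · rw [sub_ofNat_succ_add_one]
      intro hj
      exact (h4 j (by omega) (by omega) hj).2 hocc
    · rw [← occ_succ]
      exact (h4 (j + 1) (by omega) hi hocc).2

theorem occ_moveSet (i : ℕ) : Occ (moveSet Z M) b i ↔
    (Occ Z b i ∧ b - Fin.ofNat n i ∉ M) ∨ b - Fin.ofNat n (i + 1) ∈ M := by
  rw [Occ, mem_moveSet, Fin.ofNat_succ, ← sub_sub]
  rfl

theorem IsJam.occ_zero_moveSet (h : IsJam Z b m) (hM : FreeMoves Z M) :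
    Occ (moveSet Z M) b 0 ↔ b ∉ M := by
  obtain ⟨h1, ⟨h2, h3, h4⟩, h5⟩ := id h
  rw [occ_moveSet, h.mem_movers_iff hM (i := 0 + 1) (by omega) (by omega), Fin.ofNat_zero_eq_zero,
    sub_zero]
  have := h3 0 (by omega)
  constructor
  · rintro (h | h)
    · exact h.2
    · omega
  · exact fun h => Or.inl ⟨this, h⟩

theorem IsJam.occ_moveSet_of_lt (h : IsJam Z b m) (hM : FreeMoves Z M) {i : ℕ} (hi0 : 0 < i)
    (hi : i < m) : Occ (moveSet Z M) b i := by
  obtain ⟨h1, ⟨h2, h3, h4⟩, h5⟩ := id h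
  rw [occ_moveSet, h.mem_movers_iff hM hi0 (by omega)]
  exact Or.inl ⟨h3 i hi, by omega⟩

theorem IsJam.occ_moveSet_of_ge (h : IsJam Z b m) (hM : FreeMoves Z M) {i : ℕ} (hi0 : m ≤ i)
    (hi : i + 1 < n) : Occ (moveSet Z M) b i ↔ Occ Z b (i + 1) := by
  obtain ⟨h1, ⟨h2, h3, h4⟩, h5⟩ := id h
  rw [occ_moveSet, h.mem_movers_iff hM (by omega) (by omega), h.mem_movers_iff hM (by omega) hi]
  constructor
  · rintro (⟨h6, h7⟩ | h6)
    · rcases eq_or_lt_of_le hi0 with rfl | hlt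
      · exact absurd h6 h5
      · exact absurd ⟨hlt, h6⟩ h7
    · exact h6.2
  · exact fun h6 => Or.inr ⟨by omega, h6⟩

theorem IsJam.occ_moveSet_last (h : IsJam Z b m) {i : ℕ}
    (hi : i + 1 = n) : Occ (moveSet Z M) b i ↔ b ∈ M := by
  obtain ⟨h1, ⟨h2, h3, h4⟩, h5⟩ := id h
  rw [occ_moveSet, hi, Fin.ofNat_self_eq_zero, sub_zero]
  constructor
  · rintro (⟨h6, h7⟩ | h6)
    · have := (h4 i (by omega) (by omega) h6).1
      omega
    · exact h6
  · exact Or.inr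

theorem IsJam.jamTail_stay (h : IsJam Z b m) (hM : FreeMoves Z M) (hb : b ∉ M) :
    JamTail (moveSet Z M) b m := by
  obtain ⟨h1, ⟨h2, h3, h4⟩, h5⟩ := id h
  refine ⟨h2, fun i hi => ?_, fun i him hin hocc => ?_⟩
  · rcases Nat.eq_zero_or_pos i with rfl | hi0
    · exact (h.occ_zero_moveSet hM).2 hb
    · exact h.occ_moveSet_of_lt hM hi0 hi
  · by_cases hlast : i + 1 = n
    · exact absurd ((h.occ_moveSet_last hlast).1 hocc) hb
    · rw [h.occ_moveSet_of_ge hM him (by omega)] at hocc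
      obtain ⟨h6, h7⟩ := h4 (i + 1) (by omega) (by omega) hocc
      refine ⟨by omega, ?_⟩
      rwa [h.occ_moveSet_of_ge hM (by omega) h6]

theorem IsJam.jamTail_leave (h : IsJam Z b m) (hM : FreeMoves Z M) (hb : b ∈ M) :
    JamTail (moveSet Z M) (b - 1) (m - 1) := by
  obtain ⟨h1, ⟨h2, h3, h4⟩, h5⟩ := id h
  have hn : ¬ Occ (moveSet Z M) b n := by
    rw [occ_self, ← occ_zero (b := b), h.occ_zero_moveSet hM, not_not]
    exact hb
  refine ⟨by omega, fun i hi => ?_, fun i him hin hocc => ?_⟩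
  · rw [occ_sub_one]
    exact h.occ_moveSet_of_lt hM (by omega) (by omega)
  · rw [occ_sub_one] at hocc ⊢
    by_cases hlast : i + 1 = n
    · rw [hlast] at hocc
      exact absurd hocc hn
    · refine ⟨by omega, ?_⟩
      by_cases hlast2 : i + 1 + 1 = n
      · rwa [hlast2]
      · rw [h.occ_moveSet_of_ge hM (by omega) (by omega)] at hocc
        obtain ⟨h6, h7⟩ := h4 (i + 1 + 1) (by omega) (by omega) hocc
        rwa [h.occ_moveSet_of_ge hM (by omega) h6]

theorem IsJam.isJam_stay (h : IsJam Z b m) (hM : FreeMoves Z M) (hb : b ∉ M) :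
    ∃ m', IsJam (moveSet Z M) b m' := by
  obtain ⟨h1, ⟨h2, h3, h4⟩, h5⟩ := id h
  refine ((h.jamTail_stay hM hb).isIdeal_or_isJam (by omega)).resolve_left fun hI => ?_
  have e0 := (h.occ_zero_moveSet hM).2 hb
  have e1 := h.occ_moveSet_of_lt hM one_pos (by omega)
  rw [occ_zero] at e0
  rw [occ_one] at e1
  exact isIdeal_iff.1 hI _ e1 (by simpa using e0)

theorem IsJam.isIdeal_or_isJam_leave (h : IsJam Z b m) (hM : FreeMoves Z M) (hb : b ∈ M) :
    IsIdeal (moveSet Z M) ∨ ∃ m', IsJam (moveSet Z M) (b - 1) m' :=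
  (h.jamTail_leave hM hb).isIdeal_or_isJam (by have := h.1; omega)

/-- In the frame of the head, the particles behind the jam advance by one: the first hole is
consumed and a hole appears at the far end. -/
theorem IsJam.readWord_stay (h : IsJam Z b m) (hM : FreeMoves Z M) (hb : b ∉ M) :
    readWord (moveSet Z M) b = List.replicate m true ++ (jamRest Z b m ++ [false]) := by
  obtain ⟨h1, ⟨h2, h3, h4⟩, h5⟩ := id h
  obtain ⟨r, hr⟩ : ∃ r, n = m + r + 1 := ⟨n - m - 1, by omega⟩
  have e : List.range n = List.range m ++ (List.range r).map (m + ·) ++ [m + r] := by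
    rw [hr, List.range_succ, List.range_add]
  have e2 : n - m - 1 = r := by omega
  rw [readWord, e, jamRest, e2, List.map_append, List.map_append, List.append_assoc, List.map_map,
    map_range_eq_replicate fun i hi => decide_eq_true ((h.jamTail_stay hM hb).2.1 i hi)]
  congr 2
  · refine List.map_congr_left fun i hi => ?_
    rw [List.mem_range] at hi
    simp only [Function.comp_apply, decide_eq_decide]
    rw [h.occ_moveSet_of_ge hM (by omega) (by omega), add_right_comm]
  · simp only [List.map_cons, List.map_nil, h.occ_moveSet_last hr.symm, hb, decide_false]

/-- The frame moves to the new front b - 1. Read from there, the last two sites are b + 1, where the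
old head now sits, and the vacated site b. -/
theorem IsJam.readWord_leave (h : IsJam Z b m) (hM : FreeMoves Z M) (hb : b ∈ M) :
    readWord (moveSet Z M) (b - 1)
      = List.replicate (m - 1) true ++ (jamRest Z b m ++ [true, false]) := by
  obtain ⟨h1, ⟨h2, h3, h4⟩, h5⟩ := id h
  obtain ⟨r, hr⟩ : ∃ r, n = m + r + 1 := ⟨n - m - 1, by omega⟩
  have hn : ¬ Occ (moveSet Z M) b n := by
    rw [occ_self, ← occ_zero (b := b), h.occ_zero_moveSet hM, not_not]
    exact hb
  have e : List.range n = List.range (m - 1) ++ (List.range r).map (m - 1 + ·) ++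
      [m - 1 + r, m - 1 + r + 1] := by
    rw [show n = m - 1 + r + 1 + 1 by omega, List.range_succ, List.range_succ, List.range_add,
      List.append_assoc _ [m - 1 + r]]
    rfl
  have e2 : n - m - 1 = r := by omega
  rw [readWord, e, jamRest, e2, List.map_append, List.map_append, List.append_assoc, List.map_map,
    map_range_eq_replicate fun i hi => decide_eq_true ((h.jamTail_leave hM hb).2.1 i hi)]
  congr 2
  · refine List.map_congr_left fun i hi => ?_
    rw [List.mem_range] at hi
    simp only [Function.comp_apply, decide_eq_decide]
    rw [occ_sub_one, h.occ_moveSet_of_ge hM (by omega) (by omega)]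
    rw [show m - 1 + i + 1 + 1 = m + 1 + i by omega]
  · simp only [List.map_cons, List.map_nil, occ_sub_one]
    rw [show m - 1 + r + 1 + 1 = n by omega]
    simp only [hn, decide_false, h.occ_moveSet_last (show m - 1 + r + 1 + 1 = n by omega), hb,
      decide_true]

/-- Only the jam falls short of hop probability 1: by 1 - p at its head and by 1 at each of the m -
1 blocked particles. -/
theorem IsJam.sum_hopProb (h : IsJam Z b m) (p : ℝ) :
    ∑ x ∈ Z, hopProb p 1 Z x = p + (jamRest Z b m).count true := by
  have hb := h.add_one_notMem
  have hcard := h.count_true_rest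
  obtain ⟨h1, ⟨h2, h3, h4⟩, h5⟩ := id h
  have e : ∑ x ∈ Z, (1 - hopProb p 1 Z x) = (1 - p) + (m - 1 : ℕ) := by
    have e1 : ∑ x ∈ Z, (1 - hopProb p 1 Z x) = ∑ x, if x ∈ Z then 1 - hopProb p 1 Z x else 0 := by
      rw [Finset.sum_ite_mem, Finset.univ_inter]
    rw [e1, sum_eq_sum_range_sub b]
    have e2 : ∀ i ∈ Finset.range n, (if b - Fin.ofNat n i ∈ Z then
        1 - hopProb p 1 Z (b - Fin.ofNat n i) else 0)
        = if i < m then (if i = 0 then 1 - p else 1) else 0 := by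
      intro i hi
      rw [Finset.mem_range] at hi
      rcases Nat.eq_zero_or_pos i with rfl | hi0
      · have o0 := h3 0 (by omega)
        have o1 := h3 1 (by omega)
        rw [occ_zero] at o0
        rw [occ_one] at o1
        rw [Fin.ofNat_zero_eq_zero, sub_zero, if_pos o0, if_pos (by omega), if_pos rfl, hopProb_eq,
          if_neg hb, if_pos o1]
      · obtain ⟨j, rfl⟩ : ∃ j, i = j + 1 := ⟨i - 1, by omega⟩
        by_cases him : j + 1 < m
        · have o1 : b - Fin.ofNat n (j + 1) ∈ Z := h3 _ him
          have o2 : b - Fin.ofNat n j ∈ Z := h3 _ (by omega)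
          rw [if_pos o1, if_pos him, if_neg (by omega), hopProb_eq, sub_ofNat_succ_add_one,
            if_pos o2, sub_zero]
        · rw [if_neg him]
          split_ifs with o1
          · have o1' : Occ Z b (j + 1) := o1
            have hne : j + 1 ≠ m := fun hjm => h5 (hjm ▸ o1')
            have o2 : ¬ (b - Fin.ofNat n (j + 1) - 1 ∈ Z) := by
              rw [← occ_succ]
              exact (h4 (j + 1) (by omega) hi o1').2
            have o3 : ¬ (b - Fin.ofNat n j ∈ Z) := fun o3 =>
              (h4 j (by omega) (by omega) o3).2 o1'
            rw [hopProb_eq, sub_ofNat_succ_add_one, if_neg o3, if_neg o2, sub_self]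
          · rfl
    rw [Finset.sum_congr rfl e2, ← Finset.sum_filter]
    have e3 : (Finset.range n).filter (· < m) = Finset.range (m - 1 + 1) := by
      ext i
      simp only [Finset.mem_filter, Finset.mem_range]
      omega
    rw [e3, Finset.sum_range_succ']
    simp
    ring
  rw [Finset.sum_sub_distrib, Finset.sum_const, nsmul_eq_mul, mul_one, ← hcard] at e
  rw [Nat.cast_sub (by omega)] at e
  push_cast at e
  linarith

end Jam

/-! ## At most one jam under a stationary distribution -/

section OneJam

variable {n : ℕ} [NeZero n] {Z M W : Config n} {b x y : Fin n} {p lam : ℝ}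

theorem sub_ofNat_injOn {i j : ℕ} (hi : i < n) (hj : j < n)
    (h : b - Fin.ofNat n i = b - Fin.ofNat n j) : i = j := by
  have := congrArg Fin.val (sub_right_injective h)
  simpa [Nat.mod_eq_of_lt hi, Nat.mod_eq_of_lt hj] using this

theorem sub_ofNat_eq_add_one {i : ℕ} (hi : i + 1 = n) : b - Fin.ofNat n i = b + 1 := by
  have := sub_ofNat_succ_add_one b i
  rw [hi, Fin.ofNat_self_eq_zero, sub_zero] at this
  exact this.symm

/-- At most one jam, and every particle outside it is free. -/
def AtMostOneJam (Z : Config n) : Prop := IsIdeal Z ∨ ∃ b m, IsJam Z b m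

theorem jamTail_insert (hW : IsIdeal W) {a : ℕ} (ha : a + 1 < n) (hb : b + 1 ∉ W)
    (hocc : ∀ i ≤ a, Occ (insert (b - Fin.ofNat n a) W) b i) :
    JamTail (insert (b - Fin.ofNat n a) W) b (a + 1) := by
  refine ⟨ha, fun i hi => hocc i (by omega), fun i hai hi h => ?_⟩
  have h1 : b - Fin.ofNat n i ∈ W := by
    rcases Finset.mem_insert.1 h with h | h
    · have := sub_ofNat_injOn hi (by omega) h
      omega
    · exact h
  have hlast : i + 1 ≠ n := fun hlast => hb (sub_ofNat_eq_add_one hlast ▸ h1)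
  refine ⟨by omega, fun h2 => ?_⟩
  rcases Finset.mem_insert.1 h2 with h2 | h2
  · have := sub_ofNat_injOn (i := i + 1) (by omega) (by omega) h2
    omega
  · refine isIdeal_iff.1 hW _ h2 ?_
    rwa [sub_ofNat_succ_add_one]

theorem IsIdeal.erase (hZ : IsIdeal Z) (x : Fin n) : IsIdeal (Z.erase x) :=
  isIdeal_iff.2 fun i hi h =>
    isIdeal_iff.1 hZ i (Finset.mem_of_mem_erase hi) (Finset.mem_of_mem_erase h)

/-- A particle put into an ideal configuration can touch at most its two neighbours. The front of
the resulting run is y + 1 if that site is occupied, and y otherwise. -/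
theorem IsIdeal.atMostOneJam_insert (hn : 3 ≤ n) (hW : IsIdeal W) (y : Fin n) :
    AtMostOneJam (insert y W) := by
  by_cases h : y + 1 ∈ W
  · have e : y = y + 1 - Fin.ofNat n 1 := by
      rw [show (1 : ℕ) = 0 + 1 from rfl, Fin.ofNat_succ, Fin.ofNat_zero_eq_zero, zero_add,
        add_sub_cancel_right]
    have h1 : JamTail (insert y W) (y + 1) 2 := by
      have := jamTail_insert (b := y + 1) (a := 1) hW (by omega) (isIdeal_iff.1 hW _ h)
      rw [← e] at this
      refine this fun i hi => ?_
      rcases Nat.eq_zero_or_pos i with rfl | hi0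
      · rw [occ_zero]
        exact Finset.mem_insert_of_mem h
      · rw [show i = 1 by omega, occ_one, add_sub_cancel_right]
        exact Finset.mem_insert_self _ _
    rcases h1.isIdeal_or_isJam (by omega) with h | ⟨m, hm⟩
    · exact Or.inl h
    · exact Or.inr ⟨_, m, hm⟩
  · have h1 : JamTail (insert y W) y 1 := by
      have := jamTail_insert (b := y) (a := 0) hW (by omega) h
      rw [Fin.ofNat_zero_eq_zero, sub_zero] at this
      refine this fun i hi => ?_
      rw [Nat.le_zero.1 hi, occ_zero]
      exact Finset.mem_insert_self _ _
    rcases h1.isIdeal_or_isJam (by omega) with h | ⟨m, hm⟩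
    · exact Or.inl h
    · exact Or.inr ⟨_, m, hm⟩

theorem FreeMoves.atMostOneJam_moveSet (hM : FreeMoves Z M) (hZ : AtMostOneJam Z) :
    AtMostOneJam (moveSet Z M) := by
  rcases hZ with hI | ⟨b, m, hJ⟩
  · exact Or.inl (hM.isIdeal_moveSet hI)
  · by_cases hb : b ∈ M
    · rcases hJ.isIdeal_or_isJam_leave hM hb with h | ⟨m', h⟩
      · exact Or.inl h
      · exact Or.inr ⟨_, m', h⟩
    · obtain ⟨m', h⟩ := hJ.isJam_stay hM hb
      exact Or.inr ⟨_, m', h⟩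

theorem AtMostOneJam.step (hn : 3 ≤ n) {Z' : Config n} (hZ : AtMostOneJam Z)
    (h : aStepProb p lam Z Z' ≠ 0) : AtMostOneJam Z' := by
  obtain ⟨Y, h1, h2⟩ := aStepProb_ne_zero h
  obtain ⟨M, hM, hne, rfl⟩ := exists_movers_of_stepProb_ne_zero h1
  have hY := (freeMoves_of_moversProb_ne_zero hM hne).atMostOneJam_moveSet hZ
  rcases afterProb_ne_zero h2 with rfl | ⟨hI, x, _, y, _, rfl⟩
  · exact hY
  · exact (hI.erase x).atMostOneJam_insert hn y

/-- The front particle of a jam. -/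
def JamHead (Z : Config n) (x : Fin n) : Prop := x ∈ Z ∧ x + 1 ∉ Z ∧ x - 1 ∈ Z

theorem exists_jamHead (hI : ¬ IsIdeal Z) (hZ : Z ≠ Finset.univ) : ∃ x, JamHead Z x := by
  rw [isIdeal_iff] at hI
  push Not at hI
  obtain ⟨i, hi, hi1⟩ := hI
  by_contra hcon
  simp only [JamHead, not_exists, not_and] at hcon
  have key : ∀ j : ℕ, i + Fin.ofNat n j ∈ Z ∧ i + Fin.ofNat n j + 1 ∈ Z := by
    intro j
    induction j with
    | zero =>
      rw [Fin.ofNat_zero_eq_zero, add_zero]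
      exact ⟨hi, hi1⟩
    | succ j ih =>
      rw [Fin.ofNat_succ, ← add_assoc]
      refine ⟨ih.2, ?_⟩
      by_contra hne
      exact hcon _ ih.2 hne (by simpa using ih.1)
  apply hZ
  ext z
  have := (key (z - i).val).1
  rw [Fin.ofNat_val_self, add_sub_cancel] at this
  simp [this]

theorem JamHead.not_isIdeal (h : JamHead Z x) : ¬ IsIdeal Z := fun hI =>
  isIdeal_iff.1 hI _ h.2.2 (by simpa using h.1)

theorem JamHead.moveSet (h : JamHead Z x) (hM : Movable Z M) (hx : x ∉ M) :
    JamHead (moveSet Z M) x := by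
  refine ⟨?_, ?_, ?_⟩
  · exact mem_moveSet.2 (Or.inl ⟨h.1, hx⟩)
  · rw [mem_moveSet, add_sub_cancel_right]
    rintro (h1 | h1)
    · exact h.2.1 h1.1
    · exact hx h1
  · exact mem_moveSet.2 (Or.inl ⟨h.2.2, fun h1 => hM.2 _ h1 (by simpa using h.1)⟩)

theorem JamHead.freeMoves (h : JamHead Z x) : FreeMoves Z ((heads Z).erase x) := by
  refine ⟨⟨(Finset.erase_subset _ _).trans (freeMoves_heads Z).1.1, fun i hi =>
    (freeMoves_heads Z).1.2 i (Finset.mem_of_mem_erase hi)⟩, fun i hi h1 h2 => ?_⟩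
  refine Finset.mem_erase.2 ⟨?_, (freeMoves_heads Z).2 i hi h1 h2⟩
  rintro rfl
  exact h2 h.2.2

theorem Movable.sum_moveSet (hM : Movable Z M) (g : Fin n → ℕ) :
    ∑ z ∈ moveSet Z M, g z = ∑ z ∈ Z \ M, g z + ∑ z ∈ M, g (z + 1) := by
  have hd : Disjoint (Z \ M) (M.map (finRotate n).toEmbedding) := by
    rw [Finset.disjoint_left]
    intro x hx hx'
    simp only [Finset.mem_map, Equiv.coe_toEmbedding, finRotate_eq_add_one] at hx'
    obtain ⟨a, ha, rfl⟩ := hx'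
    exact hM.2 a ha (Finset.mem_sdiff.1 hx).1
  simp [_root_.moveSet, Finset.sum_union hd]

theorem Movable.sum_sub_lt (hM : Movable Z M) (hx : x ∉ M) (hne : M.Nonempty) :
    ∑ z ∈ moveSet Z M, (x - z).val < ∑ z ∈ Z, (x - z).val := by
  rw [hM.sum_moveSet, ← Finset.sum_sdiff hM.1]
  refine Nat.add_lt_add_left (Finset.sum_lt_sum_of_nonempty hne fun z hz => ?_) _
  have h : x - z ≠ 0 := fun h => hx (by rwa [sub_eq_zero.1 h])
  have h0 : (x - z).val ≠ 0 := fun h' => h (Fin.ext h')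
  obtain ⟨j, hj⟩ : ∃ j, (x - z).val = j + 1 := ⟨(x - z).val - 1, by omega⟩
  have h1 : x - z = Fin.ofNat n j + 1 := by rw [← Fin.ofNat_val_self (x - z), hj, Fin.ofNat_succ]
  have h2 : x - (z + 1) = Fin.ofNat n j := by rw [← sub_sub, h1, add_sub_cancel_right]
  rw [h2, hj]
  exact Nat.lt_succ_of_le (Nat.mod_le _ _)

/-- If no particle other than x has a hole in front, occupation propagates forward up to x, so all
particles form one block with front x. -/
theorem JamHead.isJam (h : JamHead Z x) (hh : (heads Z).erase x = ∅) : ∃ m, IsJam Z x m := by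
  have hdown : ∀ i, i + 1 < n → Occ Z x (i + 1) → Occ Z x i := by
    intro i hi hocc
    by_contra hne
    have hmem : x - Fin.ofNat n (i + 1) ∈ (heads Z).erase x := by
      refine Finset.mem_erase.2 ⟨fun heq => ?_, Finset.mem_filter.2 ⟨hocc, ?_⟩⟩
      · have := sub_ofNat_injOn (b := x) (i := i + 1) (j := 0) hi (by omega)
          (by rw [heq, Fin.ofNat_zero_eq_zero, sub_zero])
        omega
      · rwa [sub_ofNat_succ_add_one]
    rw [hh] at hmem
    exact absurd hmem (Finset.notMem_empty _)
  have hex : ∃ i, ¬ Occ Z x i := by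
    obtain ⟨i, _, hi⟩ := exists_sub_ofNat_eq x (x + 1)
    exact ⟨i, by rw [Occ, hi]; exact h.2.1⟩
  have hlt : Nat.find hex < n := by
    obtain ⟨i, hin, hi⟩ := exists_sub_ofNat_eq x (x + 1)
    exact lt_of_le_of_lt (Nat.find_min' hex (by rw [Occ, hi]; exact h.2.1)) hin
  have hspec := Nat.find_spec hex
  have hmin : ∀ i < Nat.find hex, Occ Z x i := fun i hi => not_not.1 (Nat.find_min hex hi)
  set a := Nat.find hex
  refine ⟨a, ?_, ⟨hlt, hmin, fun i hai hin hocc => ?_⟩, hspec⟩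
  · by_contra ha
    have : a = 0 ∨ a = 1 := by omega
    rcases this with h0 | h0
    · rw [h0, occ_zero] at hspec
      exact hspec h.1
    · rw [h0, occ_one] at hspec
      exact hspec h.2.2
  · exfalso
    have : ∀ j, a + j < n → ¬ Occ Z x (a + j) := by
      intro j
      induction j with
      | zero => exact fun _ => hspec
      | succ j ih => exact fun hj ho => ih (by omega) (hdown _ hj ho)
    obtain ⟨j, rfl⟩ := Nat.exists_eq_add_of_le hai
    exact this j hin hocc

theorem aStepProb_ne_zero_of_freeMoves (hp0 : 0 < p) (hp1 : p < 1) (hlam : 0 ≤ lam)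
    (hM : FreeMoves Z M) (hI : ¬ IsIdeal (moveSet Z M)) : aStepProb p lam Z (moveSet Z M) ≠ 0 := by
  refine (Finset.sum_pos' (fun Y _ => mul_nonneg
    (stepProb_nonneg hp0.le hp1.le zero_le_one le_rfl Z Y) (afterProb_nonneg hlam Y _))
    ⟨moveSet Z M, Finset.mem_univ _, ?_⟩).ne'
  rw [afterProb, if_neg hI, if_pos rfl, mul_one]
  exact lt_of_le_of_ne (stepProb_nonneg hp0.le hp1.le zero_le_one le_rfl _ _)
    (stepProb_ne_zero_of_freeMoves hp0 hp1 hM).symm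

/-- The class is closed, so it remains to reach it. Freeze the head x of some jam and move all other
heads: the summed distance to x falls until x alone can move. The frozen jam keeps the configuration
non-ideal, so no perturbation interferes. -/
theorem IsStationaryDist.atMostOneJam {k : ℕ} {μ : Config n → ℝ} (hp0 : 0 < p) (hp1 : p < 1)
    (hlam : 0 ≤ lam) (hn : 3 ≤ n) (hk0 : 0 < k) (hkn : k < n)
    (hμ : IsStationaryDist k (aStepProb p lam) μ) (hZ : μ Z ≠ 0) : AtMostOneJam Z := by
  classical
  refine hμ.mem_of_ne_zero (aStepProb_nonneg hp0.le hp1.le hlam)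
    (fun Z hZ => sum_aStepProb hp0.le hp1.le (Finset.card_pos.1 (hZ ▸ hk0)))
    (fun _ _ h h' => h.step hn h') (fun Z hZk => ?_) hZ
  by_cases hI : IsIdeal Z
  · exact ⟨Z, Relation.ReflTransGen.refl, Or.inl hI⟩
  obtain ⟨x, hx⟩ := exists_jamHead hI (by
    rintro rfl
    rw [Finset.card_univ, Fintype.card_fin] at hZk
    omega)
  set R := Finset.univ.filter fun Y => Relation.ReflTransGen
    (fun Y Y' : Config n => aStepProb p lam Y Y' ≠ 0) Z Y ∧ JamHead Y x
  obtain ⟨Y, hY, hmin⟩ := R.exists_min_image (fun Y => ∑ z ∈ Y, (x - z).val)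
    ⟨Z, Finset.mem_filter.2 ⟨Finset.mem_univ _, Relation.ReflTransGen.refl, hx⟩⟩
  obtain ⟨hYr, hYx⟩ := (Finset.mem_filter.1 hY).2
  refine ⟨Y, hYr, Or.inr ⟨x, hYx.isJam ?_⟩⟩
  by_contra hne
  have hM := hYx.freeMoves
  have hhead := hYx.moveSet hM.1 (Finset.notMem_erase x _)
  have hmem : moveSet Y ((heads Y).erase x) ∈ R := Finset.mem_filter.2 ⟨Finset.mem_univ _,
    hYr.tail (aStepProb_ne_zero_of_freeMoves hp0 hp1 hlam hM hhead.not_isIdeal), hhead⟩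
  exact absurd (hmin _ hmem) (not_le.2 (hM.1.sum_sub_lt (Finset.notMem_erase x _)
    (Finset.nonempty_iff_ne_empty.2 hne)))

end OneJam

/-! ## Rarity of ideal configurations at high density -/

section HighDensity

variable {n k : ℕ} [NeZero n] {Z M : Config n} {b : Fin n} {m : ℕ} {p lam θ β : ℝ}

open Classical in
/-- The potential of a configuration: the word sum read from the head of its jam, truncated. -/
noncomputable def jamPot (θ β : ℝ) (Z : Config n) : ℝ :=
  if h : ∃ b m, IsJam Z b m then min (jamSum θ β (readWord Z h.choose)) (Real.exp (-θ))
  else Real.exp (-θ)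

theorem IsJam.choose_eq (h : IsJam Z b m) (h' : ∃ b m, IsJam Z b m) : h'.choose = b := by
  obtain ⟨m', hm'⟩ := h'.choose_spec
  exact h.unique hm'

theorem IsJam.jamPot_eq (h : IsJam Z b m) :
    jamPot θ β Z = min (jamSum θ β (readWord Z b)) (Real.exp (-θ)) := by
  have h' : ∃ b m, IsJam Z b m := ⟨b, m, h⟩
  rw [jamPot, dif_pos h', h.choose_eq h']

theorem IsIdeal.jamPot_eq (h : IsIdeal Z) : jamPot θ β Z = Real.exp (-θ) := by
  rw [jamPot, dif_neg]
  rintro ⟨b, m, hJ⟩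
  exact hJ.not_isIdeal h

theorem jamPot_le (Z : Config n) : jamPot θ β Z ≤ Real.exp (-θ) := by
  rw [jamPot]
  split_ifs
  · exact min_le_right _ _
  · exact le_rfl

/-- When a jam dissolves, the word read from its last front starts with a particle and a hole, and
that hole alone contributes exp (-θ). This is why the potential is truncated there. -/
theorem le_jamSum_readWord (hn : 2 ≤ n) (h0 : Occ Z b 0) (h1 : ¬ Occ Z b 1) :
    Real.exp (-θ) ≤ jamSum θ β (readWord Z b) := by
  rw [readWord, map_range_split _ (show n = 1 + 1 + (n - 2) by omega), List.range_one]
  simp only [List.map_cons, List.map_nil, h0, h1, decide_true, decide_false, List.singleton_append,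
    jamSum]
  have := jamSum_nonneg θ β ((List.range (n - 2)).map fun i => decide (Occ Z b (1 + 1 + i)))
  have h2 : 0 ≤ Real.exp (-θ) * (Real.exp (θ * β) *
      jamSum θ β ((List.range (n - 2)).map fun i => decide (Occ Z b (1 + 1 + i)))) := by positivity
  linarith

theorem IsJam.jamWeight_eq (h : IsJam Z b m) (hZ : Z.card = k) :
    jamWeight θ β (List.replicate m true ++ jamRest Z b m)
      = Real.exp (-θ * k + θ * β * (n - k - 1 : ℕ)) := by
  have h1 := h.count_true_rest
  have h2 := h.count_false_rest
  rw [hZ] at h1 h2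
  rw [jamWeight, List.count_append, List.count_append, List.count_replicate_self, h1,
    List.count_replicate, if_neg (by simp), zero_add]
  rw [show n - k - 1 = (jamRest Z b m).count false by omega]

theorem IsJam.jamSum_stay_le (h : IsJam Z b m) (hZ : Z.card = k) (hM : FreeMoves Z M)
    (hb : b ∉ M) : jamSum θ β (readWord (moveSet Z M) b)
      ≤ Real.exp (-θ * β) * jamSum θ β (readWord Z b)
        + Real.exp (-θ * k + θ * β * (n - k - 1 : ℕ)) := by
  rw [h.readWord_stay hM hb, h.readWord_eq, ← h.jamWeight_eq hZ]
  exact _root_.jamSum_stay_le _ _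

theorem IsJam.jamSum_leave_le (h : IsJam Z b m) (hZ : Z.card = k) (hM : FreeMoves Z M)
    (hb : b ∈ M) : jamSum θ β (readWord (moveSet Z M) (b - 1))
      ≤ Real.exp (θ * (1 - β)) * jamSum θ β (readWord Z b)
        + Real.exp (-θ * k + θ * β * (n - k - 1 : ℕ)) := by
  rw [h.readWord_leave hM hb, h.readWord_eq, ← h.jamWeight_eq hZ]
  obtain ⟨m', rfl⟩ : ∃ m', m = m' + 1 := ⟨m - 1, by have := h.1; omega⟩
  exact _root_.jamSum_leave_le _ _

theorem IsJam.jamPot_leave_le (h : IsJam Z b m) (hM : FreeMoves Z M) (hb : b ∈ M) :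
    jamPot θ β (moveSet Z M) ≤ jamSum θ β (readWord (moveSet Z M) (b - 1)) := by
  rcases h.isIdeal_or_isJam_leave hM hb with hI | ⟨m', hJ⟩
  · rw [hI.jamPot_eq]
    have h0 := (h.jamTail_leave hM hb).2.1 0 (by have := h.1; omega)
    refine le_jamSum_readWord (by have := h.1; have := h.2.1.1; omega) h0 ?_
    rw [occ_zero] at h0
    rw [occ_one]
    exact fun h1 => isIdeal_iff.1 hI _ h1 (by simpa using h0)
  · rw [hJ.jamPot_eq]
    exact min_le_left _ _

/-- One step of the perturbed chain applied to a function. -/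
noncomputable def aStepExp (p lam : ℝ) (f : Config n → ℝ) (Z : Config n) : ℝ :=
  ∑ Z', aStepProb p lam Z Z' * f Z'

theorem aStepExp_mono (hp0 : 0 ≤ p) (hp1 : p ≤ 1) (hlam : 0 ≤ lam) {f g : Config n → ℝ}
    (h : ∀ Z', aStepProb p lam Z Z' ≠ 0 → f Z' ≤ g Z') :
    aStepExp p lam f Z ≤ aStepExp p lam g Z := by
  refine Finset.sum_le_sum fun Z' _ => ?_
  by_cases h0 : aStepProb p lam Z Z' = 0
  · simp [h0]
  · exact mul_le_mul_of_nonneg_left (h Z' h0) (aStepProb_nonneg hp0 hp1 hlam Z Z')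

theorem aStepExp_add_const (hp0 : 0 ≤ p) (hp1 : p ≤ 1) (hZ : Z.Nonempty) (f : Config n → ℝ)
    (c : ℝ) : aStepExp p lam (fun Y => f Y + c) Z = aStepExp p lam f Z + c := by
  simp only [aStepExp, mul_add, Finset.sum_add_distrib]
  rw [← Finset.sum_mul, sum_aStepProb hp0 hp1 hZ, one_mul]

theorem aStepExp_le (hp0 : 0 ≤ p) (hp1 : p ≤ 1) (hlam : 0 ≤ lam) (hZ : Z.Nonempty)
    {f : Config n → ℝ} {c : ℝ} (h : ∀ Z', Z'.card = Z.card → f Z' ≤ c) :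
    aStepExp p lam f Z ≤ c := by
  refine (aStepExp_mono hp0 hp1 hlam (g := fun _ => c) fun Z' h' =>
    h Z' (card_eq_of_aStepProb_ne_zero h')).trans ?_
  simp only [aStepExp]
  rw [← Finset.sum_mul, sum_aStepProb hp0 hp1 hZ, one_mul]

theorem iterate_aStepExp_le (hp0 : 0 ≤ p) (hp1 : p ≤ 1) (hlam : 0 ≤ lam) (hk : 0 < k) (j : ℕ) :
    ∀ Z : Config n, Z.card = k → (aStepExp p lam)^[j] (jamPot θ β) Z ≤ Real.exp (-θ) := by
  induction j with
  | zero => exact fun Z _ => jamPot_le Z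
  | succ j ih =>
    intro Z hZ
    rw [Function.iterate_succ_apply']
    exact aStepExp_le hp0 hp1 hlam (Finset.card_pos.1 (hZ ▸ hk)) fun Z' hZ' => ih Z' (hZ'.trans hZ)

theorem afterExp_le_of_le (hlam : 0 ≤ lam) (hZ : Z.Nonempty) {f : Config n → ℝ} {c : ℝ}
    (h : ∀ Z', Z'.card = Z.card → f Z' ≤ c) : afterExp lam f Z ≤ c := by
  have h1 := perturbRate_nonneg hlam n
  have h2 := perturbRate_le_one lam n
  have h3 : relocExp f Z ≤ c := relocExp_le hZ fun x hx y hy => h _ (card_relocate hx hy)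
  have h4 := h Z rfl
  rw [afterExp]
  split_ifs
  · nlinarith
  · exact h4

/-- Perturbations act only on ideal configurations, where the potential already has its largest
value. -/
theorem afterExp_jamPot_le (hlam : 0 ≤ lam) (hZ : Z.Nonempty) :
    afterExp lam (jamPot θ β) Z ≤ jamPot θ β Z := by
  by_cases hI : IsIdeal Z
  · rw [hI.jamPot_eq]
    exact afterExp_le_of_le hlam hZ fun Z' _ => jamPot_le Z'
  · rw [afterExp, if_neg hI]

theorem IsJam.hopProb_head (h : IsJam Z b m) : hopProb p 1 Z b = p := by
  have h1 := h.2.1.2.1 1 (by have := h.1; omega)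
  rw [occ_one] at h1
  rw [hopProb_eq, if_neg h.add_one_notMem, if_pos h1]

theorem IsJam.mem (h : IsJam Z b m) : b ∈ Z :=
  occ_zero.1 (h.2.1.2.1 0 (by have := h.1; omega))

theorem aStepExp_eq (p lam : ℝ) (f : Config n → ℝ) (Z : Config n) :
    aStepExp p lam f Z = moverExp p 1 Z (fun M => afterExp lam f (moveSet Z M)) :=
  sum_aStepProb_mul p lam Z f

/-- Supermartingale property up to an exponentially small error: the head stays with probability 1 -
p and leaves with probability p, and `hκ` says that the two factors average to at most 1. -/
theorem aStepExp_jamPot_le (hp0 : 0 ≤ p) (hp1 : p ≤ 1) (hlam : 0 ≤ lam) (hk : 0 < k)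
    (hκ : (1 - p) * Real.exp (-θ * β) + p * Real.exp (θ * (1 - β)) ≤ 1)
    (hD : AtMostOneJam Z) (hZ : Z.card = k) :
    aStepExp p lam (jamPot θ β) Z
      ≤ jamPot θ β Z + Real.exp (-θ * k + θ * β * (n - k - 1 : ℕ)) := by
  set δ := Real.exp (-θ * k + θ * β * (n - k - 1 : ℕ))
  have hδ : 0 < δ := Real.exp_pos _
  have hne : Z.Nonempty := Finset.card_pos.1 (hZ ▸ hk)
  have hle : aStepExp p lam (jamPot θ β) Z ≤ Real.exp (-θ) :=
    aStepExp_le hp0 hp1 hlam hne fun Z' _ => jamPot_le Z'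
  rcases hD with hI | ⟨b, m, hJ⟩
  · rw [hI.jamPot_eq]
    linarith
  · rw [hJ.jamPot_eq, ← min_add_add_right]
    refine le_min ?_ (by linarith)
    rw [aStepExp_eq]
    set S := jamSum θ β (readWord Z b)
    have hS : 0 ≤ S := jamSum_nonneg _ _ _
    have h1 : moverExp p 1 Z (fun M => afterExp lam (jamPot θ β) (moveSet Z M))
        ≤ moverExp p 1 Z (fun M => if b ∈ M then Real.exp (θ * (1 - β)) * S + δ
            else Real.exp (-θ * β) * S + δ) := by
      refine moverExp_one_mono hp0 hp1 fun M hM => ?_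
      refine (afterExp_jamPot_le hlam (hM.1.nonempty_moveSet hne)).trans ?_
      split_ifs with hb
      · exact (hJ.jamPot_leave_le hM hb).trans (hJ.jamSum_leave_le hZ hM hb)
      · obtain ⟨m', hJ'⟩ := hJ.isJam_stay hM hb
        rw [hJ'.jamPot_eq]
        exact (min_le_left _ _).trans (hJ.jamSum_stay_le hZ hM hb)
    rw [moverExp_ite_mem p 1 hJ.mem, hJ.hopProb_head] at h1
    have h2 := mul_le_mul_of_nonneg_right hκ hS
    linarith

theorem iterate_aStepExp_jamPot_le (hp0 : 0 ≤ p) (hp1 : p ≤ 1) (hlam : 0 ≤ lam) (hn : 3 ≤ n)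
    (hk : 0 < k) (hκ : (1 - p) * Real.exp (-θ * β) + p * Real.exp (θ * (1 - β)) ≤ 1) (j : ℕ) :
    ∀ Z : Config n, AtMostOneJam Z → Z.card = k → (aStepExp p lam)^[j] (jamPot θ β) Z
      ≤ jamPot θ β Z + j * Real.exp (-θ * k + θ * β * (n - k - 1 : ℕ)) := by
  induction j with
  | zero =>
    intro Z _ _
    simp
  | succ j ih =>
    intro Z hD hZ
    rw [Function.iterate_succ_apply']
    refine (aStepExp_mono hp0 hp1 hlam fun Z' h' => ih Z' (hD.step hn h')
      ((card_eq_of_aStepProb_ne_zero h').trans hZ)).trans ?_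
    rw [aStepExp_add_const hp0 hp1 (Finset.card_pos.1 (hZ ▸ hk))]
    have := aStepExp_jamPot_le hp0 hp1 hlam hk hκ hD hZ
    push_cast
    linarith

/-- While its head stays, a jam contracts the potential. -/
theorem IsJam.iterate_aStepExp_le (hp0 : 0 ≤ p) (hp1 : p ≤ 1) (hlam : 0 ≤ lam) (hθ : 0 ≤ θ)
    (hβ : 0 ≤ β) (hk : 0 < k) (j : ℕ) : ∀ (Z : Config n) (b : Fin n) (m : ℕ), IsJam Z b m →
      Z.card = k → (aStepExp p lam)^[j] (jamPot θ β) Z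
      ≤ (1 - (1 - p) ^ j) * Real.exp (-θ) + (1 - p) ^ j * (Real.exp (-θ * β) ^ j *
        jamSum θ β (readWord Z b) + j * Real.exp (-θ * k + θ * β * (n - k - 1 : ℕ))) := by
  set δ := Real.exp (-θ * k + θ * β * (n - k - 1 : ℕ))
  have hδ : 0 < δ := Real.exp_pos _
  have he1 : Real.exp (-θ * β) ≤ 1 := by
    rw [Real.exp_le_one_iff]
    nlinarith
  have hq : 0 ≤ 1 - p := by linarith
  set E := Real.exp (-θ * β)
  have hE : 0 < E := Real.exp_pos _
  induction j with
  | zero =>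
    intro Z b m hJ _
    simp [hJ.jamPot_eq]
  | succ j ih =>
    intro Z b m hJ hZ
    have hne : Z.Nonempty := Finset.card_pos.1 (hZ ▸ hk)
    rw [Function.iterate_succ_apply', aStepExp_eq]
    set S := jamSum θ β (readWord Z b)
    -- If the head leaves, only the trivial bound exp (-θ) is kept; this is why the contraction
    -- carries the factor (1 - p) ^ j.
    have h1 : moverExp p 1 Z (fun M =>
          afterExp lam ((aStepExp p lam)^[j] (jamPot θ β)) (moveSet Z M))
        ≤ moverExp p 1 Z (fun M => if b ∈ M then Real.exp (-θ) else
            (1 - (1 - p) ^ j) * Real.exp (-θ) +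
              (1 - p) ^ j * (E ^ (j + 1) * S + (j + 1) * δ)) := by
      refine moverExp_one_mono hp0 hp1 fun M hM => ?_
      have hc := hM.1.card_moveSet
      split_ifs with hb
      · exact afterExp_le_of_le hlam (hM.1.nonempty_moveSet hne) fun Z' hZ' =>
          _root_.iterate_aStepExp_le hp0 hp1 hlam hk j Z' (hZ'.trans (hc.trans hZ))
      · obtain ⟨m', hJ'⟩ := hJ.isJam_stay hM hb
        rw [afterExp, if_neg hJ'.not_isIdeal]
        refine (ih _ b m' hJ' (hc.trans hZ)).trans ?_
        have h2 : E ^ j * jamSum θ β (readWord (moveSet Z M) b) ≤ E ^ j * (E * S + δ) := by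
          gcongr
          exact hJ.jamSum_stay_le hZ hM hb
        have h3 : E ^ j * δ ≤ 1 * δ := by
          gcongr
          exact pow_le_one₀ hE.le he1
        have h4 : E ^ j * jamSum θ β (readWord (moveSet Z M) b) + j * δ
            ≤ E ^ (j + 1) * S + (j + 1) * δ := by
          rw [pow_succ]
          linarith
        gcongr
    rw [moverExp_ite_mem p 1 hJ.mem, hJ.hopProb_head] at h1
    refine h1.trans (le_of_eq ?_)
    push_cast
    ring

theorem sum_range_heightInc {α : ℝ} (hα : α * Zᶜ.card = Z.card) (b : Fin n) (j : ℕ) :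
    ∑ i ∈ Finset.range j, heightInc α Z (b - Fin.ofNat n i)
      = height α Z b - height α Z (b - Fin.ofNat n j) := by
  induction j with
  | zero => simp
  | succ j ih =>
    rw [Finset.sum_range_succ, ih]
    have := height_add_one hα (b - Fin.ofNat n (j + 1))
    rw [sub_ofNat_succ_add_one] at this
    linarith

theorem take_readWord (Z : Config n) (b : Fin n) (j : ℕ) :
    (readWord Z b).take j = (List.range (min j n)).map fun i => decide (Occ Z b i) := by
  rw [readWord, ← List.map_take, List.take_range]

/-- A particle of an ideal configuration can be relocated so that the jam created is followed by
a word that stays above a line of slope `α`. -/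
theorem IsIdeal.exists_relocate {α α' : ℝ} (hI : IsIdeal Z) (hn : 3 ≤ n) (hZ : 2 ≤ Z.card)
    (hθ : 0 < θ) (hα0 : 0 < α) (hβα : β < α) (hαα' : α ≤ α') (hα' : α' * Zᶜ.card = Z.card) :
    ∃ x ∈ Z, ∃ y, y ∉ Z.erase x ∧ ∃ b m, IsJam (insert y (Z.erase x)) b m ∧
      jamSum θ β (readWord (insert y (Z.erase x)) b)
        ≤ Real.exp (θ * (1 + α)) / (1 - Real.exp (-θ * (α - β))) := by
  -- Read counterclockwise from a maximum of the height, every initial segment has nonnegative total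
  -- increment, that is, at least α' particles per hole. The jam is made there by putting a particle
  -- at b - 1.
  obtain ⟨b, hmax⟩ := Finite.exists_max (height α' Z)
  have hbZ : b ∈ Z := by
    by_contra hb
    have h1 := height_add_one hα' (b - 1)
    rw [sub_add_cancel, heightInc, if_neg hb] at h1
    have := hmax (b - 1)
    linarith
  have hb1 : b - 1 ∉ Z := fun h => isIdeal_iff.1 hI _ h (by simpa using hbZ)
  obtain ⟨x, hx, hxb⟩ := Finset.exists_mem_ne hZ b
  have hy : b - 1 ∉ Z.erase x := fun h => hb1 (Finset.mem_of_mem_erase h)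
  have hbe : b ∈ Z.erase x := Finset.mem_erase.2 ⟨hxb.symm, hbZ⟩
  have e : b - Fin.ofNat n 1 = b - 1 := by
    rw [show (1 : ℕ) = 0 + 1 from rfl, Fin.ofNat_succ, Fin.ofNat_zero_eq_zero, zero_add]
  have htail : JamTail (insert (b - 1) (Z.erase x)) b 2 := by
    have := jamTail_insert (b := b) (a := 1) (hI.erase x) (by omega)
      (isIdeal_iff.1 (hI.erase x) _ hbe)
    rw [e] at this
    refine this fun i hi => ?_
    rcases Nat.eq_zero_or_pos i with rfl | hi0
    · rw [occ_zero]
      exact Finset.mem_insert_of_mem hbe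
    · rw [show i = 1 by omega, occ_one]
      exact Finset.mem_insert_self _ _
  refine ⟨x, hx, b - 1, hy, b, ?_⟩
  set Y := insert (b - 1) (Z.erase x) with hYdef
  obtain ⟨m, hm⟩ : ∃ m, IsJam Y b m := by
    refine (htail.isIdeal_or_isJam (by omega)).resolve_left fun hIY => ?_
    refine isIdeal_iff.1 hIY (b - 1) (Finset.mem_insert_self _ _) ?_
    rw [sub_add_cancel]
    exact Finset.mem_insert_of_mem hbe
  refine ⟨m, hm, jamSum_le_of_prefix hθ hβα _ _ fun j => ?_⟩
  rw [take_readWord, count_map_range, count_map_range]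
  push_cast
  rw [Finset.mul_sum, ← Finset.sum_sub_distrib]
  set J := min j n
  -- Lowering α' to α and adding a particle only help; the removal of x costs at most 1 + α, and
  -- only once.
  have h1 : ∀ i ∈ Finset.range J,
      α * (if decide (Occ Y b i) = false then (1 : ℝ) else 0)
          - (if decide (Occ Y b i) = true then 1 else 0)
        ≤ -heightInc α' Z (b - Fin.ofNat n i)
          + (1 + α) * (if b - Fin.ofNat n i = x then 1 else 0) := by
    intro i _
    by_cases hY : Occ Y b i
    · rw [if_neg (by simpa using hY), if_pos (decide_eq_true hY), heightInc]
      split_ifs <;> linarith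
    · rw [if_pos (by simpa using hY), if_neg (by simpa using hY), heightInc]
      by_cases hz : b - Fin.ofNat n i ∈ Z
      · have : b - Fin.ofNat n i = x := by
          by_contra hne
          exact hY (Finset.mem_insert_of_mem (Finset.mem_erase.2 ⟨hne, hz⟩))
        rw [if_pos hz, if_pos this]
        linarith
      · rw [if_neg hz]
        split_ifs <;> linarith
  refine (Finset.sum_le_sum h1).trans ?_
  rw [Finset.sum_add_distrib, Finset.sum_neg_distrib, sum_range_heightInc hα', ← Finset.mul_sum]
  have h2 : ∑ i ∈ Finset.range J, (if b - Fin.ofNat n i = x then (1 : ℝ) else 0) ≤ 1 := by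
    calc ∑ i ∈ Finset.range J, (if b - Fin.ofNat n i = x then (1 : ℝ) else 0)
        ≤ ∑ i ∈ Finset.range n, (if b - Fin.ofNat n i = x then (1 : ℝ) else 0) :=
          Finset.sum_le_sum_of_subset_of_nonneg (Finset.range_mono (min_le_right _ _))
            fun i _ _ => by split_ifs <;> norm_num
      _ = 1 := by
          rw [← sum_eq_sum_range_sub b (fun z => if z = x then (1 : ℝ) else 0)]
          simp
  have h3 := hmax (b - Fin.ofNat n J)
  have h4 := mul_le_mul_of_nonneg_left h2 (show 0 ≤ 1 + α by linarith)
  linarith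

theorem relocExp_le_sub {f : Config n → ℝ} {c e : ℝ} {x y : Fin n}
    (h : ∀ x ∈ Z, ∀ y, y ∉ Z.erase x → f (insert y (Z.erase x)) ≤ c) (hx : x ∈ Z)
    (hy : y ∉ Z.erase x) (he : f (insert y (Z.erase x)) ≤ c - e) :
    relocExp f Z ≤ c - pickProb Z x * e := by
  have hZ : Z.Nonempty := ⟨x, hx⟩
  have h1 : relocExp f Z + pickProb Z x * (c - f (insert y (Z.erase x))) ≤ c := by
    have h2 : ∑ x' ∈ Z, ∑ y' ∈ (Z.erase x')ᶜ, pickProb Z x' * (c - f (insert y' (Z.erase x')))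
        = c - relocExp f Z := by
      simp only [mul_sub, Finset.sum_sub_distrib]
      rw [← relocExp]
      simp only [← Finset.sum_mul]
      rw [sum_pickProb hZ, one_mul]
    have h3 : ∀ x' ∈ Z, ∀ y' ∈ (Z.erase x')ᶜ,
        0 ≤ pickProb Z x' * (c - f (insert y' (Z.erase x'))) := fun x' hx' y' hy' =>
      mul_nonneg (pickProb_nonneg Z x') (sub_nonneg.2 (h x' hx' y' (Finset.mem_compl.1 hy')))
    have h4 := Finset.single_le_sum (f := fun x' => ∑ y' ∈ (Z.erase x')ᶜ,
      pickProb Z x' * (c - f (insert y' (Z.erase x'))))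
      (fun x' hx' => Finset.sum_nonneg (h3 x' hx')) hx
    have h5 := Finset.single_le_sum (f := fun y' => pickProb Z x * (c - f (insert y' (Z.erase x))))
      (h3 x hx) (Finset.mem_compl.2 hy)
    linarith
  have h6 : pickProb Z x * e ≤ pickProb Z x * (c - f (insert y (Z.erase x))) :=
    mul_le_mul_of_nonneg_left (by linarith) (pickProb_nonneg Z x)
  linarith

theorem pickProb_eq {x : Fin n} (hx : x ∈ Z) :
    pickProb Z x = ((Z.card : ℝ) * (n - Z.card + 1 : ℕ))⁻¹ := by
  have h1 := Finset.card_erase_add_one hx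
  have h2 : Z.card ≤ n := by simpa using Finset.card_le_univ Z
  rw [pickProb, Finset.card_compl, Fintype.card_fin]
  congr 3
  omega

/-- The step stays ideal; then one good relocation is chosen with probability of order rate / n²,
and with probability (1 - p) ^ j the new jam keeps its head for j steps and contracts. All other
outcomes are bounded by exp (-θ). -/
theorem IsIdeal.iterate_aStepExp_le {α α' : ℝ} (hp0 : 0 ≤ p) (hp1 : p ≤ 1) (hlam : 0 ≤ lam)
    (hθ : 0 < θ) (hβ : 0 ≤ β) (hn : 3 ≤ n) (hk : 2 ≤ k) (hβα : β < α) (hαα' : α ≤ α')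
    (hI : IsIdeal Z) (hZ : Z.card = k) (hα' : α' * (n - k) = k) (j : ℕ) :
    (aStepExp p lam)^[j + 1] (jamPot θ β) Z ≤ Real.exp (-θ) - perturbRate lam n *
      (((k : ℝ) * (n - k + 1 : ℕ))⁻¹ * ((1 - p) ^ j * (Real.exp (-θ) - (Real.exp (-θ * β) ^ j *
        (Real.exp (θ * (1 + α)) / (1 - Real.exp (-θ * (α - β))))
        + j * Real.exp (-θ * k + θ * β * (n - k - 1 : ℕ)))))) := by
  set δ := Real.exp (-θ * k + θ * β * (n - k - 1 : ℕ))
  set K := Real.exp (θ * (1 + α)) / (1 - Real.exp (-θ * (α - β)))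
  have hr := perturbRate_nonneg hlam n
  have hr1 := perturbRate_le_one lam n
  have hq : 0 ≤ 1 - p := by linarith
  rw [Function.iterate_succ_apply', aStepExp_eq, ← moverExp_const p 1 Z (_ - _)]
  refine moverExp_one_mono hp0 hp1 fun M hM => ?_
  have hI' := hM.isIdeal_moveSet hI
  have hc : (moveSet Z M).card = k := hM.1.card_moveSet.trans hZ
  set Y := moveSet Z M
  obtain ⟨x, hx, y, hy, b, m, hJ, hle⟩ := hI'.exists_relocate (θ := θ) hn (hc ▸ hk) hθ
    (hβ.trans_lt hβα) hβα hαα' (by rw [cast_card_compl, hc, hα'])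
  have h1 := hJ.iterate_aStepExp_le hp0 hp1 hlam hθ.le hβ (show 0 < k by omega) j _ _ _
    ((card_relocate hx hy).trans hc)
  have hall := _root_.iterate_aStepExp_le (θ := θ) (β := β) (n := n) hp0 hp1 hlam
    (show 0 < k by omega) j
  have h2 : (aStepExp p lam)^[j] (jamPot θ β) (insert y (Y.erase x)) ≤ Real.exp (-θ) -
      (1 - p) ^ j * (Real.exp (-θ) - (Real.exp (-θ * β) ^ j * K + j * δ)) := by
    refine h1.trans ?_
    have : Real.exp (-θ * β) ^ j * jamSum θ β (readWord (insert y (Y.erase x)) b)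
        ≤ Real.exp (-θ * β) ^ j * K := by gcongr
    have := mul_le_mul_of_nonneg_left this (pow_nonneg hq j)
    linarith
  have h3 := relocExp_le_sub (fun x hx y hy => hall _ ((card_relocate hx hy).trans hc)) hx hy h2
  rw [pickProb_eq hx, hc] at h3
  rw [afterExp, if_pos hI']
  have h4 := mul_le_mul_of_nonneg_left h3 hr
  have h5 := mul_le_mul_of_nonneg_left (hall Y hc) (show 0 ≤ 1 - perturbRate lam n by linarith)
  linarith

theorem IsStationaryDist.sum_mul_iterate {μ : Config n → ℝ}
    (hμ : IsStationaryDist k (aStepProb p lam) μ) (f : Config n → ℝ) (j : ℕ) :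
    ∑ Z, μ Z * (aStepExp p lam)^[j] f Z = ∑ Z, μ Z * f Z := by
  induction j with
  | zero => rfl
  | succ j ih =>
    simp only [Function.iterate_succ_apply']
    rw [← ih]
    exact hμ.sum_mul_step _

/-- Over j + 1 steps the mean of the potential is preserved. Off the ideal configurations it gains
at most j + 1 small errors; on them it loses the amount of the previous bound, so their mass is at
most the quotient. -/
theorem IsStationaryDist.mass_ideal_le {α α' : ℝ} {μ : Config n → ℝ} (hp0 : 0 < p) (hp1 : p < 1)
    (hlam : 0 ≤ lam) (hθ : 0 < θ) (hβ : 0 ≤ β) (hn : 3 ≤ n) (hk : 2 ≤ k) (hkn : k < n)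
    (hβα : β < α) (hαα' : α ≤ α') (hα' : α' * (n - k) = k)
    (hκ : (1 - p) * Real.exp (-θ * β) + p * Real.exp (θ * (1 - β)) ≤ 1)
    (hμ : IsStationaryDist k (aStepProb p lam) μ) (j : ℕ) :
    (∑ Z, μ Z * if IsIdeal Z then 1 else 0) * (perturbRate lam n *
      (((k : ℝ) * (n - k + 1 : ℕ))⁻¹ * ((1 - p) ^ j * (Real.exp (-θ) - (Real.exp (-θ * β) ^ j *
        (Real.exp (θ * (1 + α)) / (1 - Real.exp (-θ * (α - β))))
        + j * Real.exp (-θ * k + θ * β * (n - k - 1 : ℕ)))))))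
      ≤ (j + 1) * Real.exp (-θ * k + θ * β * (n - k - 1 : ℕ)) := by
  set ε := perturbRate lam n *
      (((k : ℝ) * (n - k + 1 : ℕ))⁻¹ * ((1 - p) ^ j * (Real.exp (-θ) - (Real.exp (-θ * β) ^ j *
        (Real.exp (θ * (1 + α)) / (1 - Real.exp (-θ * (α - β))))
        + j * Real.exp (-θ * k + θ * β * (n - k - 1 : ℕ))))))
  set δ := Real.exp (-θ * k + θ * β * (n - k - 1 : ℕ))
  have hδ : 0 < δ := Real.exp_pos _
  have h1 : ∑ Z, μ Z * (aStepExp p lam)^[j + 1] (jamPot θ β) Z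
      ≤ ∑ Z, μ Z * (jamPot θ β Z + ((j + 1) * δ - ε * if IsIdeal Z then 1 else 0)) := by
    refine hμ.sum_mul_le fun Z hZ hne => ?_
    have hD := hμ.atMostOneJam hp0 hp1 hlam hn (by omega) hkn hne
    by_cases hI : IsIdeal Z
    · rw [if_pos hI, mul_one, hI.jamPot_eq]
      have := hI.iterate_aStepExp_le hp0.le hp1.le hlam hθ hβ hn hk hβα hαα' hZ hα' j
      have h0 : (0 : ℝ) ≤ (j + 1) * δ := by positivity
      linarith
    · rw [if_neg hI]
      have := iterate_aStepExp_jamPot_le hp0.le hp1.le hlam hn (by omega) hκ (j + 1) Z hD hZ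
      push_cast at this
      linarith
  rw [hμ.sum_mul_iterate] at h1
  have h2 : ∑ Z, μ Z * (jamPot θ β Z + ((j + 1) * δ - ε * if IsIdeal Z then 1 else 0))
      = ∑ Z, μ Z * jamPot θ β Z + (j + 1) * δ - ε * ∑ Z, μ Z * if IsIdeal Z then 1 else 0 := by
    have h3 := hμ.sum_mul_const ((j + 1) * δ)
    calc _ = ∑ Z, μ Z * jamPot θ β Z + ∑ Z, μ Z * ((j + 1) * δ)
          - ε * ∑ Z, μ Z * if IsIdeal Z then 1 else 0 := by
          rw [Finset.mul_sum, ← Finset.sum_add_distrib, ← Finset.sum_sub_distrib]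
          exact Finset.sum_congr rfl fun Z _ => by ring
      _ = _ := by rw [h3]
  linarith

end HighDensity

/-! ## The flux at high density -/

section HighDensityFlux

variable {n k : ℕ} [NeZero n] {Z M : Config n} {b : Fin n} {m : ℕ} {p lam : ℝ}

open Classical in
/-- Number of pairs of a particle and a hole met later when reading from the head of the jam. -/
noncomputable def jamInvExp (Z : Config n) : ℝ :=
  if h : ∃ b m, IsJam Z b m then (jamInv (readWord Z h.choose) : ℝ) else 0

theorem IsJam.jamInvExp_eq (h : IsJam Z b m) : jamInvExp Z = jamInv (readWord Z b) := by
  have h' : ∃ b m, IsJam Z b m := ⟨b, m, h⟩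
  rw [jamInvExp, dif_pos h', h.choose_eq h']

theorem IsIdeal.jamInvExp_eq (h : IsIdeal Z) : jamInvExp Z = 0 := by
  rw [jamInvExp, dif_neg]
  rintro ⟨b, m, hJ⟩
  exact hJ.not_isIdeal h

theorem jamInv_readWord_le (Z : Config n) (b : Fin n) : (jamInv (readWord Z b) : ℝ) ≤ n ^ 2 := by
  have h1 := jamInv_le (readWord Z b)
  rw [count_true_readWord, count_false_readWord] at h1
  have h2 : Z.card ≤ n := by simpa using Finset.card_le_univ Z
  have h3 : Z.card * (n - Z.card) ≤ n * n := Nat.mul_le_mul h2 (Nat.sub_le _ _)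
  rw [sq]
  exact_mod_cast h1.trans h3

theorem jamInvExp_nonneg (Z : Config n) : 0 ≤ jamInvExp Z := by
  rw [jamInvExp]
  split_ifs
  · exact Nat.cast_nonneg _
  · exact le_rfl

theorem jamInvExp_le (Z : Config n) : jamInvExp Z ≤ n ^ 2 := by
  rw [jamInvExp]
  split_ifs
  · exact jamInv_readWord_le _ _
  · positivity

theorem relocExp_nonneg {f : Config n → ℝ} (h : ∀ Y, 0 ≤ f Y) (Z : Config n) :
    0 ≤ relocExp f Z :=
  Finset.sum_nonneg fun x _ => Finset.sum_nonneg fun _ _ => mul_nonneg (pickProb_nonneg Z x) (h _)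

theorem IsIdeal.afterExp_jamInvExp (hlam : 0 ≤ lam) (hI : IsIdeal Z) (hZ : Z.Nonempty) :
    0 ≤ afterExp lam jamInvExp Z ∧ afterExp lam jamInvExp Z ≤ lam * n := by
  have hr := perturbRate_nonneg hlam n
  rw [afterExp, if_pos hI, hI.jamInvExp_eq, mul_zero, zero_add]
  refine ⟨mul_nonneg hr (relocExp_nonneg jamInvExp_nonneg Z), ?_⟩
  have h1 : relocExp jamInvExp Z ≤ n ^ 2 := relocExp_le hZ fun _ _ _ _ => jamInvExp_le _
  have h2 := mul_le_mul_of_nonneg_left h1 hr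
  have h3 := mul_le_mul_of_nonneg_right (perturbRate_mul_le hlam n) (Nat.cast_nonneg (α := ℝ) n)
  linarith

theorem IsIdeal.idealProb_eq (hp0 : 0 ≤ p) (hp1 : p ≤ 1) (hI : IsIdeal Z) : idealProb p Z = 1 := by
  rw [← moverExp_const p 1 Z 1]
  exact moverExp_one_congr hp0 hp1 fun M hM => if_pos (hM.isIdeal_moveSet hI)

/-- With a jam the mean gain of inversions is the number of outside particles minus p times the
number of outside holes, which is the mean number of movers minus p (n - k). It can fail only when
the step reaches an ideal configuration, and then by the trivial size of the terms. -/
theorem abs_aStepExp_jamInvExp_sub_le (hp0 : 0 ≤ p) (hp1 : p ≤ 1) (hlam : 0 ≤ lam) (hk : 0 < k)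
    (hkn : k ≤ n) (hD : AtMostOneJam Z) (hZ : Z.card = k) :
    |aStepExp p lam jamInvExp Z
        - (jamInvExp Z + ∑ i ∈ Z, hopProb p 1 Z i - p * (n - k : ℕ))|
      ≤ (n ^ 2 + lam * n + n) * idealProb p Z := by
  have hne : Z.Nonempty := Finset.card_pos.1 (hZ ▸ hk)
  have hn : (0 : ℝ) ≤ n := Nat.cast_nonneg n
  rw [aStepExp_eq]
  rcases hD with hI | ⟨b, m, hJ⟩
  · rw [hI.idealProb_eq hp0 hp1, mul_one, hI.jamInvExp_eq, sum_hopProb_of_isIdeal hI, hZ]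
    have h1 : (0 : ℝ) ≤ moverExp p 1 Z (fun M => afterExp lam jamInvExp (moveSet Z M)) := by
      rw [← moverExp_const p 1 Z 0]
      exact moverExp_one_mono hp0 hp1 fun M hM =>
        ((hM.isIdeal_moveSet hI).afterExp_jamInvExp hlam (hM.1.nonempty_moveSet hne)).1
    have h2 : moverExp p 1 Z (fun M => afterExp lam jamInvExp (moveSet Z M)) ≤ lam * n := by
      rw [← moverExp_const p 1 Z (lam * n)]
      exact moverExp_one_mono hp0 hp1 fun M hM =>
        ((hM.isIdeal_moveSet hI).afterExp_jamInvExp hlam (hM.1.nonempty_moveSet hne)).2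
    have h3 : ((n - k : ℕ) : ℝ) = n - k := Nat.cast_sub hkn
    have h4 : (k : ℝ) ≤ n := Nat.cast_le.2 hkn
    have h5 : (0 : ℝ) ≤ k := Nat.cast_nonneg k
    have h6 : p * (n - k) ≤ n - k := mul_le_of_le_one_left (by linarith) hp1
    have h7 : 0 ≤ p * ((n : ℝ) - k) := mul_nonneg hp0 (by linarith)
    have h8 : 0 ≤ lam * n := mul_nonneg hlam hn
    rw [h3, abs_le]
    constructor <;> nlinarith
  · set G : Config n → ℝ := fun M => if b ∈ M then
      (jamInv (readWord Z b) : ℝ) + (jamRest Z b m).count true - (jamRest Z b m).count false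
      else (jamInv (readWord Z b) : ℝ) + (jamRest Z b m).count true with hG
    have hmean : moverExp p 1 Z G
        = jamInvExp Z + ∑ i ∈ Z, hopProb p 1 Z i - p * (n - k : ℕ) := by
      rw [hG, moverExp_ite_mem p 1 hJ.mem, hJ.hopProb_head, hJ.jamInvExp_eq, hJ.sum_hopProb]
      have := hJ.count_false_rest
      rw [hZ] at this
      rw [← this]
      push_cast
      ring
    have hGM : ∀ M, FreeMoves Z M → G M = jamInv (readWord (moveSet Z M) (if b ∈ M then b - 1
        else b)) := by
      intro M hM
      by_cases hb : b ∈ M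
      · simp only [hG, if_pos hb]
        obtain ⟨m', hm'⟩ : ∃ m', m = m' + 1 := ⟨m - 1, by have := hJ.1; omega⟩
        have h1 := jamInv_leave m' (jamRest Z b m)
        rw [hJ.readWord_leave hM hb, hJ.readWord_eq, hm', Nat.add_sub_cancel, ← hm', sub_eq_iff_eq_add]
        rw [← hm'] at h1
        exact_mod_cast h1.symm
      · simp only [hG, if_neg hb]
        rw [hJ.readWord_stay hM hb, jamInv_stay, hJ.readWord_eq]
        push_cast
        rfl
    have hclose : ∀ M, FreeMoves Z M → |afterExp lam jamInvExp (moveSet Z M) - G M|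
        ≤ (n ^ 2 + lam * n + n) * (if IsIdeal (moveSet Z M) then 1 else 0) := by
      intro M hM
      by_cases hI : IsIdeal (moveSet Z M)
      · rw [if_pos hI, mul_one, hGM M hM]
        obtain ⟨h1, h2⟩ := hI.afterExp_jamInvExp hlam (hM.1.nonempty_moveSet hne)
        have h3 := jamInv_readWord_le (moveSet Z M) (if b ∈ M then b - 1 else b)
        have h4 : (0 : ℝ) ≤ jamInv (readWord (moveSet Z M) (if b ∈ M then b - 1 else b)) :=
          Nat.cast_nonneg _
        rw [abs_le]
        constructor <;> nlinarith
      · rw [if_neg hI, mul_zero, afterExp, if_neg hI, hGM M hM]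
        have : jamInvExp (moveSet Z M)
            = jamInv (readWord (moveSet Z M) (if b ∈ M then b - 1 else b)) := by
          by_cases hb : b ∈ M
          · obtain ⟨m', hJ'⟩ := (hJ.isIdeal_or_isJam_leave hM hb).resolve_left hI
            rw [if_pos hb, hJ'.jamInvExp_eq]
          · obtain ⟨m', hJ'⟩ := hJ.isJam_stay hM hb
            rw [if_neg hb, hJ'.jamInvExp_eq]
        rw [this, sub_self, abs_zero]
    rw [← hmean, ← moverExp_sub, abs_le, idealProb, ← moverExp_const_mul]
    constructor
    · have h0 : moverExp p 1 Z (fun _ => (0 : ℝ)) ≤ moverExp p 1 Z (fun M =>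
          (afterExp lam jamInvExp (moveSet Z M) - G M)
            + (n ^ 2 + lam * n + n) * (if IsIdeal (moveSet Z M) then 1 else 0)) :=
        moverExp_one_mono hp0 hp1 fun M hM => by
          have := (abs_le.1 (hclose M hM)).1
          linarith
      rw [moverExp_const, moverExp_add] at h0
      linarith
    · exact moverExp_one_mono hp0 hp1 fun M hM => (abs_le.1 (hclose M hM)).2

/-- Averaging the drift of the inversion count over the stationary law cancels the count itself and
leaves the flux equal to p (n - k), up to n² times the mass of ideal configurations. -/
theorem IsStationaryDist.abs_flux_sub_le {μ : Config n → ℝ} (hp0 : 0 < p) (hp1 : p < 1)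
    (hlam : 0 ≤ lam) (hn : 3 ≤ n) (hk : 0 < k) (hkn : k < n) (hr : perturbRate lam n ≤ 1 / 2)
    (hμ : IsStationaryDist k (aStepProb p lam) μ) :
    |∑ Z, μ Z * aDist p lam Z - p * (n - k : ℕ)|
      ≤ (n ^ 2 + lam * n + n + lam) * (2 * ∑ Z, μ Z * if IsIdeal Z then 1 else 0) := by
  set B : ℝ := n ^ 2 + lam * n + n
  have hB : 0 ≤ B := by positivity
  have hr0 := perturbRate_nonneg hlam n
  set ι := ∑ Z, μ Z * idealProb p Z with hι
  have hstat := hμ.sum_mul_step (jamInvExp (n := n))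
  have hpt : ∀ Z, Z.card = k → μ Z ≠ 0 → |aStepExp p lam jamInvExp Z
        - (jamInvExp Z + ∑ i ∈ Z, hopProb p 1 Z i - p * (n - k : ℕ))| ≤ B * idealProb p Z :=
    fun Z hZ hne => abs_aStepExp_jamInvExp_sub_le hp0.le hp1.le hlam hk hkn.le
      (hμ.atMostOneJam hp0 hp1 hlam hn hk hkn hne) hZ
  have e1 := hμ.sum_mul_const (p * (n - k : ℕ))
  have e2 : ∀ c : ℝ, ∑ Z, μ Z * (c * idealProb p Z) = c * ι := by
    intro c
    rw [hι, Finset.mul_sum]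
    exact Finset.sum_congr rfl fun Z _ => by ring
  have hup : ∑ Z, μ Z * (∑ i ∈ Z, hopProb p 1 Z i + jamInvExp Z)
      ≤ ∑ Z, μ Z * (aStepExp p lam jamInvExp Z + B * idealProb p Z + p * (n - k : ℕ)) :=
    hμ.sum_mul_le fun Z hZ hne => by
      have := (abs_le.1 (hpt Z hZ hne)).1
      linarith
  have hlow : ∑ Z, μ Z * (aStepExp p lam jamInvExp Z + p * (n - k : ℕ))
      ≤ ∑ Z, μ Z * (∑ i ∈ Z, hopProb p 1 Z i + jamInvExp Z + B * idealProb p Z) :=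
    hμ.sum_mul_le fun Z hZ hne => by
      have := (abs_le.1 (hpt Z hZ hne)).2
      linarith
  have hA : ∑ Z, μ Z * aStepExp p lam jamInvExp Z = ∑ Z, μ Z * jamInvExp Z := hstat
  have d1 : ∑ Z, μ Z * ∑ i ∈ Z, hopProb p 1 Z i ≤ ∑ Z, μ Z * aDist p lam Z :=
    hμ.sum_mul_le fun Z _ _ => (aDist_mem hp0.le hp1.le hlam Z).1
  have d2 : ∑ Z, μ Z * aDist p lam Z
      ≤ ∑ Z, μ Z * (∑ i ∈ Z, hopProb p 1 Z i + lam * idealProb p Z) :=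
    hμ.sum_mul_le fun Z _ _ => (aDist_mem hp0.le hp1.le hlam Z).2
  simp only [mul_add (μ _), Finset.sum_add_distrib, e1, e2, hA] at hup hlow d2
  -- An ideal configuration reached by the movement survives the perturbation stage with probability
  -- at least 1/2, so reaching one is at most twice as likely as finding one.
  have hmass : ι ≤ 2 * ∑ Z, μ Z * if IsIdeal Z then 1 else 0 := by
    have h1 := hμ.sum_mul_moverExp (fun Z => if IsIdeal Z then (1 : ℝ) else 0)
    rw [← h1, hι, Finset.mul_sum]
    refine Finset.sum_le_sum fun Z _ => ?_
    rw [mul_left_comm]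
    refine mul_le_mul_of_nonneg_left ?_ (hμ.nonneg Z)
    rw [idealProb, ← moverExp_const_mul]
    refine moverExp_one_mono hp0.le hp1.le fun M _ => ?_
    rw [afterExp]
    have h2 : 0 ≤ relocExp (fun Z => if IsIdeal Z then (1 : ℝ) else 0) (moveSet Z M) :=
      relocExp_nonneg (fun Y => by split_ifs <;> norm_num) _
    have h3 := mul_nonneg hr0 h2
    split_ifs <;> linarith
  have hι0 : 0 ≤ ι := Finset.sum_nonneg fun Z _ => mul_nonneg (hμ.nonneg Z) (by
    rw [← moverExp_const p 1 Z 0]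
    exact moverExp_one_mono hp0.le hp1.le fun M _ => by split_ifs <;> norm_num)
  have hfin : (B + lam) * ι ≤ (B + lam) * (2 * ∑ Z, μ Z * if IsIdeal Z then 1 else 0) :=
    mul_le_mul_of_nonneg_left hmass (by positivity)
  have hBι : 0 ≤ B * ι := mul_nonneg hB hι0
  have hlι : 0 ≤ lam * ι := mul_nonneg hlam hι0
  rw [abs_le]
  constructor <;> linarith

end HighDensityFlux

/-! ### The flux above the critical density, and the theorem -/

section Main

theorem tendsto_pow_mul_exp_neg_nat {γ : ℝ} (hγ : 0 < γ) (j : ℕ) :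
    Tendsto (fun n : ℕ => (n : ℝ) ^ j * Real.exp (-(γ * n))) atTop (𝓝 0) := by
  have h1 : Tendsto (fun n : ℕ => γ * (n : ℝ)) atTop atTop :=
    tendsto_natCast_atTop_atTop.const_mul_atTop hγ
  have h2 := ((Real.tendsto_pow_mul_exp_neg_atTop_nhds_zero j).comp h1).const_mul (γ ^ j)⁻¹
  rw [mul_zero] at h2
  refine h2.congr fun n => ?_
  simp only [Function.comp_apply, mul_pow]
  field_simp

set_option maxHeartbeats 800000 in
theorem isTypicalFlux_of_gt {p ρ lam : ℝ} (hp0 : 0 < p) (hp1 : p < 1) (hρ0 : 0 < ρ) (hρ1 : ρ < 1)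
    (hρ : p < ρ / (1 - ρ)) (hlam : 0 < lam) : IsTypicalFlux p lam ρ (p * (1 - ρ)) := by
  -- Two margins p < β < α < κ: β makes the potential a supermartingale, and α - β gives both the
  -- geometric series and the exponential smallness.
  obtain ⟨α, hpα, hακ⟩ := exists_between hρ
  obtain ⟨β, hpβ, hβα⟩ := exists_between hpα
  have hβ0 : 0 < β := hp0.trans hpβ
  -- The roles of moving and staying are exchanged: the head stays with probability 1 - p > 1 - β.
  obtain ⟨θ, hθ, hlt⟩ := exists_exp_mean_lt_one (p := 1 - p) (α := 1 - β) (by linarith)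
    (by linarith) (by linarith)
  have hκ : (1 - p) * Real.exp (-θ * β) + p * Real.exp (θ * (1 - β)) ≤ 1 := by
    rw [show -θ * β = θ * (1 - β - 1) by ring]
    rw [sub_sub_cancel] at hlt
    exact hlt.le
  have hq : 0 < 1 - p := by linarith
  set c := Real.exp (-θ)
  have hc : 0 < c := Real.exp_pos _
  set K := Real.exp (θ * (1 + α)) / (1 - Real.exp (-θ * (α - β)))
  have hK : 0 < K := by
    refine div_pos (Real.exp_pos _) (sub_pos.2 ?_)
    rw [Real.exp_lt_one_iff]
    nlinarith
  -- After j contractions the initial bound K is below a quarter of the cap exp (-θ); the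
  -- accumulated errors take another quarter, so half of the cap is gained.
  obtain ⟨j, hj⟩ := exists_pow_lt_of_lt_one (show 0 < c / 4 / K by positivity)
    (show Real.exp (-θ * β) < 1 by rw [Real.exp_lt_one_iff]; nlinarith)
  rw [lt_div_iff₀ hK] at hj
  -- Since k ≥ α (n - k) and n - k ≥ (1 - ρ) n / 2 for large n, the one-step error is at most exp
  -- (-γ n).
  set γ := θ * (α - β) * ((1 - ρ) / 2) with hγdef
  have hγ : 0 < γ := mul_pos (mul_pos hθ (by linarith)) (by linarith)
  -- The ideal mass is at most a constant times n³ exp (-γ n), and the flux error costs a further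
  -- n², whence the power n⁵.
  set D := (2 + 2 * lam) * (2 * ((j + 1) * 2 / (lam * (1 - p) ^ j * c))) with hD
  have hD0 : 0 ≤ D := by positivity
  refine isFluxLimit_of_abs_le (b := fun n : ℕ => p * |((n - ⌈ρ * n⌉₊ : ℕ) : ℝ) / n - (1 - ρ)|
    + D * ((n : ℝ) ^ 5 * Real.exp (-(γ * n)))) ?_ ?_ ?_
  · filter_upwards [eventually_ceil_lt hρ0.le hρ1, eventually_ceil_gt hρ0 0] with n h1 h2
    have : NeZero n := ⟨by omega⟩
    obtain ⟨μ, hμ⟩ := exists_isStationaryDist_aStepProb hp0.le hp1.le hlam.le h2 h1.le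
    exact ⟨_, μ, hμ, rfl⟩
  · have h1 := (((tendsto_holes_div hρ0.le hρ1).sub_const (1 - ρ)).abs).const_mul p
    have h2 := (tendsto_pow_mul_exp_neg_nat hγ 5).const_mul D
    simpa using h1.add h2
  · have hexp := (tendsto_pow_mul_exp_neg_nat hγ 0).const_mul (j : ℝ)
    rw [mul_zero] at hexp
    filter_upwards [eventually_ceil_lt hρ0.le hρ1, eventually_ceil_gt hρ0 1,
      (tendsto_particles_div_holes hρ0.le hρ1).eventually_const_lt hακ,
      (tendsto_holes_div hρ0.le hρ1).eventually_const_lt (show (1 - ρ) / 2 < 1 - ρ by linarith),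
      hexp.eventually_lt_const (show 0 < c / 4 by positivity),
      eventually_ge_atTop ⌈2 * lam⌉₊, eventually_ge_atTop 3] with n h1 h2 h3 h4 h5 h6 h7
    have : NeZero n := ⟨by omega⟩
    have hn : (1 : ℝ) ≤ n := by exact_mod_cast (by omega : 1 ≤ n)
    have hn0 : (0 : ℝ) < n := by linarith
    rintro x ⟨μ, hμ, rfl⟩
    set k := ⌈ρ * n⌉₊
    have hcast : ((n - k : ℕ) : ℝ) = n - k := Nat.cast_sub h1.le
    have hkn : (k : ℝ) < n := Nat.cast_lt.2 h1
    have hN : (n : ℝ) - k ≠ 0 := by linarith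
    have h2lam : 2 * lam ≤ n := (Nat.le_ceil _).trans (Nat.cast_le.2 h6)
    have hrate : perturbRate lam n = lam / n := by
      rw [perturbRate, min_eq_right]
      rw [div_le_one hn0]
      linarith
    have hr2 : perturbRate lam n ≤ 1 / 2 := by
      rw [hrate, div_le_iff₀ hn0]
      linarith
    rw [hcast] at h3
    set δ := Real.exp (-θ * k + θ * β * (n - k - 1 : ℕ)) with hδdef
    have hδ : δ ≤ Real.exp (-(γ * n)) := by
      apply Real.exp_le_exp.2
      have a1 : ((n - k - 1 : ℕ) : ℝ) ≤ n - k := by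
        rw [← hcast]
        exact Nat.cast_le.2 (Nat.sub_le _ _)
      have a2 : α * (n - k) ≤ k := by
        rw [lt_div_iff₀ (by linarith)] at h3
        exact h3.le
      have a3 : (1 - ρ) / 2 * n ≤ n - k := by
        rw [lt_div_iff₀ hn0, hcast] at h4
        exact h4.le
      have a4 := mul_le_mul_of_nonneg_left a1 (mul_pos hθ hβ0).le
      have a5 := mul_le_mul_of_nonneg_left a2 hθ.le
      have a6 := mul_le_mul_of_nonneg_left a3 (mul_pos hθ (sub_pos.2 hβα)).le
      rw [hγdef]
      linarith
    have hmass := hμ.mass_ideal_le (α := α) hp0 hp1 hlam.le hθ hβ0.le h7 h2 h1 hβα h3.le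
      (div_mul_cancel₀ (k : ℝ) hN) hκ j
    set S := ∑ Z, μ Z * if IsIdeal Z then 1 else 0
    have hS0 : 0 ≤ S := Finset.sum_nonneg fun Z _ => mul_nonneg (hμ.nonneg Z) (by
      split_ifs <;> norm_num)
    have hlow : lam / n * (((n : ℝ) * n)⁻¹ * ((1 - p) ^ j * (c / 2)))
        ≤ perturbRate lam n * (((k : ℝ) * (n - k + 1 : ℕ))⁻¹ * ((1 - p) ^ j *
          (c - (Real.exp (-θ * β) ^ j * K + j * δ)))) := by
      rw [hrate]
      have b1 : (k : ℝ) * (n - k + 1 : ℕ) ≤ n * n :=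
        mul_le_mul hkn.le (Nat.cast_le.2 (by omega)) (Nat.cast_nonneg _) hn0.le
      have b2 : (0 : ℝ) < k * (n - k + 1 : ℕ) := by
        have : (0 : ℝ) < k := Nat.cast_pos.2 (by omega)
        positivity
      have b3 : j * δ ≤ j * ((n : ℝ) ^ 0 * Real.exp (-(γ * n))) := by
        rw [pow_zero, one_mul]
        gcongr
      have b4 : c / 2 ≤ c - (Real.exp (-θ * β) ^ j * K + j * δ) := by linarith
      have b5 : ((n : ℝ) * n)⁻¹ ≤ ((k : ℝ) * (n - k + 1 : ℕ))⁻¹ := inv_anti₀ b2 b1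
      gcongr
    have hmass2 : S ≤ (j + 1) * 2 / (lam * (1 - p) ^ j * c) * (n ^ 3 * δ) := by
      have c1 := (mul_le_mul_of_nonneg_left hlow hS0).trans hmass
      have c2 : 0 < lam / n * (((n : ℝ) * n)⁻¹ * ((1 - p) ^ j * (c / 2))) := by positivity
      rw [← le_div_iff₀ c2] at c1
      refine c1.trans (le_of_eq ?_)
      rw [← hδdef]
      clear_value δ c K D
      field_simp
    have hflux := hμ.abs_flux_sub_le hp0 hp1 hlam.le h7 (by omega) h1 hr2
    have hB : (n : ℝ) ^ 2 + lam * n + n + lam ≤ (2 + 2 * lam) * n ^ 2 := by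
      have d1 : (n : ℝ) ≤ n ^ 2 := by nlinarith
      have d2 := mul_le_mul_of_nonneg_left d1 hlam.le
      have d3 := mul_le_mul_of_nonneg_left hn hlam.le
      linarith
    have hfin : ((n : ℝ) ^ 2 + lam * n + n + lam) * (2 * S)
        ≤ D * (n ^ 5 * Real.exp (-(γ * n))) := by
      calc ((n : ℝ) ^ 2 + lam * n + n + lam) * (2 * S)
          ≤ ((2 + 2 * lam) * n ^ 2) *
            (2 * ((j + 1) * 2 / (lam * (1 - p) ^ j * c) * (n ^ 3 * δ))) := by gcongr
        _ = D * (n ^ 5 * δ) := by rw [hD]; ring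
        _ ≤ D * (n ^ 5 * Real.exp (-(γ * n))) := by gcongr
    have e1 : (∑ Z, μ Z * aDist p lam Z) / n - p * (1 - ρ)
        = (∑ Z, μ Z * aDist p lam Z - p * (n - k : ℕ)) / n
          + p * (((n - k : ℕ) : ℝ) / n - (1 - ρ)) := by ring
    rw [e1]
    refine (abs_add_le _ _).trans ?_
    rw [abs_mul, abs_of_pos hp0, abs_div, abs_of_pos hn0, add_comm]
    refine add_le_add le_rfl ?_
    refine (div_le_self (abs_nonneg _) hn).trans (hflux.trans hfin)

theorem mainTheorem5 (p ρ : ℝ) (hp0 : 0 < p) (hp1 : p < 1) (hρ0 : 0 < ρ) (hρ1 : ρ < 1)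
    (hρh : ρ ≠ p / (1 + p)) :
    ∃ (φ : ℝ → ℝ) (φA : ℝ),
      (∀ π ∈ Set.Ioo (0 : ℝ) 1, IsZeroRangeFlux p π ρ (φ π)) ∧
      Tendsto φ (𝓝[<] 1) (𝓝 φA) ∧
      (ρ < p / (1 + p) → φA = ρ) ∧
      (p / (1 + p) < ρ → φA = p * (1 - ρ)) ∧
      (∀ lam : ℝ, 0 < lam → IsTypicalFlux p lam ρ φA) ∧
      (ρ < 1 / 2 → IsZeroRangeFlux p 1 ρ (φ 1)) ∧
      (p / (1 + p) < ρ → ρ < 1 / 2 → ¬ ContinuousWithinAt φ (Set.Ioc 0 1) 1) := by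
  obtain ⟨φ, hφ, hlim⟩ := exists_zeroRangeFlux hp0 hp1 hρ0 hρ1
  have h1ρ : 0 < 1 - ρ := by linarith
  have hlow : ρ < p / (1 + p) → ρ / (1 - ρ) < p := by
    intro h
    rw [lt_div_iff₀ (by linarith)] at h
    rw [div_lt_iff₀ h1ρ]
    linarith
  have hhigh : p / (1 + p) < ρ → p < ρ / (1 - ρ) := by
    intro h
    rw [div_lt_iff₀ (by linarith)] at h
    rw [lt_div_iff₀ h1ρ]
    linarith
  have hAlow : ρ < p / (1 + p) → (1 - ρ) * min p (ρ / (1 - ρ)) = ρ := by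
    intro h
    rw [min_eq_right (hlow h).le, mul_div_cancel₀ _ h1ρ.ne']
  have hAhigh : p / (1 + p) < ρ → (1 - ρ) * min p (ρ / (1 - ρ)) = p * (1 - ρ) := by
    intro h
    rw [min_eq_left (hhigh h).le, mul_comm]
  -- The flux function is so far constrained only on (0, 1); its value at 1 is set to ρ, which does
  -- not affect the left limit.
  have hlim' : Tendsto (Function.update φ 1 ρ) (𝓝[<] 1) (𝓝 ((1 - ρ) * min p (ρ / (1 - ρ)))) := by
    refine hlim.congr' ?_
    filter_upwards [self_mem_nhdsWithin] with π hπ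
    rw [Function.update_of_ne (ne_of_lt hπ)]
  refine ⟨Function.update φ 1 ρ, (1 - ρ) * min p (ρ / (1 - ρ)), fun π hπ => ?_, hlim', hAlow, hAhigh,
    fun lam hlam => ?_, fun h => ?_, fun h1 h2 hcont => ?_⟩
  · rw [Function.update_of_ne hπ.2.ne]
    exact hφ π hπ
  · rcases lt_or_gt_of_ne hρh with h | h
    · rw [hAlow h]
      exact isTypicalFlux_of_lt hp0 hp1 hρ0 hρ1 (hlow h) hlam
    · rw [hAhigh h]
      exact isTypicalFlux_of_gt hp0 hp1 hρ0 hρ1 (hhigh h) hlam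
  · rw [Function.update_self]
    exact isZeroRangeFlux_one hp0 hp1 hρ0 h
  · have h3 : Tendsto (Function.update φ 1 ρ) (𝓝[<] 1) (𝓝 ρ) := by
      have := hcont.tendsto
      rw [Function.update_self] at this
      refine this.mono_left ?_
      rw [← nhdsWithin_Ioo_eq_nhdsLT (zero_lt_one' ℝ)]
      exact nhdsWithin_mono _ Set.Ioo_subset_Ioc_self
    -- Continuity at 1 would give p (1 - ρ) = ρ, that is ρ = p / (1 + p), contrary to `h1`.
    have h4 := tendsto_nhds_unique hlim' h3
    rw [hAhigh h1] at h4
    rw [div_lt_iff₀ (by linarith)] at h1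
    linarith

end Main
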